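/- **Setting.** Let $q>4$, let $\lambda>0$ satisfy $\sqrt q=e^{\lambda}+e^{-\lambda}$, and put $p_c=\frac{\sqrt q}{1+\sqrt q}$, $\mathbf c=e^{\lambda/2}+e^{-\lambda/2}$, $\mathbf c_{\mathrm b}=e^{\lambda/2}$. Let $\mathbb L_\bullet=\mathbb Z^2$ with its set $\mathbb E^\bullet$ of nearest-neighbour edges, $\mathbb L_\circ=(\frac12,\frac12)+\mathbb Z^2$, and for an edge $e$ of $\mathbb Z^2$ let $e^*$ be the dual edge crossing it. The tile $t$ of $e=e_t$ is the convex hull of the endpoints of $e_t$ and $e_t^*$; $\mathbb L_\diamond$ is the set of tiles. Let $\mathbb H^+=\{y\ge 0\}$ and $\mathbb H^-=\{y<0\}$. For integers $n,m\ge 0$ let $\mathsf B=\{-n,\dots,n\}\times\{-m,\dots,m\}$, $\mathsf B'=\{-n-\frac12,\dots,n+\frac12\}\times\{-m-\frac12,\dots,m+\frac12\}$, $\mathsf D=\mathsf B\cup\mathsf B'$. Let $\mathsf G=(\mathsf V,\mathsf E)$, where $\mathsf V$ is $\mathsf B$ with its exterior vertex boundary $\partial^{\mathrm{ex}}\mathsf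 B$ and $\mathsf E$ is the set of edges with at least one endpoint in $\mathsf B$; let $\partial^{\pm}=\partial^{\mathrm{ex}}\mathsf B\cap\mathbb H^{\pm}$. Boundary tiles are the tiles with exactly one corner in $\mathsf D$, interior tiles are those with at least two. **FK measure and coupling.** Let $\mathtt{FK}^{1/1}_{\mathsf G}$ be the probability measure on $\{0,1\}^{\mathbb E^\bullet}$ with $\mathtt{FK}^{1/1}_{\mathsf G}(\omega)\propto p_c^{|\omega\cap \mathsf E|}(1-p_c)^{|\mathsf E\setminus\omega|}q^{\kappa_{\mathsf V}(\omega)}$ if, outside $\mathsf E$, the open edges of $\omega$ are precisely those contained in $\mathbb H^+$ or in $\mathbb H^-$, and $0$ otherwise, where $\kappa_{\mathsf V}(\omega)$ is the number of clusters of $(\mathbb Z^2,\omega)$ that intersect $\mathsf V$. On each tile draw two quarter-turn arcs linking midpoints of sides: around the two endpoints of $e_t^*$ if $e_t$ is open in $\omega$, and around the two endpoints of $e_t$ if it is closed. The arcs form the loop configuration $\ell$ of $\omega$, made of loops and bi-infinite paths. Let $\mathcal L$ be the countable set of all loops that can be drawn in this way, and let $(\omega,U,U')$ have law $$\Psi=\mathtt{FK}^{1/1}_{\mathsf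 G}(\,\cdot\mid\partial^+\nleftrightarrow\partial^-)\otimes Q\otimes Q',$$ where $Q$ and $Q'$ are the laws of independent uniform variables on $[0,1]$ indexed by $\mathcal L$ and by $\mathbb L_\diamond$, respectively. **Orientation and spins.** Orient $\ell$ as follows: each loop surrounding a vertex of $\mathbb L_\circ\setminus\mathsf B'$ is oriented clockwise; the bi-infinite paths are oriented from right to left; each loop $l$ surrounding a vertex of $\mathsf B\cup\mathsf B'$ is oriented clockwise if $U_l<e^{\lambda}/\sqrt q$ and counter-clockwise otherwise. The orientation gives a direction to each medial edge (the edge joining two adjacent tiles across their common side, which separates some $i\in\mathbb L_\bullet$ from some $u\in\mathbb L_\circ$). Let $(\sigma_\bullet,\sigma_\circ)\in\{\pm1\}^{\mathbb L_\bullet}\times\{\pm1\}^{\mathbb L_\circ}$ be such that $\sigma_\bullet((n+1,0))=+1$ and, for each medial edge, $\sigma_\bullet(i)=\sigma_\circ(u)$ if $i$ is to its left and $\sigma_\bullet(i)=-\sigma_\circ(u)$ if $i$ is to its right. **Lemma.** Almost surely, the rules above determine exactly one orientation of $\ell$ and exactly one pair $(\sigma_\bullet,\sigma_\circ)$. The law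 of $(\sigma_\bullet,\sigma_\circ)$ is the probability measure $$\mathtt{Spin}_{\mathsf D}^{+-,+-}(\sigma)\propto \mathbf c^{|T^{\mathrm i}_{5,6}(\sigma)|}\,\mathbf c_{\mathrm b}^{|T^{\mathrm b}_{5,6}(\sigma)|}\,\mathbf 1_{\mathrm{bc}}(\sigma)\,\mathbf 1_{\mathrm{ice}}(\sigma).$$ Here $T^{\mathrm i}_{5,6}(\sigma)$ and $T^{\mathrm b}_{5,6}(\sigma)$ are the sets of interior, respectively boundary, tiles $t$ of type 5 or 6, i.e. such that $\sigma_\bullet$ is constant on the endpoints of $e_t$ and $\sigma_\circ$ is constant on the endpoints of $e_t^*$. The condition $\mathrm{bc}$ is that $\sigma_\bullet$ on $\mathbb L_\bullet\setminus\mathsf B$ and $\sigma_\circ$ on $\mathbb L_\circ\setminus\mathsf B'$ equal $+1$ on $\mathbb H^+$ and $-1$ on $\mathbb H^-$. The condition $\mathrm{ice}$ is that $(\sigma_\bullet(i)-\sigma_\bullet(j))(\sigma_\circ(u)-\sigma_\circ(v))=0$ for every tile with $e_t=ij$ and $e_t^*=uv$. -/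

import Mathlib

open MeasureTheory ProbabilityTheory Filter

namespace BKW

noncomputable section

/-! ### Lattices

All lattice points are written in doubled coordinates: `(X, Y) : ℤ × ℤ` stands for the point
`(X / 2, Y / 2)` of the plane.  Points of `ℤ²` have two even coordinates, points of the dual
lattice `(1/2, 1/2) + ℤ²` have two odd coordinates, and the centres of the tiles (that is, the
midpoints of the primal edges) have coordinates of different parities. -/

/-- A point of the plane with half-integer coordinates, in doubled coordinates. -/
abbrev Pt := ℤ × ℤ

/-- Being a vertex of the primal lattice `ℤ²`. -/
def IsPrimal (v : Pt) : Prop := Even v.1 ∧ Even v.2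

/-- Being a vertex of the dual lattice `(1/2, 1/2) + ℤ²`. -/
def IsDual (v : Pt) : Prop := Odd v.1 ∧ Odd v.2

/-- The primal lattice. -/
abbrev Primal := {v : Pt // IsPrimal v}

/-- The dual lattice. -/
abbrev Dual := {v : Pt // IsDual v}

/-- The lozenge tiles, given by their centres.  The tile `t` corresponds to the primal edge `e_t`
and to the dual edge `e_t*` whose common midpoint is `t`. -/
abbrev Tile := {t : Pt // Odd (t.1 + t.2)}

/-- `v` is one of the four corners of the tile centred at `t`.  The two primal corners are the
endpoints of `e_t`, the two dual corners are the endpoints of `e_t*`. -/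
def IsCorner (v t : Pt) : Prop := |v.1 - t.1| + |v.2 - t.2| = 1

/-! ### Percolation configurations and FK percolation -/

/-- Percolation configurations on the edges of `ℤ²`; edges are identified with tiles. -/
abbrev Config := Tile → Bool

/-- The spanning subgraph of `ℤ²` formed by the open edges of `ω`. -/
def openGraph (ω : Config) : SimpleGraph Primal where
  Adj i j := i ≠ j ∧ ∃ t : Tile, ω t = true ∧ IsCorner i.1 t.1 ∧ IsCorner j.1 t.1
  symm := ⟨fun _ _ h => ⟨h.1.symm, h.2.choose, h.2.choose_spec.1, h.2.choose_spec.2.2,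
    h.2.choose_spec.2.1⟩⟩
  loopless := ⟨fun _ h => h.1 rfl⟩

/-- The square grid `ℤ²`. -/
def latticeGraph : SimpleGraph Primal := openGraph fun _ => true

/-- The exterior vertex boundary of a set of vertices. -/
def exBoundary (L : Set Primal) : Set Primal :=
  {y | y ∉ L ∧ ∃ x ∈ L, latticeGraph.Adj x y}

/-- The edges with both endpoints in `L`. -/
def edgesWithin (L : Set Primal) : Set Tile :=
  {t | ∀ i : Primal, IsCorner i.1 t.1 → i ∈ L}

/-- The edges with one endpoint in `L` and the other one outside. -/
def edgeBoundary (L : Set Primal) : Set Tile :=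
  {t | (∃ i ∈ L, IsCorner i.1 t.1) ∧ ∃ j, j ∉ L ∧ IsCorner j.1 t.1}

/-- The number of clusters of `η` that intersect `V`. -/
def numClusters (V : Set Primal) (η : Config) : ℕ :=
  {C : (openGraph η).ConnectedComponent |
    ∃ i ∈ V, (openGraph η).connectedComponentMk i = C}.ncard

/-- The measure proportional to the non-negative weight `w`, normalised to have mass one
(for a weight with finite support that is not identically zero). -/
def proportionalTo {X : Type*} [MeasurableSpace X] (w : X → ℝ) : Measure X :=
  (∑' x, ENNReal.ofReal (w x))⁻¹ • Measure.sum fun x => ENNReal.ofReal (w x) • Measure.dirac x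

open Classical in
/-- The FK weight on the finite graph `(V, E)` with boundary condition `ξ`. -/
def fkWeight (V : Set Primal) (E : Set Tile) (ξ : Config) (p q : ℝ) (η : Config) : ℝ :=
  if ∀ t, t ∉ E → η t = ξ t then
    p ^ {t | t ∈ E ∧ η t = true}.ncard * (1 - p) ^ {t | t ∈ E ∧ η t = false}.ncard *
      q ^ numClusters V η
  else 0

/-- The FK-percolation measure on the finite graph `(V, E)` with boundary condition `ξ`. -/
def fkMeasure (V : Set Primal) (E : Set Tile) (ξ : Config) (p q : ℝ) : Measure Config :=
  proportionalTo (fkWeight V E ξ p q)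

/-! ### Rectangular domains (recall that coordinates are doubled) -/

/-- `v` is a vertex of `B = {-n, …, n} × {-m, …, m}`. -/
def InB (n m : ℕ) (v : Pt) : Prop := IsPrimal v ∧ |v.1| ≤ 2 * n ∧ |v.2| ≤ 2 * m

/-- `v` is a vertex of `B' = {-n-1/2, …, n+1/2} × {-m-1/2, …, m+1/2}`. -/
def InB' (n m : ℕ) (v : Pt) : Prop := IsDual v ∧ |v.1| ≤ 2 * n + 1 ∧ |v.2| ≤ 2 * m + 1

/-- The set `B` of primal vertices. -/
def boxB (n m : ℕ) : Set Primal := {i | InB n m i.1}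

/-- The vertices of the graph `G`: the box `B` with its exterior boundary. -/
def boxV (n m : ℕ) : Set Primal := boxB n m ∪ exBoundary (boxB n m)

/-- The edges of the graph `G`: those within `B` and those between `B` and its complement. -/
def boxE (n m : ℕ) : Set Tile := edgesWithin (boxB n m) ∪ edgeBoundary (boxB n m)

/-- The part `∂⁺` of the exterior boundary of `B` in the upper half-plane `y ≥ 0`. -/
def upperBoundary (n m : ℕ) : Set Primal := {i | i ∈ exBoundary (boxB n m) ∧ 0 ≤ i.1.2}

/-- The part `∂⁻` of the exterior boundary of `B` in the lower half-plane `y < 0`. -/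
def lowerBoundary (n m : ℕ) : Set Primal := {i | i ∈ exBoundary (boxB n m) ∧ i.1.2 < 0}

open Classical in
/-- The wired-wired Dobrushin boundary condition: an edge is open iff it is contained in the upper
half-plane `y ≥ 0` or in the lower half-plane `y < 0`. -/
def wiredWired : Config := fun t =>
  decide ((∀ i : Primal, IsCorner i.1 t.1 → 0 ≤ i.1.2) ∨
    ∀ i : Primal, IsCorner i.1 t.1 → i.1.2 < 0)

/-- The critical parameter `√q / (1 + √q)`. -/
def criticalP (q : ℝ) : ℝ := √q / (1 + √q)

/-- The event that `∂⁺` and `∂⁻` are not connected by open edges. -/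
def disconnectedBoundaries (n m : ℕ) : Set Config :=
  {ω | ∀ i ∈ upperBoundary n m, ∀ j ∈ lowerBoundary n m, ¬ (openGraph ω).Reachable i j}

/-- The FK measure on `G` at criticality under wired-wired boundary conditions, conditioned on
`∂⁺` and `∂⁻` not being connected. -/
def conditionedFK (n m : ℕ) (q : ℝ) : Measure Config :=
  cond (fkMeasure (boxV n m) (boxE n m) wiredWired (criticalP q) q) (disconnectedBoundaries n m)

/-! ### Loops

A medial edge joins two adjacent tiles and crosses their common side, which has one primal and one
dual endpoint. -/

/-- A directed medial edge, from the tile `src` to the adjacent tile with centre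
`src + (dx, dy)`, where `dx, dy ∈ {1, -1}`. -/
@[ext] structure DirEdge where
  src : Tile
  dx : ℤˣ
  dy : ℤˣ

namespace DirEdge

theorem odd_target (d : DirEdge) : Odd ((d.src.1.1 + (d.dx : ℤ)) + (d.src.1.2 + (d.dy : ℤ))) := by
  obtain ⟨⟨⟨a, b⟩, h⟩, x, y⟩ := d
  rcases Int.units_eq_one_or x with rfl | rfl <;> rcases Int.units_eq_one_or y with rfl | rfl <;>
    · simp only [Units.val_one, Units.val_neg, Int.odd_iff] at h ⊢
      omega

/-- The tile at which `d` arrives. -/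
def tgt (d : DirEdge) : Tile := ⟨(d.src.1.1 + (d.dx : ℤ), d.src.1.2 + (d.dy : ℤ)), d.odd_target⟩

/-- The same medial edge with the opposite direction. -/
def rev (d : DirEdge) : DirEdge := ⟨d.tgt, -d.dx, -d.dy⟩

/-- The vertex (primal or dual) to the left of `d`: the midpoint of `d` plus half of the direction
`(dx, dy)` turned by a quarter-turn to the left.  The divisions are exact. -/
def left (d : DirEdge) : Pt :=
  (d.src.1.1 + ((d.dx : ℤ) - d.dy) / 2, d.src.1.2 + ((d.dy : ℤ) + d.dx) / 2)

/-- The vertex (primal or dual) to the right of `d`. -/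
def right (d : DirEdge) : Pt :=
  (d.src.1.1 + ((d.dx : ℤ) + d.dy) / 2, d.src.1.2 + ((d.dy : ℤ) - d.dx) / 2)

end DirEdge

/-- The two loop arcs on a tile turn around the dual corners if the primal edge is open and around
the primal corners if it is closed.  `TurnsLeft ω d` says that the arc of `ω` that continues the
directed medial edge `d` on the tile where `d` arrives turns around the vertex to the left of `d`
(otherwise it turns around the vertex to the right of `d`). -/
def TurnsLeft (ω : Config) (d : DirEdge) : Prop := IsPrimal d.left ↔ ω d.tgt = false

open Classical in
/-- The directed medial edge that follows `d` along the arcs of `ω`. -/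
def step (ω : Config) (d : DirEdge) : DirEdge :=
  if TurnsLeft ω d then ⟨d.tgt, -d.dy, d.dx⟩ else ⟨d.tgt, d.dy, -d.dx⟩

/-- A loop arc: the quarter-turn on a tile (first component) around one of the corners of the tile
(second component). -/
abbrev Arc := Tile × Pt

open Classical in
/-- The arc of `ω` between `d` and `step ω d`. -/
def arcAfter (ω : Config) (d : DirEdge) : Arc :=
  (d.tgt, if TurnsLeft ω d then d.left else d.right)

/-- The directed medial edge `d` lies on a (finite) loop of `ω`; otherwise it lies on a bi-infinite
path. -/
def OnLoop (ω : Config) (d : DirEdge) : Prop := d ∈ Function.periodicPts (step ω)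

/-- The unoriented loop of `ω` through `d`, as a set of arcs. -/
def loopThrough (ω : Config) (d : DirEdge) : Set Arc :=
  {a | ∃ k : ℕ, a = arcAfter ω ((step ω)^[k] d)}

/-- The set of all unoriented loops drawn on the tiles. -/
abbrev Loop := {l : Set Arc // ∃ ω d, OnLoop ω d ∧ l = loopThrough ω d}

/-- The loop of `ω` through `d` crosses the side with endpoints `v` and `w`. -/
def Crosses (ω : Config) (d : DirEdge) (v w : Pt) : Prop :=
  ∃ k : ℕ, s(((step ω)^[k] d).left, ((step ω)^[k] d).right) = s(v, w)

/-- The loop of `ω` through `d` surrounds the primal or dual vertex `v`: the diagonal ray from `v`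
in direction `(1, 1)`, which runs alternately through primal and dual vertices and along sides of
tiles, crosses the loop an odd number of times. -/
def Surrounds (ω : Config) (d : DirEdge) (v : Pt) : Prop :=
  Odd {j : ℕ | Crosses ω d (v.1 + j, v.2 + j) (v.1 + j + 1, v.2 + j + 1)}.ncard

/-- The loop through `d`, oriented along `d`, is clockwise: its inside is to the right. -/
def Clockwise (ω : Config) (d : DirEdge) : Prop := Surrounds ω d d.right

/-- The loop through `d`, oriented along `d`, is counter-clockwise: its inside is to the left. -/
def CounterClockwise (ω : Config) (d : DirEdge) : Prop := Surrounds ω d d.left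

/-- The bi-infinite path through `d`, oriented along `d`, goes from right to left. -/
def RightToLeft (ω : Config) (d : DirEdge) : Prop :=
  Tendsto (fun k : ℕ => ((step ω)^[k] d).src.1.1) atTop atBot ∧
    Tendsto (fun k : ℕ => ((step ω)^[k] d.rev).src.1.1) atTop atTop

/-- `o` is an orientation of the loops and bi-infinite paths of `ω`: every medial edge receives
exactly one direction, and the directions match along the arcs. -/
structure IsOrientation (ω : Config) (o : Set DirEdge) : Prop where
  one_direction : ∀ d, d ∈ o ↔ d.rev ∉ o
  matching : ∀ d ∈ o, step ω d ∈ o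

/-- `o` is the oriented loop configuration obtained from `ω` and the numbers `U`, where
`r` is the threshold under which a loop inside the domain is oriented clockwise. -/
structure IsOrientedBy (n m : ℕ) (r : ℝ) (ω : Config) (U : Loop → unitInterval)
    (o : Set DirEdge) : Prop extends IsOrientation ω o where
  outside : ∀ d ∈ o, OnLoop ω d → (∃ u, IsDual u ∧ ¬ InB' n m u ∧ Surrounds ω d u) →
    Clockwise ω d
  biinfinite : ∀ d ∈ o, ¬ OnLoop ω d → RightToLeft ω d
  inside_lt : ∀ d ∈ o, OnLoop ω d → (∃ v, (InB n m v ∨ InB' n m v) ∧ Surrounds ω d v) →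
    ∀ l : Loop, l.1 = loopThrough ω d → (U l : ℝ) < r → Clockwise ω d
  inside_ge : ∀ d ∈ o, OnLoop ω d → (∃ v, (InB n m v ∨ InB' n m v) ∧ Surrounds ω d v) →
    ∀ l : Loop, l.1 = loopThrough ω d → r ≤ (U l : ℝ) → CounterClockwise ω d

/-! ### Six-vertex spins -/

/-- Pairs of spin configurations on the primal and on the dual lattice. -/
abbrev SpinPair := (Primal → ℤˣ) × (Dual → ℤˣ)

/-- The spins `σ` represent the six-vertex edge orientations `o`: for a directed medial edge that
separates the primal vertex `i` from the dual vertex `u`, the spins at `i` and `u` agree if `i` is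
to the left and disagree if `i` is to the right. -/
def IsSpinRepresentation (o : Set DirEdge) (σ : SpinPair) : Prop :=
  ∀ d ∈ o, ∀ (i : Primal) (u : Dual),
    (d.left = i.1 → d.right = u.1 → σ.1 i = σ.2 u) ∧
    (d.right = i.1 → d.left = u.1 → σ.1 i = -σ.2 u)

/-- The primal vertex `(n + 1, 0)`. -/
def rightVertex (n : ℕ) : Primal :=
  ⟨(2 * ((n : ℤ) + 1), 0), ⟨even_two_mul _, Even.zero⟩⟩

/-- `σ` is the spin pair, with spin `+1` at `(n + 1, 0)`, associated with the oriented loop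
configuration obtained from `ω` and `U`. -/
def IsInducedSpin (n m : ℕ) (r : ℝ) (ω : Config) (U : Loop → unitInterval) (σ : SpinPair) : Prop :=
  ∃ o, IsOrientedBy n m r ω U o ∧ IsSpinRepresentation o σ ∧ σ.1 (rightVertex n) = 1

/-- The ice rule. -/
def IceRule (σ : SpinPair) : Prop :=
  ∀ (t : Tile) (i j : Primal) (u v : Dual), IsCorner i.1 t.1 → IsCorner j.1 t.1 →
    IsCorner u.1 t.1 → IsCorner v.1 t.1 →
    ((σ.1 i : ℤ) - (σ.1 j : ℤ)) * ((σ.2 u : ℤ) - (σ.2 v : ℤ)) = 0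

/-- The tile `t` is of type 5 or 6: both spin configurations are constant on its corners. -/
def IsType56 (σ : SpinPair) (t : Tile) : Prop :=
  (∀ i j : Primal, IsCorner i.1 t.1 → IsCorner j.1 t.1 → σ.1 i = σ.1 j) ∧
    ∀ u v : Dual, IsCorner u.1 t.1 → IsCorner v.1 t.1 → σ.2 u = σ.2 v

/-- The number of corners of `t` in `D = B ∪ B'`. -/
def cornersInD (n m : ℕ) (t : Tile) : ℕ :=
  {v : Pt | IsCorner v t.1 ∧ (InB n m v ∨ InB' n m v)}.ncard

/-- The boundary tiles: those with precisely one corner in `D`. -/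
def boundaryTiles (n m : ℕ) : Set Tile := {t | cornersInD n m t = 1}

/-- The interior tiles: those with at least one corner in `D` that are not boundary tiles. -/
def interiorTiles (n m : ℕ) : Set Tile := {t | 1 ≤ cornersInD n m t ∧ t ∉ boundaryTiles n m}

/-- The sign `+1` in the upper half-plane `y ≥ 0` and `-1` in the lower half-plane `y < 0`. -/
def dobrushinSign (v : Pt) : ℤˣ := if 0 ≤ v.2 then 1 else -1

/-- The double Dobrushin boundary conditions. -/
def DobrushinBC (n m : ℕ) (σ : SpinPair) : Prop :=
  (∀ i : Primal, ¬ InB n m i.1 → σ.1 i = dobrushinSign i.1) ∧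
    ∀ u : Dual, ¬ InB' n m u.1 → σ.2 u = dobrushinSign u.1

open Classical in
/-- The weight of a spin pair: `c` per interior tile and `cb` per boundary tile of type 5 or 6. -/
def spinWeight (n m : ℕ) (c cb : ℝ) (σ : SpinPair) : ℝ :=
  if DobrushinBC n m σ ∧ IceRule σ then
    c ^ {t | t ∈ interiorTiles n m ∧ IsType56 σ t}.ncard *
      cb ^ {t | t ∈ boundaryTiles n m ∧ IsType56 σ t}.ncard
  else 0

/-- The six-vertex spin measure under double Dobrushin conditions. -/
def spinMeasure (n m : ℕ) (c cb : ℝ) : Measure SpinPair :=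
  proportionalTo (spinWeight n m c cb)

/-! ### The coupling measure -/

/-- The product of the conditioned FK measure with the laws of independent uniform random variables
indexed by all loops and by all tiles. -/
def couplingMeasure (n m : ℕ) (q : ℝ) :
    Measure (Config × (Loop → unitInterval) × (Tile → unitInterval)) :=
  (conditionedFK n m q).prod
    ((Measure.infinitePi fun _ : Loop => (volume : Measure unitInterval)).prod
      (Measure.infinitePi fun _ : Tile => (volume : Measure unitInterval)))

end

end BKW

open BKW

namespace BKW

noncomputable section

/-! ### Geometry of medial edges -/

/-! This is the Baxter–Kelland–Wu argument. For fixed spins, the joint weight of a percolation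
configuration and of the orientations of its loops is summed over the configurations that can
produce these spins, and the sum factorises over tiles.

Deterministic part. On the support of the conditioned measure (`Admissible`) the vertices outside
`B` form, in each half-plane, part of a single unbounded cluster, and these two clusters are
distinct. Surrounding is defined by a parity of crossings, and a loop separates the two sides of
exactly those medial edges that it uses (`hits_iff`); hence being surrounded is constant along open
edges and along the duals of closed edges. It follows that a loop meeting the outside is a small
loop around a single dual vertex, and that every path which is not a loop ends up on the line y =
-1/2. The orientation rules therefore never conflict and leave exactly one orientation
(`Admissible.isOrientedBy_iff`). An orientation is a connection with values in {1, -1} on the sides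
of tiles. It is flat around every tile because each arc carries one direction, so it integrates to
spins (`exists_vertex_potential`), and these are unique once one spin is prescribed
(`orientationOf_injective`). `Admissible.isInducedSpin_iff` inverts the construction: the induced
spins are those that satisfy the boundary conditions, are constant on open edges and on duals of
closed edges, and orient the loops inside as the uniform variables prescribe.

Weights. A loop inside is clockwise with probability exp(λ)/√q and counter-clockwise with
probability exp(-λ)/√q, so it contributes a factor 1/√q and a factor exp(±λ). Both have to be made
local, and both are handled by a discrete theorem of turning tangents: a loop makes four more turns
to one side than to the other (`sum_turn_orbit`), and the portion of a bi-infinite path inside the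
domain contributes zero turning (`sum_turn_path`). `Admissible.sum_signed_turn` packages this as a
sum over medial edges. For the orientation that keeps primal vertices on the left, it becomes an
Euler relation (`exists_euler_constant`): the number of open edges plus twice the number of clusters
minus the number of loops is constant. At the critical point this cancels all powers of √q. For the
orientation given by the spins, it turns the product of the factors exp(±λ) into a product over
tiles (`Admissible.sum_loops_eq`).

On a graph tile of type 5 or 6 both states are compatible with the spins and contribute exp(λ/2) and
exp(-λ/2), whose sum is the weight c; on any other graph tile the ice rule leaves one state, with
factor 1. A boundary tile has a fixed state and contributes, up to a constant, exp(λ/2) exactly when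
it is of type 5 or 6. Thus the law is proportional to the six-vertex weight, and the total mass
fixes the constant. -/

theorem units_cases (u : ℤˣ) : (u : ℤ) = 1 ∨ (u : ℤ) = -1 := by
  rcases Int.units_eq_one_or u with rfl | rfl <;> simp

theorem units_sign_ext {u v : ℤˣ} (h : (u : ℤ) = v) : u = v := Units.ext h

namespace DirEdge

theorem left_fst (d : DirEdge) : d.left.1 = d.src.1.1 + ((d.dx : ℤ) - d.dy) / 2 := rfl
theorem left_snd (d : DirEdge) : d.left.2 = d.src.1.2 + ((d.dy : ℤ) + d.dx) / 2 := rfl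
theorem right_fst (d : DirEdge) : d.right.1 = d.src.1.1 + ((d.dx : ℤ) + d.dy) / 2 := rfl
theorem right_snd (d : DirEdge) : d.right.2 = d.src.1.2 + ((d.dy : ℤ) - d.dx) / 2 := rfl
theorem tgt_fst (d : DirEdge) : d.tgt.1.1 = d.src.1.1 + d.dx := rfl
theorem tgt_snd (d : DirEdge) : d.tgt.1.2 = d.src.1.2 + d.dy := rfl

theorem right_fst_eq (d : DirEdge) : d.right.1 = d.left.1 + d.dy := by
  rw [left_fst, right_fst]
  rcases units_cases d.dx with hx | hx <;> rcases units_cases d.dy with hy | hy <;>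
    rw [hx, hy] <;> omega

theorem right_snd_eq (d : DirEdge) : d.right.2 = d.left.2 - d.dx := by
  rw [left_snd, right_snd]
  rcases units_cases d.dx with hx | hx <;> rcases units_cases d.dy with hy | hy <;>
    rw [hx, hy] <;> omega

/-- The target is the midpoint of the crossed side plus half the direction; doubling removes the
divisions and leaves linear relations for `omega`. -/
theorem two_tgt_fst (d : DirEdge) : 2 * d.tgt.1.1 = d.left.1 + d.right.1 + d.dx := by
  rw [left_fst, right_fst, tgt_fst]
  rcases units_cases d.dx with hx | hx <;> rcases units_cases d.dy with hy | hy <;>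
    rw [hx, hy] <;> omega

theorem two_tgt_snd (d : DirEdge) : 2 * d.tgt.1.2 = d.left.2 + d.right.2 + d.dy := by
  rw [left_snd, right_snd, tgt_snd]
  rcases units_cases d.dx with hx | hx <;> rcases units_cases d.dy with hy | hy <;>
    rw [hx, hy] <;> omega

theorem ext_sides {d e : DirEdge} (hl : d.left = e.left) (hr : d.right = e.right) : d = e := by
  have h1 := right_fst_eq d
  have h2 := right_snd_eq d
  have h3 := right_fst_eq e
  have h4 := right_snd_eq e
  have hx : d.dx = e.dx := units_sign_ext (by rw [hl, hr] at h2; omega)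
  have hy : d.dy = e.dy := units_sign_ext (by rw [hl, hr] at h1; omega)
  have h5 := two_tgt_fst d
  have h6 := two_tgt_fst e
  have h7 := two_tgt_snd d
  have h8 := two_tgt_snd e
  rw [tgt_fst] at h5 h6
  rw [tgt_snd] at h7 h8
  rw [hl, hr, hx] at h5
  rw [hl, hr, hy] at h7
  have hs : d.src = e.src := Subtype.ext (Prod.ext (by omega) (by omega))
  exact DirEdge.ext hs hx hy

theorem rev_left (d : DirEdge) : d.rev.left = d.right := by
  rcases units_cases d.dx with hx | hx <;> rcases units_cases d.dy with hy | hy <;>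
    (ext <;> simp only [left, right, rev, tgt, Units.val_neg, hx, hy] <;> omega)

theorem rev_right (d : DirEdge) : d.rev.right = d.left := by
  rcases units_cases d.dx with hx | hx <;> rcases units_cases d.dy with hy | hy <;>
    (ext <;> simp only [left, right, rev, tgt, Units.val_neg, hx, hy] <;> omega)

@[simp] theorem rev_rev (d : DirEdge) : d.rev.rev = d :=
  ext_sides (by rw [rev_left, rev_right]) (by rw [rev_right, rev_left])

theorem rev_tgt (d : DirEdge) : d.rev.tgt = d.src :=
  Subtype.ext (Prod.ext (by simp [rev, tgt]) (by simp [rev, tgt]))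

theorem primal_left_xor (d : DirEdge) :
    (IsPrimal d.left ∧ IsDual d.right) ∨ (IsDual d.left ∧ IsPrimal d.right) := by
  have h := d.src.2
  have h1 := left_fst d
  have h2 := left_snd d
  have h3 := right_fst_eq d
  have h4 := right_snd_eq d
  simp only [IsPrimal, IsDual, Int.even_iff, Int.odd_iff] at *
  rcases units_cases d.dx with hx | hx <;> rcases units_cases d.dy with hy | hy <;>
    rw [hx] at h1 h2 h4 <;> rw [hy] at h1 h2 h3 <;> omega

theorem exists_sides {v w : Pt} (hv : Even (v.1 + v.2)) (h1 : |w.1 - v.1| = 1)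
    (h2 : |w.2 - v.2| = 1) : ∃ d : DirEdge, d.left = v ∧ d.right = w := by
  obtain ⟨v1, v2⟩ := v
  obtain ⟨w1, w2⟩ := w
  simp only [Int.even_iff] at *
  rcases (abs_eq one_pos.le).1 h1 with h1 | h1 <;> rcases (abs_eq one_pos.le).1 h2 with h2 | h2
  · refine ⟨⟨⟨(v1 + 1, v2), by rw [Int.odd_iff]; omega⟩, -1, 1⟩, ?_, ?_⟩ <;> ext <;>
      simp [left, right] <;> omega
  · refine ⟨⟨⟨(v1, v2 - 1), by rw [Int.odd_iff]; omega⟩, 1, 1⟩, ?_, ?_⟩ <;> ext <;>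
      simp [left, right] <;> omega
  · refine ⟨⟨⟨(v1, v2 + 1), by rw [Int.odd_iff]; omega⟩, -1, -1⟩, ?_, ?_⟩ <;> ext <;>
      simp [left, right] <;> omega
  · refine ⟨⟨⟨(v1 - 1, v2), by rw [Int.odd_iff]; omega⟩, 1, -1⟩, ?_, ?_⟩ <;> ext <;>
      simp [left, right] <;> omega

/-- The primal vertex of `d` lies to its left. -/
def PL (d : DirEdge) : Prop := IsPrimal d.left

theorem not_primal_of_dual {v : Pt} (h : IsDual v) : ¬ IsPrimal v := fun h' => by
  simp only [IsPrimal, IsDual, Int.even_iff, Int.odd_iff] at *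
  omega

open Classical in
/-- The primal vertex on the side of the tile crossed by `d`. -/
def primal (d : DirEdge) : Primal :=
  if h : d.PL then ⟨d.left, h⟩
  else ⟨d.right, (d.primal_left_xor.resolve_left fun h' => h h'.1).2⟩

open Classical in
/-- The dual vertex on the side of the tile crossed by `d`. -/
def dual (d : DirEdge) : Dual :=
  if h : d.PL then ⟨d.right, (d.primal_left_xor.resolve_right
    fun h' => not_primal_of_dual h'.1 h).2⟩
  else ⟨d.left, (d.primal_left_xor.resolve_left fun h' => h h'.1).1⟩

theorem primal_of_PL {d : DirEdge} (h : d.PL) : d.primal.1 = d.left := by simp [primal, h]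
theorem dual_of_PL {d : DirEdge} (h : d.PL) : d.dual.1 = d.right := by simp [dual, h]
theorem primal_of_not_PL {d : DirEdge} (h : ¬ d.PL) : d.primal.1 = d.right := by simp [primal, h]
theorem dual_of_not_PL {d : DirEdge} (h : ¬ d.PL) : d.dual.1 = d.left := by simp [dual, h]

theorem PL_rev (d : DirEdge) : d.rev.PL ↔ ¬ d.PL := by
  unfold PL
  rw [rev_left]
  rcases d.primal_left_xor with h | h
  · exact ⟨fun h' => absurd h' (not_primal_of_dual h.2), fun h' => absurd h.1 h'⟩
  · exact ⟨fun _ => not_primal_of_dual h.1, fun _ => h.2⟩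

theorem primal_rev (d : DirEdge) : d.rev.primal = d.primal := by
  apply Subtype.ext
  by_cases h : d.PL
  · rw [primal_of_not_PL (by rw [PL_rev]; exact not_not.2 h), primal_of_PL h, rev_right]
  · rw [primal_of_PL (by rwa [PL_rev]), primal_of_not_PL h, rev_left]

theorem dual_rev (d : DirEdge) : d.rev.dual = d.dual := by
  apply Subtype.ext
  by_cases h : d.PL
  · rw [dual_of_not_PL (by rw [PL_rev]; exact not_not.2 h), dual_of_PL h, rev_left]
  · rw [dual_of_PL (by rwa [PL_rev]), dual_of_not_PL h, rev_right]

theorem ext_primal_dual {d e : DirEdge} (hp : d.primal = e.primal) (hu : d.dual = e.dual)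
    (h : d.PL ↔ e.PL) : d = e := by
  have hp := congrArg Subtype.val hp
  have hu := congrArg Subtype.val hu
  by_cases hd : d.PL
  · have he := h.1 hd
    rw [primal_of_PL hd, primal_of_PL he] at hp
    rw [dual_of_PL hd, dual_of_PL he] at hu
    exact ext_sides hp hu
  · have he := fun h' => hd (h.2 h')
    rw [primal_of_not_PL hd, primal_of_not_PL he] at hp
    rw [dual_of_not_PL hd, dual_of_not_PL he] at hu
    exact ext_sides hu hp

/-- Coordinates of the ends and of the direction of a medial edge with the primal vertex on its
left. -/
theorem coords_of_PL {d : DirEdge} (h : d.PL) :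
    d.dual.1.1 = d.primal.1.1 + d.dy ∧ d.dual.1.2 = d.primal.1.2 - d.dx ∧
    2 * d.tgt.1.1 = d.primal.1.1 + d.dual.1.1 + d.dx ∧
    2 * d.tgt.1.2 = d.primal.1.2 + d.dual.1.2 + d.dy := by
  rw [primal_of_PL h, dual_of_PL h, two_tgt_fst, two_tgt_snd]
  exact ⟨right_fst_eq d, right_snd_eq d, rfl, rfl⟩

theorem coords_of_not_PL {d : DirEdge} (h : ¬ d.PL) :
    d.dual.1.1 = d.primal.1.1 - d.dy ∧ d.dual.1.2 = d.primal.1.2 + d.dx ∧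
    2 * d.tgt.1.1 = d.primal.1.1 + d.dual.1.1 + d.dx ∧
    2 * d.tgt.1.2 = d.primal.1.2 + d.dual.1.2 + d.dy := by
  rw [primal_of_not_PL h, dual_of_not_PL h, two_tgt_fst, two_tgt_snd]
  have := right_fst_eq d
  have := right_snd_eq d
  refine ⟨?_, ?_, ?_, ?_⟩ <;> omega

/-- The relative position of the vertices and of the target of a medial edge. -/
theorem corner_cases (d : DirEdge) :
    (d.dual.1.1 = d.primal.1.1 + 1 ∨ d.dual.1.1 = d.primal.1.1 - 1) ∧
    (d.dual.1.2 = d.primal.1.2 + 1 ∨ d.dual.1.2 = d.primal.1.2 - 1) ∧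
    ((d.tgt.1.1 = d.primal.1.1 ∧ d.tgt.1.2 = d.dual.1.2) ∨
      (d.tgt.1.1 = d.dual.1.1 ∧ d.tgt.1.2 = d.primal.1.2)) := by
  by_cases h : d.PL
  · obtain ⟨h1, h2, h3, h4⟩ := coords_of_PL h
    rcases units_cases d.dx with hx | hx <;> rcases units_cases d.dy with hy | hy <;>
      rw [hx] at h2 h3 <;> rw [hy] at h1 h4 <;> omega
  · obtain ⟨h1, h2, h3, h4⟩ := coords_of_not_PL h
    rcases units_cases d.dx with hx | hx <;> rcases units_cases d.dy with hy | hy <;>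
      rw [hx] at h2 h3 <;> rw [hy] at h1 h4 <;> omega

/-- The direction of a medial edge is determined by its vertices and the target tile. -/
theorem PL_iff (d : DirEdge) : d.PL ↔
    (d.tgt.1.1 = d.primal.1.1 ↔
      d.dual.1.1 - d.primal.1.1 = d.dual.1.2 - d.primal.1.2) := by
  by_cases h : d.PL
  · obtain ⟨h1, h2, h3, h4⟩ := coords_of_PL h
    refine iff_of_true h ?_
    rcases units_cases d.dx with hx | hx <;> rcases units_cases d.dy with hy | hy <;>
      rw [hx] at h2 h3 <;> rw [hy] at h1 h4 <;> omega
  · obtain ⟨h1, h2, h3, h4⟩ := coords_of_not_PL h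
    refine iff_of_false h ?_
    rcases units_cases d.dx with hx | hx <;> rcases units_cases d.dy with hy | hy <;>
      rw [hx] at h2 h3 <;> rw [hy] at h1 h4 <;> omega

theorem exists_edge (p : Primal) (u : Dual) (h1 : |u.1.1 - p.1.1| = 1) (h2 : |u.1.2 - p.1.2| = 1)
    (b : Prop) : ∃ d : DirEdge, d.primal = p ∧ d.dual = u ∧ (d.PL ↔ b) := by
  have hp : Even (p.1.1 + p.1.2) := p.2.1.add p.2.2
  obtain ⟨d, hl, hr⟩ := exists_sides hp h1 h2
  have hd : d.PL := by rw [PL, hl]; exact p.2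
  have e1 : d.primal = p := Subtype.ext (by rw [primal_of_PL hd, hl])
  have e2 : d.dual = u := Subtype.ext (by rw [dual_of_PL hd, hr])
  by_cases hb : b
  · exact ⟨d, e1, e2, iff_of_true hd hb⟩
  · exact ⟨d.rev, by rw [primal_rev, e1], by rw [dual_rev, e2],
      by rw [PL_rev]; tauto⟩

end DirEdge

/-! ### The arcs of a configuration -/

open DirEdge

theorem turnsLeft_iff (ω : Config) (d : DirEdge) : TurnsLeft ω d ↔ (d.PL ↔ ω d.tgt = false) :=
  Iff.rfl

/-- The turn after `d`: `1` to the left, `-1` to the right. -/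
def turn (ω : Config) (d : DirEdge) : ℤ := by
  classical exact if TurnsLeft ω d then 1 else -1

theorem step_src (ω : Config) (d : DirEdge) : (step ω d).src = d.tgt := by
  unfold step; split_ifs <;> rfl

theorem step_left_of_turnsLeft {ω : Config} {d : DirEdge} (h : TurnsLeft ω d) :
    (step ω d).left = d.left := by
  rw [step, if_pos h]
  rcases units_cases d.dx with hx | hx <;> rcases units_cases d.dy with hy | hy <;>
    (ext <;> simp only [left, tgt, Units.val_neg, hx, hy] <;> omega)

theorem step_right_of_turnsLeft {ω : Config} {d : DirEdge} (h : TurnsLeft ω d) :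
    (step ω d).right = (2 * d.tgt.1.1 - d.right.1, 2 * d.tgt.1.2 - d.right.2) := by
  rw [step, if_pos h]
  rcases units_cases d.dx with hx | hx <;> rcases units_cases d.dy with hy | hy <;>
    (ext <;> simp only [right, tgt, Units.val_neg, hx, hy] <;> omega)

theorem step_right_of_not_turnsLeft {ω : Config} {d : DirEdge} (h : ¬ TurnsLeft ω d) :
    (step ω d).right = d.right := by
  rw [step, if_neg h]
  rcases units_cases d.dx with hx | hx <;> rcases units_cases d.dy with hy | hy <;>
    (ext <;> simp only [right, tgt, Units.val_neg, hx, hy] <;> omega)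

theorem step_left_of_not_turnsLeft {ω : Config} {d : DirEdge} (h : ¬ TurnsLeft ω d) :
    (step ω d).left = (2 * d.tgt.1.1 - d.left.1, 2 * d.tgt.1.2 - d.left.2) := by
  rw [step, if_neg h]
  rcases units_cases d.dx with hx | hx <;> rcases units_cases d.dy with hy | hy <;>
    (ext <;> simp only [left, tgt, Units.val_neg, hx, hy] <;> omega)

theorem isPrimal_reflect (t v : Pt) :
    IsPrimal (2 * t.1 - v.1, 2 * t.2 - v.2) ↔ IsPrimal v := by
  simp only [IsPrimal, Int.even_iff]; omega

/-- An arc turns about one corner, which stays on its side, and the other vertex is reflected in the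
centre of the tile, which preserves the sublattice. So a whole path keeps its primal vertices on one
side. -/
theorem step_PL (ω : Config) (d : DirEdge) : (step ω d).PL ↔ d.PL := by
  unfold PL
  by_cases h : TurnsLeft ω d
  · rw [step_left_of_turnsLeft h]
  · rw [step_left_of_not_turnsLeft h, isPrimal_reflect]

theorem step_primal_of_closed {ω : Config} {d : DirEdge} (h : ω d.tgt = false) :
    (step ω d).primal = d.primal := by
  apply Subtype.ext
  by_cases hd : d.PL
  · have hs := (step_PL ω d).2 hd
    rw [primal_of_PL hd, primal_of_PL hs,
      step_left_of_turnsLeft ((turnsLeft_iff ω d).2 (iff_of_true hd h))]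
  · have hs := mt (step_PL ω d).1 hd
    rw [primal_of_not_PL hd, primal_of_not_PL hs,
      step_right_of_not_turnsLeft (fun h' => hd (((turnsLeft_iff ω d).1 h').2 h))]

theorem step_dual_of_closed {ω : Config} {d : DirEdge} (h : ω d.tgt = false) :
    (step ω d).dual.1 = (2 * d.tgt.1.1 - d.dual.1.1, 2 * d.tgt.1.2 - d.dual.1.2) := by
  by_cases hd : d.PL
  · have hs := (step_PL ω d).2 hd
    rw [dual_of_PL hd, dual_of_PL hs,
      step_right_of_turnsLeft ((turnsLeft_iff ω d).2 (iff_of_true hd h))]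
  · have hs := mt (step_PL ω d).1 hd
    rw [dual_of_not_PL hd, dual_of_not_PL hs,
      step_left_of_not_turnsLeft (fun h' => hd (((turnsLeft_iff ω d).1 h').2 h))]

theorem step_dual_of_open {ω : Config} {d : DirEdge} (h : ω d.tgt = true) :
    (step ω d).dual = d.dual := by
  have h' : ¬ ω d.tgt = false := by simp [h]
  apply Subtype.ext
  by_cases hd : d.PL
  · have hs := (step_PL ω d).2 hd
    rw [dual_of_PL hd, dual_of_PL hs,
      step_right_of_not_turnsLeft (fun ht => h' (((turnsLeft_iff ω d).1 ht).1 hd))]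
  · have hs := mt (step_PL ω d).1 hd
    rw [dual_of_not_PL hd, dual_of_not_PL hs,
      step_left_of_turnsLeft ((turnsLeft_iff ω d).2 (iff_of_false hd h'))]

theorem step_primal_of_open {ω : Config} {d : DirEdge} (h : ω d.tgt = true) :
    (step ω d).primal.1 = (2 * d.tgt.1.1 - d.primal.1.1, 2 * d.tgt.1.2 - d.primal.1.2) := by
  have h' : ¬ ω d.tgt = false := by simp [h]
  by_cases hd : d.PL
  · have hs := (step_PL ω d).2 hd
    rw [primal_of_PL hd, primal_of_PL hs,
      step_left_of_not_turnsLeft (fun ht => h' (((turnsLeft_iff ω d).1 ht).1 hd))]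
  · have hs := mt (step_PL ω d).1 hd
    rw [primal_of_not_PL hd, primal_of_not_PL hs,
      step_right_of_turnsLeft ((turnsLeft_iff ω d).2 (iff_of_false hd h'))]

theorem isCorner_iff (v t : Pt) : IsCorner v t ↔
    (v.1 = t.1 + 1 ∧ v.2 = t.2) ∨ (v.1 = t.1 - 1 ∧ v.2 = t.2) ∨
    (v.1 = t.1 ∧ v.2 = t.2 + 1) ∨ (v.1 = t.1 ∧ v.2 = t.2 - 1) := by
  unfold IsCorner
  rcases abs_cases (v.1 - t.1) with h | h <;> rcases abs_cases (v.2 - t.2) with h' | h' <;> omega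

theorem isCorner_primal (d : DirEdge) : IsCorner d.primal.1 d.tgt.1 := by
  rw [isCorner_iff]
  have := d.corner_cases
  omega

theorem isCorner_dual (d : DirEdge) : IsCorner d.dual.1 d.tgt.1 := by
  rw [isCorner_iff]
  have := d.corner_cases
  omega

theorem isCorner_step_primal (ω : Config) (d : DirEdge) :
    IsCorner (step ω d).primal.1 d.tgt.1 := by
  by_cases h : ω d.tgt = true
  · have := isCorner_primal d
    rw [isCorner_iff] at this ⊢
    rw [step_primal_of_open h]
    dsimp only
    omega
  · rw [step_primal_of_closed (by simpa using h)]
    exact isCorner_primal d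

theorem isCorner_step_dual (ω : Config) (d : DirEdge) :
    IsCorner (step ω d).dual.1 d.tgt.1 := by
  by_cases h : ω d.tgt = true
  · rw [step_dual_of_open h]
    exact isCorner_dual d
  · have := isCorner_dual d
    rw [isCorner_iff] at this ⊢
    rw [step_dual_of_closed (by simpa using h)]
    dsimp only
    omega

/-- On a closed tile the primal vertex is unchanged, and on an open tile it moves along the open
edge. A path therefore follows a single cluster. -/
theorem reachable_step_primal (ω : Config) (d : DirEdge) :
    (openGraph ω).Reachable d.primal (step ω d).primal := by
  by_cases h : ω d.tgt = true
  · apply SimpleGraph.Adj.reachable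
    refine ⟨fun he => ?_, d.tgt, h, isCorner_primal d, isCorner_step_primal ω d⟩
    have h1 := congrArg Subtype.val he
    rw [step_primal_of_open h] at h1
    have h2 := congrArg Prod.fst h1
    have h3 := congrArg Prod.snd h1
    have := d.corner_cases
    dsimp only at h2 h3
    omega
  · rw [step_primal_of_closed (by simpa using h)]

/-- Separates a factor that depends on the direction of the medial edge from one that depends on the
state of the tile. This is what makes signed sums of turns local. -/
theorem turn_eq (ω : Config) (d : DirEdge) [Decidable d.PL] :
    turn ω d = (if d.PL then 1 else -1) * (if ω d.tgt then -1 else 1) := by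
  unfold turn
  rw [show TurnsLeft ω d ↔ _ from turnsLeft_iff ω d]
  by_cases h1 : d.PL <;> cases h2 : ω d.tgt <;> simp [h1]

/-- Reversal conjugates `step` to its inverse; injectivity of `step` and the behaviour of loops and
turns under reversal all come from this. -/
theorem step_rev_step (ω : Config) (d : DirEdge) : step ω (step ω d).rev = d.rev := by
  have ht : (step ω d).rev.tgt = d.tgt := by rw [rev_tgt, step_src]
  refine ext_primal_dual ?_ ?_ (by rw [step_PL, PL_rev, PL_rev, step_PL])
  · apply Subtype.ext
    by_cases h : ω d.tgt = true
    · rw [step_primal_of_open (by rw [ht, h]), ht, primal_rev, primal_rev, step_primal_of_open h]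
      ext <;> simp
    · have h : ω d.tgt = false := by simpa using h
      rw [step_primal_of_closed (by rw [ht, h]), primal_rev, primal_rev, step_primal_of_closed h]
  · apply Subtype.ext
    by_cases h : ω d.tgt = true
    · rw [step_dual_of_open (by rw [ht, h]), dual_rev, dual_rev, step_dual_of_open h]
    · have h : ω d.tgt = false := by simpa using h
      rw [step_dual_of_closed (by rw [ht, h]), ht, dual_rev, dual_rev, step_dual_of_closed h]
      ext <;> simp

/-- The predecessor of a directed medial edge. -/
def pred (ω : Config) (d : DirEdge) : DirEdge := (step ω d.rev).rev

theorem step_pred (ω : Config) (d : DirEdge) : step ω (pred ω d) = d := by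
  rw [pred, step_rev_step, rev_rev]

theorem pred_step (ω : Config) (d : DirEdge) : pred ω (step ω d) = d := by
  rw [pred, step_rev_step, rev_rev]

theorem step_injective (ω : Config) : Function.Injective (step ω) :=
  Function.LeftInverse.injective (pred_step ω)

theorem turn_rev_step (ω : Config) (d : DirEdge) : turn ω (step ω d).rev = - turn ω d := by
  classical
  rw [turn_eq, turn_eq, rev_tgt, step_src, PL_rev, step_PL]
  by_cases h : d.PL <;> cases ω d.tgt <;> simp [h]

theorem turn_pred (ω : Config) (d : DirEdge) : turn ω (pred ω d) = - turn ω d.rev := by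
  have := turn_rev_step ω (pred ω d)
  rw [step_pred] at this
  omega

theorem iterate_step_rev (ω : Config) (d : DirEdge) (k : ℕ) :
    (step ω)^[k] ((step ω)^[k] d).rev = d.rev := by
  induction k with
  | zero => rfl
  | succ k ih => rw [Function.iterate_succ_apply (step ω) k,
      Function.iterate_succ_apply' (step ω) k d, step_rev_step, ih]

theorem iterate_PL (ω : Config) (d : DirEdge) (k : ℕ) : ((step ω)^[k] d).PL ↔ d.PL := by
  induction k with
  | zero => rfl
  | succ k ih => rw [Function.iterate_succ_apply', step_PL, ih]

theorem iterate_reachable (ω : Config) (d : DirEdge) (k : ℕ) :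
    (openGraph ω).Reachable d.primal ((step ω)^[k] d).primal := by
  induction k with
  | zero => rfl
  | succ k ih => rw [Function.iterate_succ_apply']; exact ih.trans (reachable_step_primal ω _)

/-- Following arcs keeps the primal vertices on one side and reversal exchanges the sides, so a path
never runs back along itself. -/
theorem iterate_ne_rev (ω : Config) (d : DirEdge) (j k : ℕ) :
    (step ω)^[j] d ≠ ((step ω)^[k] d).rev := fun h => by
  have h1 := iterate_PL ω d j
  have h2 := iterate_PL ω d k
  have h3 := PL_rev ((step ω)^[k] d)
  rw [h] at h1
  tauto

theorem onLoop_step {ω : Config} {d : DirEdge} : OnLoop ω (step ω d) ↔ OnLoop ω d := by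
  constructor
  · rintro ⟨k, hk, h⟩
    refine ⟨k, hk, step_injective ω ?_⟩
    rw [← Function.iterate_succ_apply' (step ω), Function.iterate_succ_apply]
    exact h
  · rintro ⟨k, hk, h⟩
    exact ⟨k, hk, h.apply⟩

theorem onLoop_iterate {ω : Config} {d : DirEdge} (k : ℕ) :
    OnLoop ω ((step ω)^[k] d) ↔ OnLoop ω d := by
  induction k with
  | zero => rfl
  | succ k ih => rw [Function.iterate_succ_apply', onLoop_step, ih]

theorem OnLoop.rev {ω : Config} {d : DirEdge} (h : OnLoop ω d) : OnLoop ω d.rev := by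
  obtain ⟨k, hk, h⟩ := h
  refine ⟨k, hk, ?_⟩
  have := iterate_step_rev ω d k
  rwa [h.eq] at this

theorem onLoop_rev {ω : Config} {d : DirEdge} : OnLoop ω d.rev ↔ OnLoop ω d :=
  ⟨fun h => by simpa using h.rev, OnLoop.rev⟩

theorem OnLoop.exists_iterate_eq {ω : Config} {d e : DirEdge} (h : OnLoop ω d) {k : ℕ}
    (hk : (step ω)^[k] d = e) : ∃ j, (step ω)^[j] e = d := by
  obtain ⟨p, hp, hp'⟩ := h
  -- After k steps, another k(p - 1) complete k full periods.
  refine ⟨k * (p - 1), ?_⟩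
  rw [← hk, ← Function.iterate_add_apply]
  have : k * (p - 1) + k = p * k := by
    obtain ⟨p, rfl⟩ : ∃ r, p = r + 1 := ⟨p - 1, by omega⟩
    simp; ring
  rw [this]
  exact hp'.mul_const k

theorem iterate_injective_of_not_onLoop {ω : Config} {d : DirEdge} (h : ¬ OnLoop ω d) :
    Function.Injective fun k : ℕ => (step ω)^[k] d := by
  have key : ∀ j k : ℕ, j < k → (step ω)^[j] d ≠ (step ω)^[k] d := by
    intro j k hjk he
    apply h
    refine ⟨k - j, by omega, (step_injective ω).iterate j ?_⟩
    rw [← Function.iterate_add_apply, show j + (k - j) = k by omega, he]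
  intro j k hjk
  by_contra hne
  rcases lt_or_gt_of_ne hne with h' | h'
  · exact key j k h' hjk
  · exact key k j h' hjk.symm

/-! ### The parity of the number of crossings -/

theorem Crosses.symm {ω : Config} {d : DirEdge} {v w : Pt} (h : Crosses ω d v w) :
    Crosses ω d w v := by
  obtain ⟨k, hk⟩ := h
  exact ⟨k, hk.trans Sym2.eq_swap⟩

theorem crosses_comm {ω : Config} {d : DirEdge} {v w : Pt} :
    Crosses ω d v w ↔ Crosses ω d w v := ⟨Crosses.symm, Crosses.symm⟩

/-- The loop or path through `d` uses the medial edge `e`, in one direction or the other. -/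
def Hits (ω : Config) (d e : DirEdge) : Prop :=
  ∃ k : ℕ, (step ω)^[k] d = e ∨ (step ω)^[k] d = e.rev

theorem crosses_iff_hits {ω : Config} {d e : DirEdge} :
    Crosses ω d e.left e.right ↔ Hits ω d e := by
  refine exists_congr fun k => ?_
  rw [Sym2.eq_iff]
  refine or_congr ⟨fun h => ext_sides h.1 h.2, fun h => by rw [h]; exact ⟨rfl, rfl⟩⟩
    ⟨fun h => ext_sides ?_ ?_, fun h => ?_⟩
  · rw [h.1, rev_left]
  · rw [h.2, rev_right]
  · rw [h, rev_left, rev_right]; exact ⟨rfl, rfl⟩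

theorem OnLoop.exists_of_step_eq {ω : Config} {d e : DirEdge} (h : OnLoop ω d) {k : ℕ}
    (hk : (step ω)^[k] d = step ω e) : ∃ j, (step ω)^[j] d = e := by
  obtain ⟨p, hp, hp'⟩ := h
  refine ⟨k + (p - 1), step_injective ω ?_⟩
  rw [← Function.iterate_succ_apply' (step ω), ← hk, show (k + (p - 1)).succ = k + p by omega,
    Function.iterate_add_apply, hp'.eq]

theorem hits_step {ω : Config} {d e : DirEdge} (h : OnLoop ω d) :
    Hits ω d (step ω e) ↔ Hits ω d e := by
  constructor
  · rintro ⟨k, hk | hk⟩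
    · obtain ⟨j, hj⟩ := h.exists_of_step_eq hk
      exact ⟨j, Or.inl hj⟩
    · refine ⟨k + 1, Or.inr ?_⟩
      rw [Function.iterate_succ_apply', hk, step_rev_step]
  · rintro ⟨k, hk | hk⟩
    · exact ⟨k + 1, Or.inl (by rw [Function.iterate_succ_apply', hk])⟩
    · rw [← step_rev_step ω e] at hk
      obtain ⟨j, hj⟩ := h.exists_of_step_eq hk
      exact ⟨j, Or.inr hj⟩

theorem OnLoop.crosses_bounded {ω : Config} {d : DirEdge} (h : OnLoop ω d) :
    ∃ K : ℕ, ∀ v w : Pt, Crosses ω d v w → |v.1| ≤ K ∧ |v.2| ≤ K := by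
  obtain ⟨p, hp, hp'⟩ := h
  let g : ℕ → ℕ := fun k => (((step ω)^[k] d).left.1.natAbs + ((step ω)^[k] d).left.2.natAbs) +
    (((step ω)^[k] d).right.1.natAbs + ((step ω)^[k] d).right.2.natAbs)
  -- A crude bound: the sum over one period of the absolute values of all coordinates of the
  -- adjacent vertices.
  refine ⟨∑ k ∈ Finset.range p, g k, ?_⟩
  rintro v w ⟨k, hk⟩
  have h1 : g (k % p) ≤ ∑ k ∈ Finset.range p, g k :=
    Finset.single_le_sum (fun _ _ => Nat.zero_le _) (Finset.mem_range.2 (Nat.mod_lt _ hp))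
  have h2 : g (k % p) = g k := by
    simp only [g, hp'.iterate_mod_apply]
  rw [h2] at h1
  have hg : g k = (((step ω)^[k] d).left.1.natAbs + ((step ω)^[k] d).left.2.natAbs) +
    (((step ω)^[k] d).right.1.natAbs + ((step ω)^[k] d).right.2.natAbs) := rfl
  rw [hg] at h1
  generalize ∑ k ∈ Finset.range p, g k = S at h1 ⊢
  rcases Sym2.eq_iff.1 hk with ⟨ha, hb⟩ | ⟨ha, hb⟩ <;> rw [ha, hb] at h1 <;>
    rw [Int.abs_eq_natAbs, Int.abs_eq_natAbs] <;> omega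

/-- Moving the starting point one step along the ray removes the crossing with index 0 and shifts
the others. -/
theorem odd_ncard_succ {p : ℕ → Prop} (hf : {j | p j}.Finite) :
    Odd {j | p j}.ncard ↔ ¬ (Odd {j | p (j + 1)}.ncard ↔ p 0) := by
  have hinj : Function.Injective Nat.succ := Nat.succ_injective
  have hcard : (Nat.succ '' {j | p (j + 1)}).ncard = {j | p (j + 1)}.ncard :=
    Set.ncard_image_of_injective _ hinj
  by_cases h0 : p 0
  · have hs : {j | p j} = insert 0 (Nat.succ '' {j | p (j + 1)}) := by
      ext j
      cases j <;> simp [h0]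
    have hfin : (Nat.succ '' {j | p (j + 1)}).Finite := hf.subset (by rw [hs]; simp)
    rw [hs, Set.ncard_insert_of_notMem (by simp) hfin, hcard, Nat.odd_add_one]
    simp [h0]
  · have hs : {j | p j} = Nat.succ '' {j | p (j + 1)} := by
      ext j
      cases j <;> simp [h0]
    rw [hs, hcard]
    simp [h0]

theorem OnLoop.finite_crosses {ω : Config} {d : DirEdge} (h : OnLoop ω d) (v : Pt) :
    {j : ℕ | Crosses ω d (v.1 + j, v.2 + j) (v.1 + j + 1, v.2 + j + 1)}.Finite := by
  obtain ⟨K, hK⟩ := h.crosses_bounded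
  refine (Set.finite_Iic (K + v.1.natAbs)).subset fun j hj => ?_
  have := (hK _ _ hj).1
  rw [Set.mem_Iic]
  dsimp only at this
  rw [abs_le] at this
  omega

theorem Surrounds.exists_crosses {ω : Config} {d : DirEdge} {v : Pt} (h : Surrounds ω d v) :
    ∃ j : ℕ, Crosses ω d (v.1 + j, v.2 + j) (v.1 + j + 1, v.2 + j + 1) := by
  by_contra! hc
  have : {j : ℕ | Crosses ω d (v.1 + j, v.2 + j) (v.1 + j + 1, v.2 + j + 1)} = ∅ := by
    ext j; simpa using hc j
  rw [Surrounds, this] at h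
  simp at h

/-- The vertices surrounded by a loop lie in a bounded region. -/
theorem OnLoop.surrounds_bounded {ω : Config} {d : DirEdge} (h : OnLoop ω d) :
    ∃ K : ℕ, ∀ v : Pt, Surrounds ω d v → v.1 ≤ K ∧ v.2 ≤ K ∧ |v.1 - v.2| ≤ K := by
  obtain ⟨K, hK⟩ := h.crosses_bounded
  refine ⟨2 * K, fun v hv => ?_⟩
  obtain ⟨j, hj⟩ := hv.exists_crosses
  obtain ⟨h1, h2⟩ := hK _ _ hj
  dsimp only at h1 h2
  rw [abs_le] at h1 h2
  rw [abs_le]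
  push_cast
  omega

theorem surrounds_diag {ω : Config} {d : DirEdge} (h : OnLoop ω d) (v : Pt) :
    Surrounds ω d v ↔
      ¬ (Surrounds ω d (v.1 + 1, v.2 + 1) ↔ Crosses ω d v (v.1 + 1, v.2 + 1)) := by
  have := odd_ncard_succ (h.finite_crosses v)
  unfold Surrounds
  rw [this]
  simp only [Nat.cast_zero, add_zero, Nat.cast_add, Nat.cast_one, Prod.mk.eta]
  simp only [add_assoc, add_comm (1 : ℤ)]

/-- The two arcs on the tile with left corner `v`. -/
theorem tile_arcs (ω : Config) {v : Pt} (hv : Even (v.1 + v.2)) : ∃ e f : DirEdge,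
    e.left = (v.1 + 1, v.2 + 1) ∧ e.right = v ∧
    f.left = (v.1 + 1, v.2 - 1) ∧ f.right = (v.1 + 2, v.2) ∧
    (((step ω e).left = (v.1 + 1, v.2 + 1) ∧ (step ω e).right = (v.1 + 2, v.2) ∧
      (step ω f).left = (v.1 + 1, v.2 - 1) ∧ (step ω f).right = v) ∨
    ((step ω e).left = (v.1 + 1, v.2 - 1) ∧ (step ω e).right = v ∧
      (step ω f).left = (v.1 + 1, v.2 + 1) ∧ (step ω f).right = (v.1 + 2, v.2))) := by
  obtain ⟨e, he1, he2⟩ := exists_sides (v := (v.1 + 1, v.2 + 1)) (w := v)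
    (by rw [Int.even_iff] at *; dsimp only; omega) (by simp) (by simp)
  obtain ⟨f, hf1, hf2⟩ := exists_sides (v := (v.1 + 1, v.2 - 1)) (w := (v.1 + 2, v.2))
    (by rw [Int.even_iff] at *; dsimp only; omega) (by dsimp only; ring_nf; simp) (by simp)
  refine ⟨e, f, he1, he2, hf1, hf2, ?_⟩
  have te1 := two_tgt_fst e
  have te2 := two_tgt_snd e
  have se1 := right_fst_eq e
  have se2 := right_snd_eq e
  have tf1 := two_tgt_fst f
  have tf2 := two_tgt_snd f
  have sf1 := right_fst_eq f
  have sf2 := right_snd_eq f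
  rw [he1, he2] at te1 te2 se1 se2
  rw [hf1, hf2] at tf1 tf2 sf1 sf2
  dsimp only at *
  have ete : e.tgt = f.tgt := Subtype.ext (Prod.ext (by omega) (by omega))
  have hpe : e.PL ↔ f.PL := by
    unfold PL
    rw [he1, hf1]
    simp only [IsPrimal, Int.even_iff]
    omega
  have htt : TurnsLeft ω e ↔ TurnsLeft ω f := by
    rw [turnsLeft_iff, turnsLeft_iff, hpe, ete]
  by_cases ht : TurnsLeft ω e
  · left
    rw [step_left_of_turnsLeft ht, step_right_of_turnsLeft ht, he1, he2,
      step_left_of_turnsLeft (htt.1 ht), step_right_of_turnsLeft (htt.1 ht), hf1, hf2]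
    refine ⟨rfl, ?_, rfl, ?_⟩ <;> ext <;> dsimp only <;> omega
  · right
    have ht' := mt htt.2 ht
    rw [step_left_of_not_turnsLeft ht, step_right_of_not_turnsLeft ht, he1, he2,
      step_left_of_not_turnsLeft ht', step_right_of_not_turnsLeft ht', hf1, hf2]
    refine ⟨?_, rfl, ?_, rfl⟩ <;> ext <;> dsimp only <;> omega

/-- Each of the two arcs on a tile joins two of its sides, and a loop uses both ends of an arc or
neither. Hence a loop crosses an even number of the four sides. -/
theorem crosses_tile_parity {ω : Config} {d : DirEdge} (h : OnLoop ω d) {v : Pt}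
    (hv : Even (v.1 + v.2)) :
    (Crosses ω d v (v.1 + 1, v.2 + 1) ↔ Crosses ω d v (v.1 + 1, v.2 - 1)) ↔
    (Crosses ω d (v.1 + 1, v.2 + 1) (v.1 + 2, v.2) ↔
      Crosses ω d (v.1 + 1, v.2 - 1) (v.1 + 2, v.2)) := by
  obtain ⟨e, f, he1, he2, hf1, hf2, hs⟩ := tile_arcs ω hv
  have hce := hits_step (e := e) h
  have hcf := hits_step (e := f) h
  rw [← crosses_iff_hits, ← crosses_iff_hits, he1, he2] at hce
  rw [← crosses_iff_hits, ← crosses_iff_hits, hf1, hf2] at hcf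
  rw [crosses_comm (v := v), crosses_comm (v := v)]
  rcases hs with ⟨h1, h2, h3, h4⟩ | ⟨h1, h2, h3, h4⟩ <;> rw [h1, h2] at hce <;>
    rw [h3, h4] at hcf
  · rw [hce, hcf]
  · rw [hce, ← hcf]; simp

theorem xor_propagate {a b c s e p x y : Prop} (h1 : y ↔ ¬ (b ↔ e)) (h2 : a ↔ ¬ (b ↔ c))
    (h3 : s ↔ ¬ (e ↔ p)) (h4 : (c ↔ x) ↔ (y ↔ p)) : x ↔ ¬ (a ↔ s) := by
  by_cases b <;> by_cases c <;> by_cases e <;> by_cases p <;> simp_all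

/-- The rays in the definition of `Surrounds` run along (1, 1), so only sides in that direction are
covered by `surrounds_diag`. The parity of the crossings of one tile transports the claim for the
other direction by one step along (1, 1), and sufficiently far out nothing is crossed or surrounded.
-/
theorem surrounds_antidiag {ω : Config} {d : DirEdge} (h : OnLoop ω d) {v : Pt}
    (hv : Even (v.1 + v.2)) :
    Crosses ω d v (v.1 + 1, v.2 - 1) ↔ ¬ (Surrounds ω d v ↔ Surrounds ω d (v.1 + 1, v.2 - 1)) := by
  obtain ⟨K, hK⟩ := h.crosses_bounded
  obtain ⟨K', hK'⟩ := h.surrounds_bounded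
  -- `J` bounds the number of diagonal steps still needed to leave the region that contains all
  -- crossings and surrounded vertices.
  have key : ∀ (J : ℕ) (v : Pt), Even (v.1 + v.2) → (K + K' : ℤ) < v.1 + J →
      (Crosses ω d v (v.1 + 1, v.2 - 1) ↔
        ¬ (Surrounds ω d v ↔ Surrounds ω d (v.1 + 1, v.2 - 1))) := by
    intro J
    induction J with
    | zero =>
      intro v _ hJ
      have h1 : ¬ Crosses ω d v (v.1 + 1, v.2 - 1) := fun hc => by
        have := (hK _ _ hc).1
        rw [abs_le] at this
        omega
      have h2 : ¬ Surrounds ω d v := fun hc => by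
        have := (hK' _ hc).1
        omega
      have h3 : ¬ Surrounds ω d (v.1 + 1, v.2 - 1) := fun hc => by
        have := (hK' _ hc).1
        dsimp only at this
        omega
      tauto
    | succ J ih =>
      intro v hv hJ
      have h1 := ih (v.1 + 1, v.2 + 1) (by rw [Int.even_iff] at *; dsimp only; omega)
        (by dsimp only; push_cast at hJ; omega)
      have h2 := surrounds_diag h v
      have h3 := surrounds_diag h (v.1 + 1, v.2 - 1)
      have h4 := crosses_tile_parity h hv
      simp only [add_sub_cancel_right, sub_add_cancel, add_assoc, one_add_one_eq_two] at h1 h3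
      exact xor_propagate h1 h2 h3 h4
  refine key (K + K' + 1 + v.1.natAbs) v hv ?_
  have := neg_abs_le v.1
  push_cast
  omega

/-- A loop separates the two sides of the medial edges that it uses, and of no others. -/
theorem hits_iff {ω : Config} {d : DirEdge} (h : OnLoop ω d) (e : DirEdge) :
    Hits ω d e ↔ ¬ (Surrounds ω d e.left ↔ Surrounds ω d e.right) := by
  rw [← crosses_iff_hits]
  have h1 := right_fst_eq e
  have h2 := right_snd_eq e
  have hl : Even (e.left.1 + e.left.2) := by
    have := e.primal_left_xor
    simp only [IsPrimal, IsDual, Int.even_iff, Int.odd_iff] at *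
    omega
  have hr : Even (e.right.1 + e.right.2) := by
    have := e.primal_left_xor
    simp only [IsPrimal, IsDual, Int.even_iff, Int.odd_iff] at *
    omega
  rcases units_cases e.dx with hx | hx <;> rcases units_cases e.dy with hy | hy <;>
    rw [hx] at h2 <;> rw [hy] at h1
  · have := surrounds_antidiag h hl
    rwa [show (e.left.1 + 1, e.left.2 - 1) = e.right from Prod.ext h1.symm h2.symm] at this
  · have := surrounds_diag h e.right
    rw [show (e.right.1 + 1, e.right.2 + 1) = e.left from
      Prod.ext (by dsimp only; omega) (by dsimp only; omega)] at this
    rw [crosses_comm]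
    tauto
  · have := surrounds_diag h e.left
    rw [show (e.left.1 + 1, e.left.2 + 1) = e.right from
      Prod.ext (by dsimp only; omega) (by dsimp only; omega)] at this
    tauto
  · have := surrounds_antidiag h hr
    rw [show (e.right.1 + 1, e.right.2 - 1) = e.left from
      Prod.ext (by dsimp only; omega) (by dsimp only; omega)] at this
    rw [crosses_comm]
    tauto

theorem hits_iff_primal_dual {ω : Config} {d : DirEdge} (h : OnLoop ω d) (e : DirEdge) :
    Hits ω d e ↔ ¬ (Surrounds ω d e.primal.1 ↔ Surrounds ω d e.dual.1) := by
  rw [hits_iff h]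
  by_cases he : e.PL
  · rw [primal_of_PL he, dual_of_PL he]
  · rw [primal_of_not_PL he, dual_of_not_PL he]; tauto

/-- On an open tile the two medial edges joined by an arc share their dual vertex and are hit
together, so the loop separates both primal vertices from it or neither. -/
theorem surrounds_step_primal {ω : Config} {d : DirEdge} (h : OnLoop ω d) (e : DirEdge) :
    Surrounds ω d (step ω e).primal.1 ↔ Surrounds ω d e.primal.1 := by
  have h1 := hits_step (e := e) h
  rw [hits_iff_primal_dual h, hits_iff_primal_dual h] at h1
  cases ht : ω e.tgt
  · rw [step_primal_of_closed ht]
  · rw [step_dual_of_open ht] at h1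
    tauto

theorem surrounds_step_dual {ω : Config} {d : DirEdge} (h : OnLoop ω d) (e : DirEdge) :
    Surrounds ω d (step ω e).dual.1 ↔ Surrounds ω d e.dual.1 := by
  have h1 := hits_step (e := e) h
  have h2 := surrounds_step_primal h e
  rw [hits_iff_primal_dual h, hits_iff_primal_dual h] at h1
  tauto

theorem hits_self (ω : Config) (d : DirEdge) : Hits ω d d := ⟨0, Or.inl rfl⟩

theorem hits_iterate (ω : Config) (d : DirEdge) (k : ℕ) : Hits ω d ((step ω)^[k] d) :=
  ⟨k, Or.inl rfl⟩

theorem OnLoop.surrounds_xor {ω : Config} {d : DirEdge} (h : OnLoop ω d) :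
    ¬ (Surrounds ω d d.primal.1 ↔ Surrounds ω d d.dual.1) :=
  (hits_iff_primal_dual h d).1 (hits_self ω d)

theorem OnLoop.counterClockwise_iff {ω : Config} {d : DirEdge} (h : OnLoop ω d) :
    CounterClockwise ω d ↔ ¬ Clockwise ω d := by
  have := (hits_iff h d).1 (hits_self ω d)
  unfold CounterClockwise Clockwise
  tauto

theorem crosses_of_hits_iff {ω : Config} {d e : DirEdge} (h : ∀ f, Hits ω d f ↔ Hits ω e f)
    (v w : Pt) : Crosses ω d v w ↔ Crosses ω e v w := by
  have key : ∀ d e : DirEdge, (∀ f, Hits ω d f ↔ Hits ω e f) → Crosses ω d v w →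
      Crosses ω e v w := by
    rintro d e h ⟨k, hk⟩
    have h1 := crosses_iff_hits.2 ((h _).1 (hits_iterate ω d k))
    rcases Sym2.eq_iff.1 hk with ⟨h2, h3⟩ | ⟨h2, h3⟩
    · rwa [h2, h3] at h1
    · rw [h2, h3] at h1; exact h1.symm
  exact ⟨key d e h, key e d fun f => (h f).symm⟩

theorem surrounds_of_hits_iff {ω : Config} {d e : DirEdge} (h : ∀ f, Hits ω d f ↔ Hits ω e f)
    (v : Pt) : Surrounds ω d v ↔ Surrounds ω e v := by
  unfold Surrounds
  simp only [crosses_of_hits_iff h]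

theorem hits_iterate_iff {ω : Config} {d : DirEdge} (h : OnLoop ω d) (k : ℕ) (f : DirEdge) :
    Hits ω ((step ω)^[k] d) f ↔ Hits ω d f := by
  constructor
  · rintro ⟨j, hj⟩
    exact ⟨j + k, by rwa [Function.iterate_add_apply]⟩
  · rintro ⟨j, hj⟩
    obtain ⟨i, hi⟩ := h.exists_iterate_eq (k := k) rfl
    exact ⟨j + i, by rwa [Function.iterate_add_apply, hi]⟩

theorem hits_rev_left {ω : Config} {d : DirEdge} (h : OnLoop ω d) (f : DirEdge) :
    Hits ω d.rev f ↔ Hits ω d f := by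
  have key : ∀ d : DirEdge, OnLoop ω d → ∀ f, Hits ω d.rev f → Hits ω d f := by
    rintro d h f ⟨k, hk⟩
    have h1 := iterate_step_rev ω d.rev k
    rw [rev_rev] at h1
    obtain ⟨j, hj⟩ := h.rev |> fun h' => OnLoop.exists_iterate_eq
      ((onLoop_iterate k).2 h').rev h1
    rcases hk with hk | hk
    · exact ⟨j, Or.inr (by rw [hj, hk])⟩
    · exact ⟨j, Or.inl (by rw [hj, hk, rev_rev])⟩
  exact ⟨key d h f, fun h' => key d.rev h.rev f (by rwa [rev_rev])⟩

theorem surrounds_iterate {ω : Config} {d : DirEdge} (h : OnLoop ω d) (k : ℕ) (v : Pt) :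
    Surrounds ω ((step ω)^[k] d) v ↔ Surrounds ω d v :=
  surrounds_of_hits_iff (hits_iterate_iff h k) v

theorem surrounds_rev {ω : Config} {d : DirEdge} (h : OnLoop ω d) (v : Pt) :
    Surrounds ω d.rev v ↔ Surrounds ω d v :=
  surrounds_of_hits_iff (hits_rev_left h) v

theorem clockwise_iff {ω : Config} {d : DirEdge} (h : OnLoop ω d) :
    Clockwise ω d ↔ (d.PL ↔ Surrounds ω d d.dual.1) := by
  have h1 := h.surrounds_xor
  unfold Clockwise
  by_cases hd : d.PL
  · rw [← dual_of_PL hd]; tauto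
  · rw [← primal_of_not_PL hd]; tauto

theorem clockwise_rev {ω : Config} {d : DirEdge} (h : OnLoop ω d) :
    Clockwise ω d.rev ↔ ¬ Clockwise ω d := by
  rw [clockwise_iff h, clockwise_iff h.rev, PL_rev, dual_rev, surrounds_rev h]
  tauto

theorem surrounds_iterate_dual {ω : Config} {d : DirEdge} (h : OnLoop ω d) (k : ℕ) :
    Surrounds ω d ((step ω)^[k] d).dual.1 ↔ Surrounds ω d d.dual.1 := by
  induction k with
  | zero => rfl
  | succ k ih => rw [Function.iterate_succ_apply', surrounds_step_dual h, ih]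

theorem clockwise_iterate {ω : Config} {d : DirEdge} (h : OnLoop ω d) (k : ℕ) :
    Clockwise ω ((step ω)^[k] d) ↔ Clockwise ω d := by
  rw [clockwise_iff h, clockwise_iff ((onLoop_iterate k).2 h), iterate_PL, surrounds_iterate h,
    surrounds_iterate_dual h]

theorem clockwise_step {ω : Config} {d : DirEdge} (h : OnLoop ω d) :
    Clockwise ω (step ω d) ↔ Clockwise ω d := clockwise_iterate h 1

/-! ### Loops as sets of arcs -/

-- The index set of the uniform variables forgets directions, as a loop is a set of arcs. An arc is
-- traversed in only two ways, so equality of arcs determines the medial edge up to running along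
-- the arc backwards.
open Classical in
theorem arcAfter_injective {ω : Config} {d e : DirEdge} (h : arcAfter ω d = arcAfter ω e) :
    d = e ∨ d = (step ω e).rev := by
  have ht : d.tgt = e.tgt := congrArg Prod.fst h
  have hc : (if TurnsLeft ω d then d.left else d.right) =
      if TurnsLeft ω e then e.left else e.right := congrArg Prod.snd h
  -- The centre of the arc is the primal vertex on a closed tile and the dual vertex on an open one,
  -- whatever the direction of travel.
  have hcv : ∀ d : DirEdge, (if TurnsLeft ω d then d.left else d.right) =
      if ω d.tgt = false then d.primal.1 else d.dual.1 := by
    intro d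
    rw [show TurnsLeft ω d ↔ _ from turnsLeft_iff ω d]
    by_cases hd : d.PL
    · rw [primal_of_PL hd, dual_of_PL hd]; simp [hd]
    · rw [primal_of_not_PL hd, dual_of_not_PL hd]; cases ω d.tgt <;> simp [hd]
  rw [hcv, hcv, ht] at hc
  have hd := d.corner_cases
  have he := e.corner_cases
  have pe := e.primal.2
  have pd := d.primal.2
  have ue := e.dual.2
  have ud := d.dual.2
  simp only [IsPrimal, IsDual, Int.even_iff, Int.odd_iff] at pe pd ue ud
  rw [ht] at hd
  clear hcv h
  cases hω : ω e.tgt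
  · rw [if_pos hω, if_pos hω] at hc
    have hs := step_dual_of_closed hω
    have hcs : d.dual.1 = e.dual.1 ∨ d.dual.1 = (step ω e).dual.1 := by
      rw [hc] at hd
      rw [hs, Prod.ext_iff, Prod.ext_iff]
      clear hc hs hω
      dsimp only
      omega
    rcases hcs with hu | hu
    · left
      refine ext_primal_dual (Subtype.ext hc) (Subtype.ext hu) ?_
      rw [d.PL_iff, e.PL_iff, ht, hc, hu]
    · right
      refine ext_primal_dual ?_ ?_ ?_
      · rw [primal_rev, step_primal_of_closed hω]; exact Subtype.ext hc
      · rw [dual_rev]; exact Subtype.ext hu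
      · rw [PL_rev, step_PL, d.PL_iff, e.PL_iff, ht, hu, hc, hs]
        clear hc hs hω hd hu pd ud pe ue ht
        dsimp only
        omega
  · rw [if_neg (by simp [hω]), if_neg (by simp [hω])] at hc
    have hs := step_primal_of_open hω
    have hcs : d.primal.1 = e.primal.1 ∨ d.primal.1 = (step ω e).primal.1 := by
      rw [hc] at hd
      rw [hs, Prod.ext_iff, Prod.ext_iff]
      clear hc hs hω
      dsimp only
      omega
    rcases hcs with hu | hu
    · left
      refine ext_primal_dual (Subtype.ext hu) (Subtype.ext hc) ?_
      rw [d.PL_iff, e.PL_iff, ht, hc, hu]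
    · right
      refine ext_primal_dual ?_ ?_ ?_
      · rw [primal_rev]; exact Subtype.ext hu
      · rw [dual_rev, step_dual_of_open hω]; exact Subtype.ext hc
      · rw [PL_rev, step_PL, d.PL_iff, e.PL_iff, ht, hu, hc, hs]
        clear hc hs hω hd hu pd ud pe ue ht
        dsimp only
        omega

theorem loopThrough_step {ω : Config} {d : DirEdge} (h : OnLoop ω d) :
    loopThrough ω (step ω d) = loopThrough ω d := by
  ext a
  constructor
  · rintro ⟨k, hk⟩
    exact ⟨k + 1, by rw [hk, ← Function.iterate_succ_apply]⟩
  · rintro ⟨k, hk⟩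
    obtain ⟨i, hi⟩ := h.exists_iterate_eq (k := 1) rfl
    refine ⟨k + i, ?_⟩
    rw [Function.iterate_add_apply]
    rw [Function.iterate_one] at hi
    rw [hi, hk]

theorem arcAfter_rev_step (ω : Config) (d : DirEdge) :
    arcAfter ω (step ω d).rev = arcAfter ω d := by
  have ht : (step ω d).rev.tgt = d.tgt := by rw [rev_tgt, step_src]
  have h1 : TurnsLeft ω (step ω d).rev ↔ ¬ TurnsLeft ω d := by
    rw [turnsLeft_iff, turnsLeft_iff, ht, PL_rev, step_PL]; tauto
  unfold arcAfter
  rw [ht]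
  by_cases h : TurnsLeft ω d
  · rw [if_pos h, if_neg (by tauto), rev_right, step_left_of_turnsLeft h]
  · rw [if_neg h, if_pos (by tauto), rev_left, step_right_of_not_turnsLeft h]

theorem loopThrough_rev {ω : Config} {d : DirEdge} (h : OnLoop ω d) :
    loopThrough ω d.rev = loopThrough ω d := by
  have key : ∀ d : DirEdge, OnLoop ω d → loopThrough ω d.rev ⊆ loopThrough ω d := by
    rintro d h a ⟨k, rfl⟩
    have h1 := iterate_step_rev ω d.rev (k + 1)
    rw [rev_rev] at h1
    obtain ⟨j, hj⟩ := OnLoop.exists_iterate_eq ((onLoop_iterate (k + 1)).2 h.rev).rev h1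
    refine ⟨j, ?_⟩
    rw [hj, Function.iterate_succ_apply', arcAfter_rev_step]
  refine (key d h).antisymm ?_
  have := key d.rev h.rev
  rwa [rev_rev] at this

theorem exists_iterate_of_loopThrough_eq {ω : Config} {d e : DirEdge}
    (h : loopThrough ω d = loopThrough ω e) :
    (∃ k, (step ω)^[k] d = e) ∨ ∃ k, (step ω)^[k] d = e.rev := by
  have h0 : arcAfter ω e ∈ loopThrough ω d := h ▸ ⟨0, rfl⟩
  obtain ⟨k, hk⟩ := h0
  rcases arcAfter_injective hk with h1 | h1
  · exact Or.inl ⟨k, h1.symm⟩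
  · right
    refine ⟨k + 1, ?_⟩
    rw [h1, rev_rev, Function.iterate_succ_apply']

/-! ### The turning number of lattice paths -/

/-- The half-open quadrant that contains a non-zero vector. -/
def quadrant (w : ℤ × ℤ) : ℤ :=
  if 0 < w.1 ∧ 0 ≤ w.2 then 0 else if w.1 ≤ 0 ∧ 0 < w.2 then 1
  else if w.1 < 0 ∧ w.2 ≤ 0 then 2 else 3

/-- The change of quadrant between two vectors, as an integer between `-1` and `2`. -/
def quadrantChange (w w' : ℤ × ℤ) : ℤ := (quadrant w' - quadrant w + 1) % 4 - 1

/-- The four unit vectors of the square lattice. -/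
def IsUnitStep (e : ℤ × ℤ) : Prop := e = (1, 0) ∨ e = (-1, 0) ∨ e = (0, 1) ∨ e = (0, -1)

theorem quadrant_spec {w : ℤ × ℤ} (h : w ≠ 0) :
    (quadrant w = 0 ∧ 0 < w.1 ∧ 0 ≤ w.2) ∨ (quadrant w = 1 ∧ w.1 ≤ 0 ∧ 0 < w.2) ∨
    (quadrant w = 2 ∧ w.1 < 0 ∧ w.2 ≤ 0) ∨ (quadrant w = 3 ∧ 0 ≤ w.1 ∧ w.2 < 0) := by
  have h' : w.1 ≠ 0 ∨ w.2 ≠ 0 := by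
    by_contra! hc
    exact h (Prod.ext hc.1 hc.2)
  unfold quadrant
  split_ifs <;> omega

/-- Opposite quadrants are not joined by a unit step, so the ambiguous half-turn, encoded by 2, does
not occur. -/
theorem quadrantChange_adjacent {w e : ℤ × ℤ} (he : IsUnitStep e) (h : w ≠ 0) (h' : w + e ≠ 0) :
    (quadrantChange w (w + e) = 0 ∨ quadrantChange w (w + e) = 1 ∨
      quadrantChange w (w + e) = -1) := by
  have h1 := quadrant_spec h
  have h2 := quadrant_spec h'
  unfold quadrantChange
  rcases he with rfl | rfl | rfl | rfl <;>
    (simp only [Prod.fst_add, Prod.snd_add] at h2; omega)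

/-- A unit square with lattice corners other than the origin does not wind around the origin, so the
discrete angle has no curvature there. The cases f = e and f = -e are degenerate. -/
theorem quadrantChange_plaquette {w e f : ℤ × ℤ} (he : IsUnitStep e) (hf : IsUnitStep f)
    (h : w ≠ 0) (h1 : w + e ≠ 0) (h2 : w + f ≠ 0) (h3 : w + e + f ≠ 0) :
    quadrantChange w (w + e) + quadrantChange (w + e) (w + e + f) =
      quadrantChange w (w + f) + quadrantChange (w + f) (w + e + f) := by
  have a1 := quadrantChange_adjacent he h h1
  have a2 := quadrantChange_adjacent hf h1 h3
  have a3 := quadrantChange_adjacent hf h h2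
  have a4 := quadrantChange_adjacent he h2 (by rwa [add_right_comm])
  rw [add_right_comm] at a4
  have q0 := quadrant_spec h
  have q1 := quadrant_spec h1
  have q2 := quadrant_spec h2
  have q3 := quadrant_spec h3
  unfold quadrantChange at *
  rcases he with rfl | rfl | rfl | rfl <;> rcases hf with rfl | rfl | rfl | rfl <;>
    simp only [Prod.fst_add, Prod.snd_add] at q1 q2 q3 <;> omega

/-- Avoiding quadrant 3 keeps the vectors away from the jump of the discrete angle, where it drops
from 3 to 0. -/
theorem quadrantChange_eq_sub {w e : ℤ × ℤ} (he : IsUnitStep e) (h : w ≠ 0) (h' : w + e ≠ 0)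
    (hq : quadrant w ≠ 3) (hq' : quadrant (w + e) ≠ 3) :
    quadrantChange w (w + e) = quadrant (w + e) - quadrant w := by
  have a1 := quadrantChange_adjacent he h h'
  have q0 := quadrant_spec h
  have q1 := quadrant_spec h'
  unfold quadrantChange at *
  omega

theorem quadrantChange_neg {w w' : ℤ × ℤ} (h : w ≠ 0) (h' : w' ≠ 0) :
    quadrantChange (-w) (-w') = quadrantChange w w' := by
  have q0 := quadrant_spec h
  have q1 := quadrant_spec h'
  have q2 := quadrant_spec (neg_ne_zero.2 h)
  have q3 := quadrant_spec (neg_ne_zero.2 h')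
  simp only [Prod.fst_neg, Prod.snd_neg] at q2 q3
  unfold quadrantChange
  omega

theorem quadrant_ne_three {w : ℤ × ℤ} (h : w.1 < 0 ∨ 0 ≤ w.2) (h0 : w ≠ 0) : quadrant w ≠ 3 := by
  have := quadrant_spec h0
  omega

/-- The turn between two consecutive unit steps. -/
def cornerTurn (e f : ℤ × ℤ) : ℤ := quadrantChange e (e + f) + quadrantChange (e + f) f

/-! ### Hopf's argument with secants of a self-avoiding lattice path. -/

section Hopf

variable {p : ℕ → ℤ × ℤ} {N : ℕ}

/-- The secants p j - p i with i < j never vanish, so their discrete angle is a flat function on the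
triangle of such pairs. Its total change along the hypotenuse, which runs through (k, k + 1), (k, k
+ 2), (k + 1, k + 2) and gives the corners of the path, equals the change along the two legs. -/
theorem hopf_triangle (hinj : ∀ i j, i < j → j ≤ N + 1 → p j - p i ≠ 0)
    (hstep : ∀ i, i ≤ N → IsUnitStep (p (i + 1) - p i)) :
    ∑ k ∈ Finset.range N, cornerTurn (p (k + 1) - p k) (p (k + 2) - p (k + 1)) =
      ∑ j ∈ Finset.range N, quadrantChange (p (j + 1) - p 0) (p (j + 2) - p 0) +
      ∑ i ∈ Finset.range N, quadrantChange (p (N + 1) - p i) (p (N + 1) - p (i + 1)) := by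
  induction N with
  | zero => simp
  | succ N ih =>
    have ih := ih (fun i j h h' => hinj i j h (by omega)) (fun i h => hstep i (by omega))
    rw [Finset.sum_range_succ, ih, Finset.sum_range_succ (fun j => quadrantChange (p (j + 1) - p 0) _),
      Finset.sum_range_succ (fun i => quadrantChange (p (N + 1 + 1) - p i) _)]
    -- The secants ending at p (N + 1) are compared with those ending at p (N + 2) by crossing k
    -- plaquettes one after the other.
    have key : ∀ k ≤ N, quadrantChange (p (N + 1) - p k) (p (N + 2) - p k) +
        ∑ i ∈ Finset.range k, quadrantChange (p (N + 1) - p i) (p (N + 1) - p (i + 1)) =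
        quadrantChange (p (N + 1) - p 0) (p (N + 2) - p 0) +
        ∑ i ∈ Finset.range k, quadrantChange (p (N + 2) - p i) (p (N + 2) - p (i + 1)) := by
      intro k
      induction k with
      | zero => intro _; simp
      | succ k ihk =>
        intro hk
        have ihk := ihk (by omega)
        rw [Finset.sum_range_succ, Finset.sum_range_succ]
        have he := hstep (N + 1) (by omega)
        have hf : IsUnitStep (p k - p (k + 1)) := by
          rcases hstep k (by omega) with h | h | h | h <;>
            rw [← neg_sub, h] <;> simp [IsUnitStep]
        have e1 : p (N + 1) - p k + (p (N + 1 + 1) - p (N + 1)) = p (N + 2) - p k := by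
          change _ + (p (N + 2) - p (N + 1)) = _; abel
        have e2 : p (N + 1) - p k + (p k - p (k + 1)) = p (N + 1) - p (k + 1) := by abel
        have e3 : p (N + 2) - p k + (p k - p (k + 1)) = p (N + 2) - p (k + 1) := by abel
        have := quadrantChange_plaquette he hf (hinj k (N + 1) (by omega) (by omega))
          (by rw [e1]; exact hinj k (N + 2) (by omega) (by omega))
          (by rw [e2]; exact hinj (k + 1) (N + 1) (by omega) (by omega))
          (by rw [e1, e3]; exact hinj (k + 1) (N + 2) (by omega) (by omega))
        rw [e1, e2, e3] at this
        linarith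
    have := key N le_rfl
    have e1 : p (N + 1) - p N + (p (N + 2) - p (N + 1)) = p (N + 2) - p N := by abel
    rw [cornerTurn, e1]
    simp only [show N + 1 + 1 = N + 2 from rfl] at *
    linarith

/-- No secant from the starting point points into quadrant 3, so the changes telescope. -/
theorem sum_quadrantChange_from_start (hinj : ∀ i j, i < j → j ≤ N + 1 → p j - p i ≠ 0)
    (hstep : ∀ i, i ≤ N → IsUnitStep (p (i + 1) - p i))
    (hq : ∀ j, 0 < j → j ≤ N + 1 → (p j - p 0).1 < 0 ∨ 0 ≤ (p j - p 0).2) :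
    ∑ j ∈ Finset.range N, quadrantChange (p (j + 1) - p 0) (p (j + 2) - p 0) =
      quadrant (p (N + 1) - p 0) - quadrant (p 1 - p 0) := by
  rw [← Finset.sum_range_sub (fun j => quadrant (p (j + 1) - p 0)) N]
  refine Finset.sum_congr rfl fun j hj => ?_
  rw [Finset.mem_range] at hj
  have e : p (j + 1) - p 0 + (p (j + 1 + 1) - p (j + 1)) = p (j + 1 + 1) - p 0 := by abel
  have h1 := hinj 0 (j + 1) (by omega) (by omega)
  have h2 := hinj 0 (j + 1 + 1) (by omega) (by omega)
  have := quadrantChange_eq_sub (hstep (j + 1) (by omega)) h1 (by rwa [e])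
    (quadrant_ne_three (hq _ (by omega) (by omega)) h1)
    (by rw [e]; exact quadrant_ne_three (hq _ (by omega) (by omega)) h2)
  rwa [e] at this

theorem sum_quadrantChange_to_end (hinj : ∀ i j, i < j → j ≤ N + 1 → p j - p i ≠ 0)
    (hstep : ∀ i, i ≤ N → IsUnitStep (p (i + 1) - p i))
    (hq : ∀ i, i ≤ N → (p (N + 1) - p i).1 < 0) :
    ∑ i ∈ Finset.range N, quadrantChange (p (N + 1) - p i) (p (N + 1) - p (i + 1)) =
      quadrant (p (N + 1) - p N) - quadrant (p (N + 1) - p 0) := by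
  rw [← Finset.sum_range_sub (fun i => quadrant (p (N + 1) - p i)) N]
  refine Finset.sum_congr rfl fun i hi => ?_
  rw [Finset.mem_range] at hi
  have e : p (N + 1) - p i + (p i - p (i + 1)) = p (N + 1) - p (i + 1) := by abel
  have hf : IsUnitStep (p i - p (i + 1)) := by
    rcases hstep i (by omega) with h | h | h | h <;> rw [← neg_sub, h] <;> simp [IsUnitStep]
  have h1 := hinj i (N + 1) (by omega) (by omega)
  have h2 := hinj (i + 1) (N + 1) (by omega) (by omega)
  have := quadrantChange_eq_sub hf h1 (by rwa [e])
    (quadrant_ne_three (Or.inl (hq _ (by omega))) h1)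
    (by rw [e]; exact quadrant_ne_three (Or.inl (hq _ (by omega))) h2)
  rwa [e] at this

/-- The secants into the end point are reversed first, which leaves the changes unaltered and puts
the vectors into the upper half-plane, away from quadrant 3. -/
theorem sum_quadrantChange_to_end_upper (hinj : ∀ i j, i < j → j ≤ N + 1 → p j - p i ≠ 0)
    (hstep : ∀ i, i ≤ N → IsUnitStep (p (i + 1) - p i))
    (hq : ∀ i, i ≤ N → 0 ≤ (p i - p (N + 1)).2) :
    ∑ i ∈ Finset.range N, quadrantChange (p (N + 1) - p i) (p (N + 1) - p (i + 1)) =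
      quadrant (p N - p (N + 1)) - quadrant (p 0 - p (N + 1)) := by
  rw [← Finset.sum_range_sub (fun i => quadrant (p i - p (N + 1))) N]
  refine Finset.sum_congr rfl fun i hi => ?_
  rw [Finset.mem_range] at hi
  have h1 := hinj i (N + 1) (by omega) (by omega)
  have h2 := hinj (i + 1) (N + 1) (by omega) (by omega)
  rw [← quadrantChange_neg h1 h2, neg_sub, neg_sub]
  have e : p i - p (N + 1) + (p (i + 1) - p i) = p (i + 1) - p (N + 1) := by abel
  have h1' : p i - p (N + 1) ≠ 0 := by rw [← neg_sub]; exact neg_ne_zero.2 h1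
  have h2' : p (i + 1) - p (N + 1) ≠ 0 := by rw [← neg_sub]; exact neg_ne_zero.2 h2
  have := quadrantChange_eq_sub (hstep i (by omega)) h1' (by rwa [e])
    (quadrant_ne_three (Or.inr (hq _ (by omega))) h1')
    (by rw [e]; exact quadrant_ne_three (Or.inr (hq _ (by omega))) h2')
  rwa [e] at this

/-- A self-avoiding path from its strictly rightmost to its strictly leftmost point has total
turning zero. -/
theorem sum_cornerTurn_right_to_left (hinj : ∀ i j, i < j → j ≤ N + 1 → p j - p i ≠ 0)
    (hstep : ∀ i, i ≤ N → IsUnitStep (p (i + 1) - p i))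
    (h0 : ∀ j, 0 < j → j ≤ N + 1 → (p j - p 0).1 < 0)
    (h1 : ∀ i, i ≤ N → (p (N + 1) - p i).1 < 0) :
    ∑ k ∈ Finset.range N, cornerTurn (p (k + 1) - p k) (p (k + 2) - p (k + 1)) = 0 := by
  rw [hopf_triangle hinj hstep,
    sum_quadrantChange_from_start hinj hstep fun j hj hj' => Or.inl (h0 j hj hj'),
    sum_quadrantChange_to_end hinj hstep h1]
  have hunit : ∀ e : ℤ × ℤ, IsUnitStep e → e.1 < 0 → quadrant e = 2 := by
    rintro e (rfl | rfl | rfl | rfl) h <;> simp at h <;> rfl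
  rw [hunit _ (hstep 0 (by omega)) (h0 1 (by omega) (by omega)),
    hunit _ (hstep N le_rfl) (h1 N le_rfl)]
  ring

/-- A self-avoiding lattice polygon whose lowest level is traversed to the right has total turning
four quarter-turns to the left. -/
theorem sum_cornerTurn_polygon (hinj : ∀ i j, i < j → j ≤ N + 1 → p j - p i ≠ 0)
    (hstep : ∀ i, i ≤ N → IsUnitStep (p (i + 1) - p i))
    (hlow : ∀ i, i ≤ N + 1 → 0 ≤ (p i - p 0).2)
    (hclose : p 0 - p (N + 1) = (1, 0))
    (hstart : p 1 - p 0 ≠ (-1, 0)) (hend : p (N + 1) - p N ≠ (-1, 0)) :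
    ∑ k ∈ Finset.range N, cornerTurn (p (k + 1) - p k) (p (k + 2) - p (k + 1)) +
      cornerTurn (p (N + 1) - p N) (1, 0) + cornerTurn (1, 0) (p 1 - p 0) = 4 := by
  have hclose' : p (N + 1) - p 0 = (-1, 0) := by rw [← neg_sub, hclose]; rfl
  have hlow' : ∀ i, i ≤ N → 0 ≤ (p i - p (N + 1)).2 := by
    intro i hi
    have e : p i - p (N + 1) = p i - p 0 + (1, 0) := by rw [← hclose]; abel
    rw [e]
    simpa using hlow i (by omega)
  rw [hopf_triangle hinj hstep,
    sum_quadrantChange_from_start hinj hstep fun j _ hj' => Or.inr (hlow j hj'),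
    sum_quadrantChange_to_end_upper hinj hstep hlow', hclose, hclose']
  have h1 := hlow 1 (by omega)
  have h2 := hlow' N le_rfl
  have h3 := hstep 0 (by omega)
  rw [← neg_sub (p (N + 1)) (p N)] at h2 ⊢
  -- The first step is not to the left by assumption and not downwards since the start is lowest;
  -- the last one is neither to the left nor upwards. Four pairs remain to be computed.
  rcases h3 with h | h | h | h <;> rcases hstep N le_rfl with h' | h' | h' | h' <;>
    simp only [zero_add] at h <;> rw [h] at h1 hstart ⊢ <;> rw [h'] at h2 hend ⊢ <;>
    first
      | exact absurd rfl hstart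
      | exact absurd rfl hend
      | (exfalso; revert h1; decide)
      | (exfalso; revert h2; decide)
      | decide

end Hopf

/-! ### Loops as lattice polygons -/

/-- The position of a medial edge: its midpoint, shifted by `(-1/2, -1/2)`. -/
def pos (d : DirEdge) : ℤ × ℤ :=
  (d.src.1.1 + ((d.dx : ℤ) - 1) / 2, d.src.1.2 + ((d.dy : ℤ) - 1) / 2)

/-- The displacement of the position along an arc that turns left (if `l`) or right. -/
def arcStep (x y : ℤˣ) (l : Bool) : ℤ × ℤ :=
  if l then (((x : ℤ) - y) / 2, ((x : ℤ) + y) / 2) else (((x : ℤ) + y) / 2, ((y : ℤ) - x) / 2)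

theorem isUnitStep_arcStep (x y : ℤˣ) (l : Bool) : IsUnitStep (arcStep x y l) := by
  rcases Int.units_eq_one_or x with rfl | rfl <;> rcases Int.units_eq_one_or y with rfl | rfl <;>
    cases l <;> simp [IsUnitStep, arcStep]

open Classical in
theorem pos_step (ω : Config) (d : DirEdge) :
    pos (step ω d) - pos d = arcStep d.dx d.dy (decide (TurnsLeft ω d)) := by
  by_cases h : TurnsLeft ω d
  · rw [step, if_pos h, decide_eq_true h]
    rcases units_cases d.dx with hx | hx <;> rcases units_cases d.dy with hy | hy <;>
      (ext <;> simp [pos, tgt, arcStep, hx, hy])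
  · rw [step, if_neg h, decide_eq_false h]
    rcases units_cases d.dx with hx | hx <;> rcases units_cases d.dy with hy | hy <;>
      (ext <;> simp [pos, tgt, arcStep, hx, hy])

theorem isUnitStep_pos (ω : Config) (d : DirEdge) : IsUnitStep (pos (step ω d) - pos d) := by
  rw [pos_step]; exact isUnitStep_arcStep _ _ _

theorem cornerTurn_arcStep (x y : ℤˣ) (l l' : Bool) :
    2 * cornerTurn (arcStep x y l) (if l then arcStep (-y) x l' else arcStep y (-x) l') =
      (if l then 1 else -1) + (if l' then 1 else -1) ∧
    (if l then arcStep (-y) x l' else arcStep y (-x) l') ≠ - arcStep x y l := by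
  rcases Int.units_eq_one_or x with rfl | rfl <;> rcases Int.units_eq_one_or y with rfl | rfl <;>
    cases l <;> cases l' <;> decide

open Classical in
theorem arcStep_step (ω : Config) (d : DirEdge) (l : Bool) :
    arcStep (step ω d).dx (step ω d).dy l =
      if decide (TurnsLeft ω d) then arcStep (-d.dy) d.dx l else arcStep d.dy (-d.dx) l := by
  by_cases h : TurnsLeft ω d <;> simp [step, h]

/-- The chord of a quarter-turn makes an angle of an eighth-turn with the direction at either end.
The corner between two consecutive chords is therefore half the sum of the two turns. -/
theorem two_mul_cornerTurn (ω : Config) (d : DirEdge) :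
    2 * cornerTurn (pos (step ω d) - pos d) (pos (step ω (step ω d)) - pos (step ω d)) =
      turn ω d + turn ω (step ω d) := by
  classical
  rw [pos_step, pos_step, arcStep_step, (cornerTurn_arcStep _ _ _ _).1]
  unfold turn
  congr 1 <;> simp

theorem no_u_turn (ω : Config) (d : DirEdge) :
    pos (step ω (step ω d)) - pos (step ω d) ≠ - (pos (step ω d) - pos d) := by
  classical
  rw [pos_step, pos_step, arcStep_step]
  exact (cornerTurn_arcStep _ _ _ _).2

theorem pos_rev (d : DirEdge) : pos d.rev = pos d := by
  rcases units_cases d.dx with hx | hx <;> rcases units_cases d.dy with hy | hy <;>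
    (ext <;> simp [pos, DirEdge.rev, tgt, hx, hy])

theorem eq_or_rev_of_pos_eq {d e : DirEdge} (h : pos d = pos e) : d = e ∨ d = e.rev := by
  have h1 : d.src.1.1 + ((d.dx : ℤ) - 1) / 2 = e.src.1.1 + ((e.dx : ℤ) - 1) / 2 :=
    congrArg Prod.fst h
  have h2 : d.src.1.2 + ((d.dy : ℤ) - 1) / 2 = e.src.1.2 + ((e.dy : ℤ) - 1) / 2 :=
    congrArg Prod.snd h
  have hd := d.src.2
  have he := e.src.2
  rw [Int.odd_iff] at hd he
  by_cases hx : d.dx = e.dx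
  · left
    have hx' : (d.dx : ℤ) = e.dx := by rw [hx]
    have hy : d.dy = e.dy := by
      apply units_sign_ext
      rcases units_cases d.dx with a | a <;> rcases units_cases d.dy with b | b <;>
        rcases units_cases e.dx with a' | a' <;> rcases units_cases e.dy with b' | b' <;>
        rw [a, a'] at h1 <;> rw [b, b'] at h2 <;> omega
    rw [hx] at h1
    rw [hy] at h2
    exact DirEdge.ext (Subtype.ext (Prod.ext (by omega) (by omega))) hx hy
  · right
    have hx' : (d.dx : ℤ) ≠ e.dx := fun h' => hx (units_sign_ext h')
    have hx2 : (d.dx : ℤ) = -e.dx := by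
      rcases units_cases d.dx with a | a <;> rcases units_cases e.dx with a' | a' <;> omega
    have hy2 : (d.dy : ℤ) = -e.dy := by
      rcases units_cases d.dx with a | a <;> rcases units_cases d.dy with b | b <;>
        rcases units_cases e.dx with a' | a' <;> rcases units_cases e.dy with b' | b' <;>
        rw [a, a'] at h1 <;> rw [b, b'] at h2 <;> omega
    refine DirEdge.ext (Subtype.ext (Prod.ext ?_ ?_)) (units_sign_ext ?_) (units_sign_ext ?_)
    · simp only [DirEdge.rev, tgt]
      rcases units_cases d.dx with a | a <;> rcases units_cases e.dx with a' | a' <;>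
        rw [a, a'] at h1 <;> omega
    · simp only [DirEdge.rev, tgt]
      rcases units_cases d.dy with a | a <;> rcases units_cases e.dy with a' | a' <;>
        rw [a, a'] at h2 <;> omega
    · simpa [DirEdge.rev] using hx2
    · simpa [DirEdge.rev] using hy2

theorem pos_iterate_ne {ω : Config} {d : DirEdge} {i j : ℕ}
    (h : (step ω)^[i] d ≠ (step ω)^[j] d) : pos ((step ω)^[j] d) - pos ((step ω)^[i] d) ≠ 0 := by
  rw [sub_ne_zero]
  intro h'
  rcases eq_or_rev_of_pos_eq h' with h1 | h1
  · exact h h1.symm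
  · exact iterate_ne_rev ω d j i h1

/-- The total turning of an arc path from its strictly rightmost to its strictly leftmost
position. -/
theorem sum_turn_path {ω : Config} {d : DirEdge} {N : ℕ}
    (hinj : ∀ i j, i < j → j ≤ N + 1 → (step ω)^[i] d ≠ (step ω)^[j] d)
    (h0 : ∀ j, 0 < j → j ≤ N + 1 → (pos ((step ω)^[j] d)).1 < (pos d).1)
    (h1 : ∀ i, i ≤ N → (pos ((step ω)^[N + 1] d)).1 < (pos ((step ω)^[i] d)).1) :
    ∑ k ∈ Finset.range N, (turn ω ((step ω)^[k] d) + turn ω ((step ω)^[k + 1] d)) = 0 := by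
  have := sum_cornerTurn_right_to_left (p := fun k => pos ((step ω)^[k] d)) (N := N)
    (fun i j h h' => pos_iterate_ne (hinj i j h h'))
    (fun i _ => by rw [Function.iterate_succ_apply']; exact isUnitStep_pos ω _)
    (fun j hj hj' => by simpa using h0 j hj hj')
    (fun i hi => by simpa using h1 i hi)
  calc _ = ∑ k ∈ Finset.range N, 2 * cornerTurn
        (pos ((step ω)^[k + 1] d) - pos ((step ω)^[k] d))
        (pos ((step ω)^[k + 2] d) - pos ((step ω)^[k + 1] d)) := by
        refine Finset.sum_congr rfl fun k _ => ?_
        rw [Function.iterate_succ_apply' (step ω) (k + 1), Function.iterate_succ_apply' (step ω) k,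
          two_mul_cornerTurn]
    _ = 0 := by rw [← Finset.mul_sum, this, mul_zero]

/-- The directed edges of the loop through `d`, oriented along `d`. -/
def orbit (ω : Config) (d : DirEdge) : Finset DirEdge := by
  classical
  exact (Finset.range (Function.minimalPeriod (step ω) d)).image fun k => (step ω)^[k] d

theorem mem_orbit {ω : Config} {d e : DirEdge} (h : OnLoop ω d) :
    e ∈ orbit ω d ↔ ∃ k, (step ω)^[k] d = e := by
  classical
  simp only [orbit, Finset.mem_image, Finset.mem_range]
  constructor
  · rintro ⟨k, _, hk⟩
    exact ⟨k, hk⟩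
  · rintro ⟨k, hk⟩
    exact ⟨k % Function.minimalPeriod (step ω) d,
      Nat.mod_lt _ (Function.minimalPeriod_pos_of_mem_periodicPts h),
      by rw [Function.iterate_mod_minimalPeriod_eq, hk]⟩

theorem sum_orbit {ω : Config} {d : DirEdge} (f : DirEdge → ℤ) :
    ∑ e ∈ orbit ω d, f e =
      ∑ k ∈ Finset.range (Function.minimalPeriod (step ω) d), f ((step ω)^[k] d) := by
  classical
  rw [orbit, Finset.sum_image]
  intro i hi j hj hij
  exact Function.iterate_injOn_Iio_minimalPeriod (by simpa using hi) (by simpa using hj) hij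

/-- The closed polygon is cut open at a rightward step on its lowest level, and this step becomes
the closing edge in `sum_cornerTurn_polygon`. -/
theorem sum_turn_of_lowest {ω : Config} {d : DirEdge} (h : OnLoop ω d)
    (hpos : pos d - pos (pred ω d) = (1, 0))
    (hlow : ∀ k, (pos d).2 ≤ (pos ((step ω)^[k] d)).2) : ∑ e ∈ orbit ω d, turn ω e = 4 := by
  rw [sum_orbit]
  set L := Function.minimalPeriod (step ω) d with hL
  have hLpos : 0 < L := Function.minimalPeriod_pos_of_mem_periodicPts h
  have hLd : (step ω)^[L] d = d := Function.iterate_minimalPeriod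
  have hL1 : L ≠ 1 := by
    intro h1
    rw [h1, Function.iterate_one] at hLd
    have := isUnitStep_pos ω d
    rw [hLd, sub_self] at this
    revert this
    simp [IsUnitStep, Prod.ext_iff]
  -- A period of length one would make a unit step vanish. With period N + 2, the points with
  -- indices 0, ..., N + 1 are the vertices of the polygon.
  obtain ⟨N, hN⟩ : ∃ N, L = N + 2 := ⟨L - 2, by omega⟩
  have hpred : (step ω)^[N + 1] d = pred ω d := by
    apply step_injective ω
    rw [step_pred, ← Function.iterate_succ_apply' (step ω), show (N + 1).succ = L by omega, hLd]
  have hdstep : pos (step ω d) - pos d ≠ (-1, 0) := by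
    intro h'
    have := no_u_turn ω (pred ω d)
    rw [step_pred, h', hpos] at this
    exact this rfl
  have hend : pos ((step ω)^[N + 1] d) - pos ((step ω)^[N] d) ≠ (-1, 0) := by
    intro h'
    have := no_u_turn ω ((step ω)^[N] d)
    rw [← Function.iterate_succ_apply' (step ω)] at this
    rw [show N.succ = N + 1 from rfl, h', hpred, step_pred, hpos] at this
    exact this rfl
  have key := sum_cornerTurn_polygon (p := fun k => pos ((step ω)^[k] d)) (N := N)
    (fun i j hij hj => pos_iterate_ne fun he => by
      have := Function.iterate_injOn_Iio_minimalPeriod (f := step ω) (x := d)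
        (show i < L by omega) (show j < L by omega) he
      omega)
    (fun i _ => by rw [Function.iterate_succ_apply']; exact isUnitStep_pos ω _)
    (fun i _ => by simpa using hlow i)
    (by simpa [hpred] using hpos) (by simpa using hdstep) hend
  -- Every turn is shared by the two corners next to it; a cyclic shift of the index gives the
  -- factor two.
  have h2 : 2 * ∑ k ∈ Finset.range L, turn ω ((step ω)^[k] d) =
      ∑ k ∈ Finset.range L, (turn ω ((step ω)^[k] d) + turn ω ((step ω)^[k + 1] d)) := by
    have hshift := Finset.sum_range_succ' (fun k => turn ω ((step ω)^[k] d)) L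
    rw [Finset.sum_range_succ, hLd] at hshift
    rw [Finset.sum_add_distrib]
    simp only [Function.iterate_zero, id_eq] at hshift
    linarith
  have h3 : ∑ k ∈ Finset.range L, (turn ω ((step ω)^[k] d) + turn ω ((step ω)^[k + 1] d)) =
      2 * ∑ k ∈ Finset.range L, cornerTurn
        (pos ((step ω)^[k + 1] d) - pos ((step ω)^[k] d))
        (pos ((step ω)^[k + 2] d) - pos ((step ω)^[k + 1] d)) := by
    rw [Finset.mul_sum]
    refine Finset.sum_congr rfl fun k _ => ?_
    rw [Function.iterate_succ_apply' (step ω) (k + 1), Function.iterate_succ_apply' (step ω) k,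
      two_mul_cornerTurn]
  have h4 := mul_left_cancel₀ two_ne_zero (h2.trans h3)
  have e2 : (step ω)^[N + 2] d = d := by rw [← hN, hLd]
  have e3 : (step ω)^[N + 1 + 2] d = step ω d := by
    rw [show N + 1 + 2 = (N + 2).succ from rfl, Function.iterate_succ_apply', e2]
  rw [h4, hN, Finset.sum_range_succ, Finset.sum_range_succ, show N + 1 + 1 = N + 2 from rfl,
    e2, e3, hpred, hpos]
  rw [hpred] at key
  exact key

theorem orbit_eq_of_mem {ω : Config} {d e : DirEdge} (h : OnLoop ω d) (he : e ∈ orbit ω d) :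
    orbit ω e = orbit ω d := by
  obtain ⟨k, rfl⟩ := (mem_orbit h).1 he
  ext f
  rw [mem_orbit h, mem_orbit ((onLoop_iterate k).2 h)]
  constructor
  · rintro ⟨j, hj⟩
    exact ⟨j + k, by rwa [Function.iterate_add_apply]⟩
  · rintro ⟨j, hj⟩
    obtain ⟨i, hi⟩ := h.exists_iterate_eq (k := k) rfl
    exact ⟨j + i, by rwa [Function.iterate_add_apply, hi]⟩

theorem mem_orbit_rev {ω : Config} {d e : DirEdge} (h : OnLoop ω d) :
    e ∈ orbit ω d.rev ↔ e.rev ∈ orbit ω d := by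
  have key : ∀ d e : DirEdge, OnLoop ω d → e ∈ orbit ω d.rev → e.rev ∈ orbit ω d := by
    intro d e h he
    obtain ⟨k, rfl⟩ := (mem_orbit h.rev).1 he
    have h1 := iterate_step_rev ω d.rev k
    rw [rev_rev] at h1
    obtain ⟨j, hj⟩ := OnLoop.exists_iterate_eq ((onLoop_iterate k).2 h.rev).rev h1
    exact (mem_orbit h).2 ⟨j, hj⟩
  refine ⟨key d e h, fun he => ?_⟩
  have := key d.rev e.rev h.rev (by rwa [rev_rev])
  rwa [rev_rev] at this

theorem step_mem_orbit {ω : Config} {d e : DirEdge} (h : OnLoop ω d) :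
    step ω e ∈ orbit ω d ↔ e ∈ orbit ω d := by
  rw [mem_orbit h, mem_orbit h]
  constructor
  · rintro ⟨k, hk⟩
    exact h.exists_of_step_eq hk
  · rintro ⟨k, hk⟩
    exact ⟨k + 1, by rw [Function.iterate_succ_apply', hk]⟩

/-- Each arc is matched with itself traversed backwards, which changes the sign of its turn. Since a
turn is attached to the edge before the arc, the bijection involves `pred`. -/
theorem sum_turn_orbit_rev {ω : Config} {d : DirEdge} (h : OnLoop ω d) :
    ∑ e ∈ orbit ω d.rev, turn ω e = - ∑ e ∈ orbit ω d, turn ω e := by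
  rw [← Finset.sum_neg_distrib]
  refine Finset.sum_bij' (fun e _ => pred ω e.rev) (fun e _ => (step ω e).rev) ?_ ?_ ?_ ?_ ?_
  · intro e he
    rw [← step_mem_orbit h, step_pred]
    exact (mem_orbit_rev h).1 he
  · intro e he
    rw [mem_orbit_rev h, rev_rev]
    exact (step_mem_orbit h).2 he
  · intro e _
    rw [step_pred, rev_rev]
  · intro e _
    rw [rev_rev, pred_step]
  · intro e _
    rw [turn_pred, rev_rev, neg_neg]

/-- From a vertex at or below every crossed side, moving along (1, -1) reaches infinity without
crossing the loop. -/
theorem not_surrounds_of_lowest {ω : Config} {d : DirEdge} (h : OnLoop ω d) {v : Pt}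
    (hv : Even (v.1 + v.2)) (hlow : ∀ a b, Crosses ω d a b → v.2 ≤ a.2 ∧ v.2 ≤ b.2) :
    ¬ Surrounds ω d v := by
  obtain ⟨K, hK⟩ := h.surrounds_bounded
  have key : ∀ J : ℕ, Surrounds ω d v ↔ Surrounds ω d (v.1 + J, v.2 - J) := by
    intro J
    induction J with
    | zero => simp
    | succ J ih =>
      have := surrounds_antidiag h (v := (v.1 + J, v.2 - J)) (by
        rw [Int.even_iff] at *; dsimp only; omega)
      have hn : ¬ Crosses ω d (v.1 + J, v.2 - J) (v.1 + J + 1, v.2 - J - 1) := fun hc => by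
        have := (hlow _ _ hc).2
        dsimp only at this
        omega
      have he : (v.1 + J + 1, v.2 - J - 1) = (v.1 + (J + 1 : ℕ), v.2 - (J + 1 : ℕ)) := by
        ext <;> push_cast <;> ring
      dsimp only at this
      rw [he] at this hn
      tauto
  intro hs
  have := (hK _ ((key (K + 1 + v.1.natAbs + v.2.natAbs)).1 hs)).2.2
  dsimp only at this
  rw [abs_le] at this
  push_cast at this
  have := neg_abs_le v.1
  have := le_abs_self v.2
  have := abs_nonneg v.1
  have := abs_nonneg v.2
  omega

theorem pos_snd (d : DirEdge) : (pos d).2 ≤ d.left.2 ∧ (pos d).2 ≤ d.right.2 ∧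
    ((pos d).2 = d.left.2 ∨ (pos d).2 = d.right.2) := by
  have h := right_snd_eq d
  have h1 := left_snd d
  unfold pos
  rcases units_cases d.dx with hx | hx <;> rcases units_cases d.dy with hy | hy <;>
    rw [hx] at h h1 <;> rw [hy] at h1 <;> rw [hx, hy] <;> dsimp only <;> omega

/-- When the loop moves to the right on its lowest level, the vertex to its right is at the bottom,
hence outside; so the inside is to the left. -/
theorem counterClockwise_of_lowest {ω : Config} {d : DirEdge} (h : OnLoop ω d)
    (hpos : pos (step ω d) - pos d = (1, 0))
    (hlow : ∀ k, (pos d).2 ≤ (pos ((step ω)^[k] d)).2) : CounterClockwise ω d := by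
  classical
  have hr : (pos d).2 = d.right.2 := by
    rw [pos_step] at hpos
    have h1 := right_snd d
    have h2 := left_snd d
    have h3 : (pos d).2 = d.src.1.2 + ((d.dy : ℤ) - 1) / 2 := rfl
    rw [h1, h3]
    rcases Int.units_eq_one_or d.dx with hx | hx <;>
      rcases Int.units_eq_one_or d.dy with hy | hy <;> rw [hx, hy] at hpos <;> rw [hx, hy] <;>
      by_cases ht : TurnsLeft ω d <;> simp [arcStep, ht] at hpos ⊢
  have hn : ¬ Surrounds ω d d.right := by
    refine not_surrounds_of_lowest h ?_ ?_
    · have := d.primal_left_xor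
      simp only [IsPrimal, IsDual, Int.even_iff, Int.odd_iff] at *
      omega
    · rintro a b ⟨k, hk⟩
      have h1 := hlow k
      have h2 := pos_snd ((step ω)^[k] d)
      rcases Sym2.eq_iff.1 hk with ⟨ha, hb⟩ | ⟨ha, hb⟩ <;> rw [ha, hb] at h2 <;> omega
  exact h.counterClockwise_iff.2 hn

theorem exists_lowest {ω : Config} {d : DirEdge} (h : OnLoop ω d) : ∃ j,
    (∀ k, (pos ((step ω)^[j] d)).2 ≤ (pos ((step ω)^[k] d)).2) ∧
    (pos (step ω ((step ω)^[j] d)) - pos ((step ω)^[j] d) = (1, 0) ∨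
      pos (step ω ((step ω)^[j] d)) - pos ((step ω)^[j] d) = (-1, 0)) := by
  set L := Function.minimalPeriod (step ω) d with hL
  have hLpos : 0 < L := Function.minimalPeriod_pos_of_mem_periodicPts h
  obtain ⟨k, -, hk⟩ := Finset.exists_min_image (Finset.range L)
    (fun k => (pos ((step ω)^[k] d)).2) ⟨0, by simpa using hLpos⟩
  have hk' : ∀ j, (pos ((step ω)^[k] d)).2 ≤ (pos ((step ω)^[j] d)).2 := by
    intro j
    have := hk (j % L) (by simpa using Nat.mod_lt _ hLpos)
    rwa [Function.iterate_mod_minimalPeriod_eq] at this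
  rcases isUnitStep_pos ω ((step ω)^[k] d) with h1 | h1 | h1 | h1
  · exact ⟨k, hk', Or.inl h1⟩
  · exact ⟨k, hk', Or.inr h1⟩
  -- If the path goes up from a lowest position, the step before cannot be upwards by minimality,
  -- nor downwards since there are no U-turns. It is horizontal and starts at the same level.
  · have hc : step ω ((step ω)^[k + (L - 1)] d) = (step ω)^[k] d := by
      rw [← Function.iterate_succ_apply' (step ω), show (k + (L - 1)).succ = k + L by omega,
        Function.iterate_add_apply, Function.iterate_minimalPeriod]
    have hu := no_u_turn ω ((step ω)^[k + (L - 1)] d)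
    have hm := hk' (k + (L - 1))
    have hs := isUnitStep_pos ω ((step ω)^[k + (L - 1)] d)
    rw [hc, h1] at hu
    rw [hc] at hs
    have hlow : ∀ e : ℤ × ℤ, pos ((step ω)^[k] d) - pos ((step ω)^[k + (L - 1)] d) = e →
        e.2 = 0 → ∀ j, (pos ((step ω)^[k + (L - 1)] d)).2 ≤ (pos ((step ω)^[j] d)).2 := by
      intro e he he2 j
      have h5 := congrArg Prod.snd he
      rw [Prod.snd_sub, he2] at h5
      have := hk' j
      omega
    rcases hs with h2 | h2 | h2 | h2
    · exact ⟨_, hlow _ h2 rfl, by rw [hc]; exact Or.inl h2⟩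
    · exact ⟨_, hlow _ h2 rfl, by rw [hc]; exact Or.inr h2⟩
    · have h5 := congrArg Prod.snd h2
      rw [Prod.snd_sub] at h5
      dsimp only at h5
      omega
    · rw [h2] at hu
      exact absurd rfl hu
  · have h5 := congrArg Prod.snd h1
    have := hk' (k + 1)
    rw [Function.iterate_succ_apply'] at this
    rw [Prod.snd_sub] at h5
    dsimp only at h5
    omega

/-- The turning number of loops: counter-clockwise loops make four more turns to the left than to
the right, clockwise loops four fewer. -/
theorem sum_turn_orbit {ω : Config} {d : DirEdge} (h : OnLoop ω d) [Decidable (Clockwise ω d)] :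
    ∑ e ∈ orbit ω d, turn ω e = if Clockwise ω d then -4 else 4 := by
  obtain ⟨j, hlow, hj⟩ := exists_lowest h
  set c := (step ω)^[j] d with hc
  have hcl : OnLoop ω c := (onLoop_iterate j).2 h
  have hcd : Clockwise ω c ↔ Clockwise ω d := clockwise_iterate h j
  have hlow' : ∀ k, (pos c).2 ≤ (pos ((step ω)^[k] c)).2 := fun k => by
    rw [hc, ← Function.iterate_add_apply]; exact hlow _
  have horb : orbit ω c = orbit ω d := orbit_eq_of_mem h ((mem_orbit h).2 ⟨j, rfl⟩)
  rcases hj with hj | hj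
  · rw [if_neg]
    · have h1 : (pos (step ω c)).2 = (pos c).2 := by
        have := congrArg Prod.snd hj
        rw [Prod.snd_sub] at this
        dsimp only at this
        omega
      -- Applied after one step, because `sum_turn_of_lowest` requires the rightward step to be the
      -- one that arrives at its base point.
      have := sum_turn_of_lowest (onLoop_step.2 hcl) (by rwa [pred_step]) (fun k => by
        rw [h1, ← Function.iterate_succ_apply]; exact hlow' _)
      rwa [orbit_eq_of_mem hcl (show step ω c ∈ orbit ω c from (mem_orbit hcl).2 ⟨1, rfl⟩),
        horb] at this
    · rw [← hcd]
      exact (hcl.counterClockwise_iff).1 (counterClockwise_of_lowest hcl hj hlow')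
  -- A leftward step on the lowest level becomes a rightward one on the reversed loop.
  · have hlowr : ∀ k, (pos c).2 ≤ (pos ((step ω)^[k] c.rev)).2 := fun k => by
      have := (mem_orbit_rev hcl).1 ((mem_orbit hcl.rev).2 ⟨k, rfl⟩)
      obtain ⟨i, hi⟩ := (mem_orbit hcl).1 this
      rw [← pos_rev ((step ω)^[k] c.rev), ← hi]
      exact hlow' i
    have hp : pos c.rev - pos (pred ω c.rev) = (1, 0) := by
      rw [pred, rev_rev, pos_rev, pos_rev, ← neg_sub, hj]; rfl
    have h4 := sum_turn_of_lowest hcl.rev hp (fun k => by rw [pos_rev]; exact hlowr k)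
    rw [sum_turn_orbit_rev hcl, horb] at h4
    rw [if_pos]
    · omega
    · have hr : OnLoop ω (step ω c).rev := (onLoop_step.2 hcl).rev
      have h1 : (pos (step ω c)).2 = (pos c).2 := by
        have := congrArg Prod.snd hj
        rw [Prod.snd_sub] at this
        dsimp only at this
        omega
      have := counterClockwise_of_lowest hr
        (by rw [step_rev_step, pos_rev, pos_rev, ← neg_sub, hj]; rfl) (fun k => by
          rw [pos_rev, h1]
          cases k with
          | zero => rw [Function.iterate_zero, id_eq, pos_rev, h1]
          | succ k => rw [Function.iterate_succ_apply, step_rev_step]; exact hlowr k)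
      rw [hr.counterClockwise_iff, clockwise_rev (onLoop_step.2 hcl), clockwise_step hcl] at this
      exact hcd.1 (not_not.1 this)

/-! ### Admissible configurations -/

/-- The configurations that respect the wired-wired boundary conditions and for which the two
parts of the boundary are not connected. -/
def Admissible (n m : ℕ) (ω : Config) : Prop :=
  (∀ t, t ∉ boxE n m → ω t = wiredWired t) ∧ ω ∈ disconnectedBoundaries n m

theorem exists_primal_corners (t : Tile) : ∃ i j : Primal, IsCorner i.1 t.1 ∧ IsCorner j.1 t.1 ∧
    i.1.1 + j.1.1 = 2 * t.1.1 ∧ i.1.2 + j.1.2 = 2 * t.1.2 ∧ i ≠ j ∧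
    ∀ k : Primal, IsCorner k.1 t.1 → k = i ∨ k = j := by
  obtain ⟨⟨a, b⟩, h⟩ := t
  rw [Int.odd_iff] at h
  dsimp only at h
  by_cases hb : b % 2 = 0
  · refine ⟨⟨(a + 1, b), ?_⟩, ⟨(a - 1, b), ?_⟩, ?_, ?_, ?_, ?_, ?_, ?_⟩
    · simp only [IsPrimal, Int.even_iff]; omega
    · simp only [IsPrimal, Int.even_iff]; omega
    · rw [isCorner_iff]; simp
    · rw [isCorner_iff]; simp
    · dsimp only; ring
    · dsimp only; ring
    · intro he
      have := congrArg (fun v : Primal => v.1.1) he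
      dsimp only at this
      omega
    · rintro ⟨k, hk⟩ hc
      rw [isCorner_iff] at hc
      simp only [IsPrimal, Int.even_iff] at hk
      dsimp only at hc
      simp only [Subtype.mk.injEq, Prod.ext_iff]
      omega
  · refine ⟨⟨(a, b + 1), ?_⟩, ⟨(a, b - 1), ?_⟩, ?_, ?_, ?_, ?_, ?_, ?_⟩
    · simp only [IsPrimal, Int.even_iff]; omega
    · simp only [IsPrimal, Int.even_iff]; omega
    · rw [isCorner_iff]; simp
    · rw [isCorner_iff]; simp
    · dsimp only; ring
    · dsimp only; ring
    · intro he
      have := congrArg (fun v : Primal => v.1.2) he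
      dsimp only at this
      omega
    · rintro ⟨k, hk⟩ hc
      rw [isCorner_iff] at hc
      simp only [IsPrimal, Int.even_iff] at hk
      dsimp only at hc
      simp only [Subtype.mk.injEq, Prod.ext_iff]
      omega

theorem exists_dual_corners (t : Tile) : ∃ u v : Dual, IsCorner u.1 t.1 ∧ IsCorner v.1 t.1 ∧
    u.1.1 + v.1.1 = 2 * t.1.1 ∧ u.1.2 + v.1.2 = 2 * t.1.2 ∧ u ≠ v ∧
    ∀ w : Dual, IsCorner w.1 t.1 → w = u ∨ w = v := by
  obtain ⟨⟨a, b⟩, h⟩ := t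
  rw [Int.odd_iff] at h
  dsimp only at h
  by_cases hb : b % 2 = 0
  · refine ⟨⟨(a, b + 1), ?_⟩, ⟨(a, b - 1), ?_⟩, ?_, ?_, ?_, ?_, ?_, ?_⟩
    · simp only [IsDual, Int.odd_iff]; omega
    · simp only [IsDual, Int.odd_iff]; omega
    · rw [isCorner_iff]; simp
    · rw [isCorner_iff]; simp
    · dsimp only; ring
    · dsimp only; ring
    · intro he
      have := congrArg (fun v : Dual => v.1.2) he
      dsimp only at this
      omega
    · rintro ⟨k, hk⟩ hc
      rw [isCorner_iff] at hc
      simp only [IsDual, Int.odd_iff] at hk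
      dsimp only at hc
      simp only [Subtype.mk.injEq, Prod.ext_iff]
      omega
  · refine ⟨⟨(a + 1, b), ?_⟩, ⟨(a - 1, b), ?_⟩, ?_, ?_, ?_, ?_, ?_, ?_⟩
    · simp only [IsDual, Int.odd_iff]; omega
    · simp only [IsDual, Int.odd_iff]; omega
    · rw [isCorner_iff]; simp
    · rw [isCorner_iff]; simp
    · dsimp only; ring
    · dsimp only; ring
    · intro he
      have := congrArg (fun v : Dual => v.1.1) he
      dsimp only at this
      omega
    · rintro ⟨k, hk⟩ hc
      rw [isCorner_iff] at hc
      simp only [IsDual, Int.odd_iff] at hk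
      dsimp only at hc
      simp only [Subtype.mk.injEq, Prod.ext_iff]
      omega

theorem iff_of_iff_iff {a b x : Prop} (h : (a ↔ x) ↔ (b ↔ x)) : b ↔ a := by tauto

theorem exists_into (t : Tile) (i : Primal) (u : Dual) (hi : IsCorner i.1 t.1)
    (hu : IsCorner u.1 t.1) : ∃ e : DirEdge, e.tgt = t ∧ e.primal = i ∧ e.dual = u := by
  have hi2 := i.2
  have hu2 := u.2
  have ht := t.2
  rw [isCorner_iff] at hi hu
  simp only [IsPrimal, IsDual, Int.even_iff, Int.odd_iff] at hi2 hu2 ht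
  have hcase : ((u.1.1 - i.1.1 = 1 ∨ u.1.1 - i.1.1 = -1) ∧
      (u.1.2 - i.1.2 = 1 ∨ u.1.2 - i.1.2 = -1)) ∧
      ((t.1.1 = i.1.1 ∧ t.1.2 = u.1.2) ∨ (t.1.1 = u.1.1 ∧ t.1.2 = i.1.2)) := by
    rcases hi with hi | hi | hi | hi <;> rcases hu with hu | hu | hu | hu <;> omega
  obtain ⟨⟨hc1, hc2⟩, h4⟩ := hcase
  obtain ⟨e, he1, he2, he3⟩ := exists_edge i u
    ((abs_eq one_pos.le).2 hc1) ((abs_eq one_pos.le).2 hc2)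
    (t.1.1 = i.1.1 ↔ u.1.1 - i.1.1 = u.1.2 - i.1.2)
  refine ⟨e, ?_, he1, he2⟩
  have h1 := e.PL_iff
  have h2 := e.corner_cases
  rw [he3, he1, he2] at h1
  rw [he1, he2] at h2
  have h3 : e.tgt.1.1 = i.1.1 ↔ t.1.1 = i.1.1 := iff_of_iff_iff h1
  clear h1 he3
  clear hi hu ht
  have h5 : u.1.1 ≠ i.1.1 := by omega
  rcases h2.2.2 with h6 | h6 <;> rcases h4 with h7 | h7 <;>
    [skip; exact absurd (h7.1 ▸ h3.1 h6.1) h5; exact absurd (h6.1 ▸ h3.2 h7.1) h5; skip] <;>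
    exact Subtype.ext (Prod.ext (h6.1.trans h7.1.symm) (h6.2.trans h7.2.symm))

theorem mem_boxE_iff {n m : ℕ} {t : Tile} :
    t ∈ boxE n m ↔ ∃ i : Primal, i ∈ boxB n m ∧ IsCorner i.1 t.1 := by
  constructor
  · rintro (h | ⟨⟨i, hi, hc⟩, -⟩)
    · obtain ⟨i, -, hi, -⟩ := exists_primal_corners t
      exact ⟨i, h i hi, hi⟩
    · exact ⟨i, hi, hc⟩
  · rintro ⟨i, hi, hc⟩
    by_cases h : t ∈ edgesWithin (boxB n m)
    · exact Or.inl h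
    · simp only [edgesWithin, Set.mem_ofPred_eq, not_forall] at h
      obtain ⟨j, hj, hj'⟩ := h
      exact Or.inr ⟨⟨i, hi, hc⟩, j, hj', hj⟩

/-- In doubled coordinates, the edges between the lines y = 0 and y = -1 are the tiles at height -1.
-/
theorem wiredWired_eq_true_iff (t : Tile) : wiredWired t = true ↔ t.1.2 ≠ -1 := by
  obtain ⟨i, j, hi, hj, h1, h2, hne, hall⟩ := exists_primal_corners t
  have hi2 := i.2
  have hj2 := j.2
  have ht := t.2
  have hne' : ¬ (i.1.1 = j.1.1 ∧ i.1.2 = j.1.2) :=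
    fun h => hne (Subtype.ext (Prod.ext h.1 h.2))
  simp only [wiredWired, decide_eq_true_eq]
  have key : ∀ p : Primal → Prop, (∀ k : Primal, IsCorner k.1 t.1 → p k) ↔ p i ∧ p j :=
    fun p => ⟨fun h => ⟨h i hi, h j hj⟩, fun h k hk => by rcases hall k hk with rfl | rfl <;> tauto⟩
  rw [key, key]
  rw [isCorner_iff] at hi hj
  simp only [IsPrimal, Int.even_iff, Int.odd_iff] at hi2 hj2 ht
  clear key hall hne
  omega

theorem inB_iff {n m : ℕ} (i : Primal) :
    InB n m i.1 ↔ (-(2 * n : ℤ) ≤ i.1.1 ∧ i.1.1 ≤ 2 * n) ∧ (-(2 * m : ℤ) ≤ i.1.2 ∧ i.1.2 ≤ 2 * m) := by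
  unfold InB
  rw [abs_le, abs_le]
  exact ⟨fun h => h.2, fun h => ⟨i.2, h⟩⟩

theorem inB'_iff {n m : ℕ} (u : Dual) :
    InB' n m u.1 ↔ (-(2 * n + 1 : ℤ) ≤ u.1.1 ∧ u.1.1 ≤ 2 * n + 1) ∧
      (-(2 * m + 1 : ℤ) ≤ u.1.2 ∧ u.1.2 ≤ 2 * m + 1) := by
  unfold InB'
  rw [abs_le, abs_le]
  exact ⟨fun h => h.2, fun h => ⟨u.2, h⟩⟩

theorem mem_boxB_iff {n m : ℕ} (i : Primal) :
    i ∈ boxB n m ↔ (-(2 * n : ℤ) ≤ i.1.1 ∧ i.1.1 ≤ 2 * n) ∧ (-(2 * m : ℤ) ≤ i.1.2 ∧ i.1.2 ≤ 2 * m) :=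
  inB_iff i

/-- The primal vertex with (ordinary) coordinates `(x, y)`. -/
def pvertex (x y : ℤ) : Primal := ⟨(2 * x, 2 * y), even_two_mul x, even_two_mul y⟩

theorem exists_pvertex (i : Primal) : ∃ x y, i = pvertex x y := by
  obtain ⟨⟨a, b⟩, ⟨x, hx⟩, y, hy⟩ := i
  exact ⟨x, y, Subtype.ext (Prod.ext (by dsimp only [pvertex] at *; omega)
    (by dsimp only [pvertex] at *; omega))⟩

theorem pvertex_mem_boxB {n m : ℕ} {x y : ℤ} :
    pvertex x y ∈ boxB n m ↔ (-(n : ℤ) ≤ x ∧ x ≤ n) ∧ (-(m : ℤ) ≤ y ∧ y ≤ m) := by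
  rw [mem_boxB_iff]
  dsimp only [pvertex]
  omega

theorem pvertex_ne {x y x' y' : ℤ} (h : x ≠ x' ∨ y ≠ y') : pvertex x y ≠ pvertex x' y' := by
  intro he
  have h1 := congrArg (fun v : Primal => v.1.1) he
  have h2 := congrArg (fun v : Primal => v.1.2) he
  dsimp only [pvertex] at h1 h2
  omega

/-! ### Connectivity and surrounding outside the box. -/

section

variable {n m : ℕ} {ω : Config}

theorem Admissible.open_of (h : Admissible n m ω) {t : Tile} (ht : t ∉ boxE n m)
    (ht' : t.1.2 ≠ -1) : ω t = true := by
  rw [h.1 t ht, wiredWired_eq_true_iff]; exact ht'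

theorem Admissible.closed_of (h : Admissible n m ω) {t : Tile} (ht : t ∉ boxE n m)
    (ht' : t.1.2 = -1) : ω t = false := by
  rw [h.1 t ht, ← Bool.not_eq_true, wiredWired_eq_true_iff]; exact not_not.2 ht'

theorem reachable_of_open {t : Tile} {i j : Primal} (ht : ω t = true) (hi : IsCorner i.1 t.1)
    (hj : IsCorner j.1 t.1) (hij : i ≠ j) : (openGraph ω).Reachable i j :=
  SimpleGraph.Adj.reachable ⟨hij, t, ht, hi, hj⟩

theorem Admissible.reachable_vertical (h : Admissible n m ω) {x y : ℤ} (k : ℕ)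
    (hB : ∀ j : ℕ, j ≤ k → pvertex x (y + j) ∉ boxB n m) (hy : ∀ j : ℕ, j < k → y + j ≠ -1) :
    (openGraph ω).Reachable (pvertex x y) (pvertex x (y + k)) := by
  induction k with
  | zero => simp
  | succ k ih =>
    refine (ih (fun j hj => hB j (by omega)) fun j hj => hy j (by omega)).trans ?_
    have h1 := hB k (by omega)
    have h2 := hB (k + 1) (by omega)
    have h3 := hy k (by omega)
    have ht : Odd (2 * x + (2 * (y + k) + 1)) := by rw [Int.odd_iff]; omega
    refine reachable_of_open (t := ⟨(2 * x, 2 * (y + k) + 1), ht⟩) (h.open_of ?_ ?_) ?_ ?_ ?_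
    · rw [mem_boxE_iff]
      rintro ⟨i, hi, hc⟩
      rw [isCorner_iff] at hc
      have := i.2
      rw [mem_boxB_iff] at hi
      rw [pvertex_mem_boxB] at h1 h2
      simp only [IsPrimal, Int.even_iff] at this
      push_cast at *
      omega
    · dsimp only; omega
    · rw [isCorner_iff]; dsimp only [pvertex]; omega
    · rw [isCorner_iff]; dsimp only [pvertex]; push_cast; omega
    · exact pvertex_ne (Or.inr (by push_cast; omega))

theorem Admissible.reachable_horizontal (h : Admissible n m ω) {x y : ℤ} (k : ℕ)
    (hB : ∀ j : ℕ, j ≤ k → pvertex (x + j) y ∉ boxB n m) :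
    (openGraph ω).Reachable (pvertex x y) (pvertex (x + k) y) := by
  induction k with
  | zero => simp
  | succ k ih =>
    refine (ih (fun j hj => hB j (by omega))).trans ?_
    have h1 := hB k (by omega)
    have h2 := hB (k + 1) (by omega)
    have ht : Odd ((2 * (x + k) + 1) + 2 * y) := by rw [Int.odd_iff]; omega
    refine reachable_of_open (t := ⟨(2 * (x + k) + 1, 2 * y), ht⟩) (h.open_of ?_ ?_) ?_ ?_ ?_
    · rw [mem_boxE_iff]
      rintro ⟨i, hi, hc⟩
      rw [isCorner_iff] at hc
      have := i.2
      rw [mem_boxB_iff] at hi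
      rw [pvertex_mem_boxB] at h1 h2
      simp only [IsPrimal, Int.even_iff] at this
      push_cast at *
      omega
    · dsimp only; omega
    · rw [isCorner_iff]; dsimp only [pvertex]; omega
    · rw [isCorner_iff]; dsimp only [pvertex]; push_cast; omega
    · exact pvertex_ne (Or.inl (by push_cast; omega))

/-- Both vertices are joined vertically to a level above the box and then to each other along that
level. These paths avoid the box and the closed edges between y = 0 and y = -1. -/
theorem Admissible.reachable_upper (h : Admissible n m ω) {i j : Primal} (hi : i ∉ boxB n m)
    (hj : j ∉ boxB n m) (hi0 : 0 ≤ i.1.2) (hj0 : 0 ≤ j.1.2) : (openGraph ω).Reachable i j := by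
  have up : ∀ i : Primal, i ∉ boxB n m → 0 ≤ i.1.2 → ∀ M : ℕ, i.1.2 ≤ 2 * M →
      (openGraph ω).Reachable i (pvertex (i.1.1 / 2) M) := by
    intro i hi hi0 M hM
    obtain ⟨x, y, rfl⟩ := exists_pvertex i
    rw [pvertex_mem_boxB] at hi
    dsimp only [pvertex] at hi0 hM
    have := h.reachable_vertical (x := x) (y := y) (M - y).toNat
      (fun j _ => by rw [pvertex_mem_boxB]; omega) (fun j _ => by omega)
    rw [show y + (M - y).toNat = M by omega] at this
    rwa [show (pvertex x y).1.1 / 2 = x by dsimp only [pvertex]; omega]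
  have across : ∀ x x' : ℤ, ∀ M : ℕ, m < M → x ≤ x' →
      (openGraph ω).Reachable (pvertex x M) (pvertex x' M) := by
    intro x x' M hM hx
    have := h.reachable_horizontal (x := x) (y := M) (x' - x).toNat
      (fun j _ => by rw [pvertex_mem_boxB]; omega)
    rwa [show x + (x' - x).toNat = x' by omega] at this
  set M : ℕ := m + 1 + i.1.2.toNat + j.1.2.toNat with hM
  refine (up i hi hi0 M (by omega)).trans (SimpleGraph.Reachable.trans ?_
    (up j hj hj0 M (by omega)).symm)
  rcases le_total (i.1.1 / 2) (j.1.1 / 2) with hx | hx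
  · exact across _ _ M (by omega) hx
  · exact (across _ _ M (by omega) hx).symm

theorem Admissible.reachable_lower (h : Admissible n m ω) {i j : Primal} (hi : i ∉ boxB n m)
    (hj : j ∉ boxB n m) (hi0 : i.1.2 < 0) (hj0 : j.1.2 < 0) : (openGraph ω).Reachable i j := by
  have down : ∀ i : Primal, i ∉ boxB n m → i.1.2 < 0 → ∀ M : ℕ, -i.1.2 ≤ 2 * M →
      (openGraph ω).Reachable (pvertex (i.1.1 / 2) (-M)) i := by
    intro i hi hi0 M hM
    obtain ⟨x, y, rfl⟩ := exists_pvertex i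
    rw [pvertex_mem_boxB] at hi
    dsimp only [pvertex] at hi0 hM
    have := h.reachable_vertical (x := x) (y := -M) (y + M).toNat
      (fun j _ => by rw [pvertex_mem_boxB]; omega) (fun j _ => by omega)
    rw [show -(M : ℤ) + (y + M).toNat = y by omega] at this
    rwa [show (pvertex x y).1.1 / 2 = x by dsimp only [pvertex]; omega]
  have across : ∀ x x' : ℤ, ∀ M : ℕ, m < M → x ≤ x' →
      (openGraph ω).Reachable (pvertex x (-M)) (pvertex x' (-M)) := by
    intro x x' M hM hx
    have := h.reachable_horizontal (x := x) (y := -M) (x' - x).toNat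
      (fun j _ => by rw [pvertex_mem_boxB]; omega)
    rwa [show x + (x' - x).toNat = x' by omega] at this
  set M : ℕ := m + 1 + (-i.1.2).toNat + (-j.1.2).toNat with hM
  refine (down i hi hi0 M (by omega)).symm.trans (SimpleGraph.Reachable.trans ?_
    (down j hj hj0 M (by omega)))
  rcases le_total (i.1.1 / 2) (j.1.1 / 2) with hx | hx
  · exact across _ _ M (by omega) hx
  · exact (across _ _ M (by omega) hx).symm

theorem pvertex_mem_upperBoundary (n m : ℕ) : pvertex 0 (m + 1) ∈ upperBoundary n m := by
  refine ⟨⟨?_, pvertex 0 m, ?_, pvertex_ne (by omega), ⟨(0, 2 * m + 1), ?_⟩, rfl, ?_, ?_⟩, ?_⟩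
  · rw [pvertex_mem_boxB]; omega
  · rw [pvertex_mem_boxB]; omega
  · rw [Int.odd_iff]; omega
  · rw [isCorner_iff]; dsimp only [pvertex]; omega
  · rw [isCorner_iff]; dsimp only [pvertex]; omega
  · dsimp only [pvertex]; omega

theorem pvertex_mem_lowerBoundary (n m : ℕ) : pvertex 0 (-m - 1) ∈ lowerBoundary n m := by
  refine ⟨⟨?_, pvertex 0 (-m), ?_, pvertex_ne (by omega), ⟨(0, -2 * m - 1), ?_⟩, rfl, ?_, ?_⟩, ?_⟩
  · rw [pvertex_mem_boxB]; omega
  · rw [pvertex_mem_boxB]; omega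
  · rw [Int.odd_iff]; omega
  · rw [isCorner_iff]; dsimp only [pvertex]; omega
  · rw [isCorner_iff]; dsimp only [pvertex]; omega
  · dsimp only [pvertex]; omega

theorem Admissible.not_reachable (h : Admissible n m ω) {i j : Primal} (hi : i ∉ boxB n m)
    (hj : j ∉ boxB n m) (hi0 : 0 ≤ i.1.2) (hj0 : j.1.2 < 0) :
    ¬ (openGraph ω).Reachable i j := by
  intro hr
  have hu := pvertex_mem_upperBoundary n m
  have hl := pvertex_mem_lowerBoundary n m
  exact h.2 _ hu _ hl (((h.reachable_upper hu.1.1 hi hu.2 hi0).trans hr).trans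
    (h.reachable_lower hj hl.1.1 hj0 hl.2))

/-! ### Which vertices can be surrounded -/

/-- A loop does not cross open edges: the two ends of an open edge are the primal vertices of
consecutive medial edges of some path, to which `surrounds_step_primal` applies. -/
theorem surrounds_of_reachable {d : DirEdge} (hd : OnLoop ω d) {i j : Primal}
    (h : (openGraph ω).Reachable i j) : Surrounds ω d i.1 ↔ Surrounds ω d j.1 := by
  rw [SimpleGraph.reachable_iff_reflTransGen] at h
  induction h with
  | refl => rfl
  | @tail j k _ hjk ih =>
    rw [ih]
    obtain ⟨hne, t, ht, hj, hk⟩ := hjk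
    obtain ⟨u, -, hu, -⟩ := exists_dual_corners t
    obtain ⟨e, he, hep, -⟩ := exists_into t j u hj hu
    have h1 := surrounds_step_primal hd e
    have h2 := step_primal_of_open (ω := ω) (d := e) (by rw [he, ht])
    rw [hep, he] at h2
    rw [hep] at h1
    rw [← h1]
    suffices hs : (step ω e).primal = k by rw [hs]
    apply Subtype.ext
    rw [h2]
    have hne' : ¬ (j.1.1 = k.1.1 ∧ j.1.2 = k.1.2) :=
      fun h => hne (Subtype.ext (Prod.ext h.1 h.2))
    have hj2 := j.2
    have hk2 := k.2
    have ht2 := t.2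
    rw [isCorner_iff] at hj hk
    simp only [IsPrimal, Int.even_iff, Int.odd_iff] at hj2 hk2 ht2
    ext <;> dsimp only <;> omega

/-- A vertex outside the box is connected to vertices arbitrarily far away, and these violate the
bounds of `OnLoop.surrounds_bounded`. -/
theorem Admissible.not_surrounds_primal (h : Admissible n m ω) {d : DirEdge} (hd : OnLoop ω d)
    {i : Primal} (hi : i ∉ boxB n m) : ¬ Surrounds ω d i.1 := by
  obtain ⟨K, hK⟩ := hd.surrounds_bounded
  by_cases h0 : 0 ≤ i.1.2
  · have hj : pvertex 0 (m + 1 + K) ∉ boxB n m := by rw [pvertex_mem_boxB]; omega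
    rw [surrounds_of_reachable hd (h.reachable_upper hi hj h0 (by dsimp only [pvertex]; omega))]
    intro hs
    have := (hK _ hs).2.1
    dsimp only [pvertex] at this
    omega
  · have hj : pvertex (K + 1) (-m - 1) ∉ boxB n m := by rw [pvertex_mem_boxB]; omega
    rw [surrounds_of_reachable hd (h.reachable_lower hi hj (by omega)
      (by dsimp only [pvertex]; omega))]
    intro hs
    have := (hK _ hs).1
    dsimp only [pvertex] at this
    omega

theorem tile_not_mem_boxE {u : Dual} (hu : ¬ InB' n m u.1) {t : Tile} (ht : IsCorner u.1 t.1) :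
    t ∉ boxE n m := by
  rw [mem_boxE_iff]
  rintro ⟨i, hi, hc⟩
  rw [mem_boxB_iff] at hi
  rw [inB'_iff] at hu
  rw [isCorner_iff] at ht hc
  have hi2 := i.2
  have hu2 := u.2
  simp only [IsPrimal, IsDual, Int.even_iff, Int.odd_iff] at hi2 hu2
  omega

theorem primal_not_mem_boxB {d : DirEdge} (hu : ¬ InB' n m d.dual.1) : d.primal ∉ boxB n m := by
  rw [mem_boxB_iff]
  rw [inB'_iff] at hu
  have := d.corner_cases
  omega

theorem dual_tile_level {u : Dual} {t : Tile} (ht : IsCorner u.1 t.1) (h : t.1.2 = -1) :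
    u.1.2 = -1 := by
  have hu2 := u.2
  have ht2 := t.2
  rw [isCorner_iff] at ht
  simp only [IsDual, Int.odd_iff] at hu2 ht2
  omega

/-- The dual vertex with coordinates `(x + 1/2, -1/2)`. -/
def dualOnLine (x : ℤ) : Dual :=
  ⟨(2 * x + 1, -1), by simp only [IsDual, Int.odd_iff]; omega⟩

theorem exists_dualOnLine {u : Dual} (h : u.1.2 = -1) : ∃ x, u = dualOnLine x := by
  obtain ⟨x, hx⟩ := u.2.1
  exact ⟨x, Subtype.ext (Prod.ext hx h)⟩

/-- The tile between these two neighbours is closed, and loops do not cross the dual of a closed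
edge. -/
theorem Admissible.surrounds_dualOnLine_succ (h : Admissible n m ω) {d : DirEdge}
    (hd : OnLoop ω d) {x : ℤ} (hx : n < x ∨ x + 1 < -n) :
    Surrounds ω d (dualOnLine x).1 ↔ Surrounds ω d (dualOnLine (x + 1)).1 := by
  have ht : Odd ((2 * x + 2) + (-1)) := by rw [Int.odd_iff]; omega
  have hc : IsCorner (dualOnLine x).1 (2 * x + 2, -1) := by
    rw [isCorner_iff]; dsimp only [dualOnLine]; omega
  obtain ⟨e, he, -, heu⟩ := exists_into ⟨(2 * x + 2, -1), ht⟩ (pvertex (x + 1) 0) (dualOnLine x)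
    (by rw [isCorner_iff]; dsimp only [pvertex]; omega) hc
  have hcl : ω e.tgt = false := by
    rw [he]
    refine h.closed_of (tile_not_mem_boxE (u := dualOnLine x) ?_ hc) rfl
    rw [inB'_iff]; dsimp only [dualOnLine]; omega
  have h1 := surrounds_step_dual hd e
  have h2 := step_dual_of_closed hcl
  rw [he, heu] at h2
  have h3 : (step ω e).dual = dualOnLine (x + 1) := by
    apply Subtype.ext
    rw [h2]
    ext <;> dsimp only [dualOnLine] <;> omega
  rw [h3, heu] at h1
  exact h1.symm

/-- Outside `B'` the line y = -1/2 consists of duals of closed edges, so a dual vertex on it is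
connected to infinity on the right or on the left. -/
theorem Admissible.not_surrounds_line (h : Admissible n m ω) {d : DirEdge} (hd : OnLoop ω d)
    {u : Dual} (hu : ¬ InB' n m u.1) (hu' : u.1.2 = -1) : ¬ Surrounds ω d u.1 := by
  obtain ⟨K, hK⟩ := hd.surrounds_bounded
  obtain ⟨x, rfl⟩ := exists_dualOnLine hu'
  rw [inB'_iff] at hu
  dsimp only [dualOnLine] at hu
  by_cases hx : (n : ℤ) < x
  · have key : ∀ k : ℕ, Surrounds ω d (dualOnLine x).1 ↔ Surrounds ω d (dualOnLine (x + k)).1 := by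
      intro k
      induction k with
      | zero => simp
      | succ k ih =>
        rw [ih, h.surrounds_dualOnLine_succ hd (Or.inl (by omega))]
        push_cast
        rw [add_assoc]
    rw [key (K + 1)]
    intro hs
    have := (hK _ hs).1
    dsimp only [dualOnLine] at this
    push_cast at this
    omega
  · have key : ∀ k : ℕ, Surrounds ω d (dualOnLine x).1 ↔ Surrounds ω d (dualOnLine (x - k)).1 := by
      intro k
      induction k with
      | zero => simp
      | succ k ih =>
        have := h.surrounds_dualOnLine_succ hd (x := x - (k + 1 : ℕ)) (Or.inr (by push_cast; omega))
        rw [ih, this]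
        push_cast
        rw [show x - (k + 1) + 1 = x - k by ring]
    rw [key (K + 1)]
    intro hs
    have := (hK _ hs).2.2
    dsimp only [dualOnLine] at this
    push_cast at this
    rw [abs_le] at this
    omega

/-- All four edges around such a dual vertex are open, so a path next to it keeps turning around it.
-/
theorem Admissible.step_dual_of_outside (h : Admissible n m ω) {e : DirEdge}
    (hu : ¬ InB' n m e.dual.1) (hu' : e.dual.1.2 ≠ -1) : (step ω e).dual = e.dual :=
  step_dual_of_open (h.open_of (tile_not_mem_boxE hu (isCorner_dual e))
    fun ht => hu' (dual_tile_level (isCorner_dual e) ht))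

theorem Admissible.iterate_dual_of_outside (h : Admissible n m ω) {e : DirEdge}
    (hu : ¬ InB' n m e.dual.1) (hu' : e.dual.1.2 ≠ -1) (k : ℕ) :
    ((step ω)^[k] e).dual = e.dual := by
  induction k with
  | zero => rfl
  | succ k ih =>
    rw [Function.iterate_succ_apply', h.step_dual_of_outside (by rwa [ih]) (by rwa [ih]), ih]

theorem finite_dual_mem {S : Set Dual} (hS : S.Finite) : {d : DirEdge | d.dual ∈ S}.Finite := by
  classical
  let g : DirEdge → Dual × (ℤˣ × ℤˣ) × Bool := fun d => (d.dual, (d.dx, d.dy), decide d.PL)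
  have hg : Function.Injective g := by
    intro d e hde
    have hu : d.dual = e.dual := congrArg Prod.fst hde
    have hx : d.dx = e.dx := congrArg (fun z => z.2.1.1) hde
    have hy : d.dy = e.dy := congrArg (fun z => z.2.1.2) hde
    have hp : d.PL ↔ e.PL := by
      have : decide d.PL = decide e.PL := congrArg (fun z => z.2.2) hde
      simpa using this
    refine ext_primal_dual (Subtype.ext ?_) hu hp
    by_cases hd : d.PL
    · have h1 := coords_of_PL hd
      have h2 := coords_of_PL (hp.1 hd)
      rw [hu, hx, hy] at h1
      exact Prod.ext (by omega) (by omega)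
    · have h1 := coords_of_not_PL hd
      have h2 := coords_of_not_PL (mt hp.2 hd)
      rw [hu, hx, hy] at h1
      exact Prod.ext (by omega) (by omega)
  refine ((hS.prod (Set.finite_univ (α := (ℤˣ × ℤˣ) × Bool))).preimage hg.injOn).subset ?_
  intro d hd
  exact ⟨hd, Set.mem_univ _⟩

theorem finite_inB' (n m : ℕ) : {u : Dual | InB' n m u.1}.Finite := by
  refine Set.Finite.of_injOn (f := Subtype.val)
    (t := Set.Icc (-(2 * n + 1) : ℤ) (2 * n + 1) ×ˢ Set.Icc (-(2 * m + 1) : ℤ) (2 * m + 1))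
    (fun u hu => ?_) Subtype.val_injective.injOn ((Set.finite_Icc _ _).prod (Set.finite_Icc _ _))
  exact (inB'_iff u).1 hu

theorem Admissible.onLoop_of_outside (h : Admissible n m ω) {e : DirEdge}
    (hu : ¬ InB' n m e.dual.1) (hu' : e.dual.1.2 ≠ -1) : OnLoop ω e := by
  by_contra hn
  have hinj := iterate_injective_of_not_onLoop hn
  have hfin := finite_dual_mem (Set.finite_singleton e.dual)
  exact Set.infinite_of_injective_forall_mem hinj
    (fun k => h.iterate_dual_of_outside hu hu' k) hfin

/-- The neighbouring primal vertices are not surrounded, so the loop separates u from them and uses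
the medial edges around u. All paths through these stay around u. -/
theorem Admissible.surrounds_outside (h : Admissible n m ω) {d : DirEdge} (hd : OnLoop ω d)
    {u : Dual} (hu : ¬ InB' n m u.1) (hs : Surrounds ω d u.1) : d.dual = u := by
  have hu' : u.1.2 ≠ -1 := fun h' => h.not_surrounds_line hd hu h' hs
  have hp : IsPrimal (u.1.1 + 1, u.1.2 + 1) := by
    have := u.2
    simp only [IsPrimal, IsDual, Int.even_iff, Int.odd_iff] at *
    omega
  obtain ⟨e, hep, heu, -⟩ := exists_edge ⟨_, hp⟩ u (by simp) (by simp) True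
  subst heu
  have hn := h.not_surrounds_primal hd (primal_not_mem_boxB hu)
  obtain ⟨k, hk⟩ := (hits_iff_primal_dual hd e).2 (by tauto)
  rcases hk with hk | hk
  · obtain ⟨j, hj⟩ := hd.exists_iterate_eq hk
    rw [← hj, h.iterate_dual_of_outside hu hu']
  · obtain ⟨j, hj⟩ := hd.exists_iterate_eq hk
    rw [← hj, h.iterate_dual_of_outside (by rwa [dual_rev]) (by rwa [dual_rev]), dual_rev]

theorem Admissible.dual_level_of_onLoop (h : Admissible n m ω) {d : DirEdge} (hd : OnLoop ω d)
    (hu : ¬ InB' n m d.dual.1) : d.dual.1.2 ≠ -1 := fun h' => by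
  have h1 := h.not_surrounds_line hd hu h'
  have h2 := h.not_surrounds_primal hd (primal_not_mem_boxB hu)
  have h3 := hd.surrounds_xor
  tauto

/-- Every side crossed by a small loop has its dual vertex u as an end. A surrounded vertex
therefore lies on the diagonal ending at u, and below u on this diagonal nothing is surrounded,
since its neighbour there is a primal vertex outside the box and no further side is crossed. -/
theorem Admissible.eq_of_surrounds_of_outside (h : Admissible n m ω) {d : DirEdge}
    (hd : OnLoop ω d) (hu : ¬ InB' n m d.dual.1) {v : Pt} (hs : Surrounds ω d v) :
    v = d.dual.1 := by
  have hu' := h.dual_level_of_onLoop hd hu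
  have hcr : ∀ a b, Crosses ω d a b → a = d.dual.1 ∨ b = d.dual.1 := by
    rintro a b ⟨k, hk⟩
    have h1 := h.iterate_dual_of_outside hu hu' k
    rw [← h1]
    by_cases hp : ((step ω)^[k] d).PL
    · rw [dual_of_PL hp]
      rcases Sym2.eq_iff.1 hk with ⟨ha, hb⟩ | ⟨ha, hb⟩
      · exact Or.inr hb.symm
      · exact Or.inl hb.symm
    · rw [dual_of_not_PL hp]
      rcases Sym2.eq_iff.1 hk with ⟨ha, hb⟩ | ⟨ha, hb⟩
      · exact Or.inl ha.symm
      · exact Or.inr ha.symm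
  have key : ∀ J : ℕ, ¬ Surrounds ω d (d.dual.1.1 - (J + 1), d.dual.1.2 - (J + 1)) := by
    intro J
    induction J with
    | zero =>
      have hp : IsPrimal (d.dual.1.1 - 1, d.dual.1.2 - 1) := by
        have := d.dual.2
        simp only [IsPrimal, IsDual, Int.even_iff, Int.odd_iff] at *
        omega
      have := h.not_surrounds_primal hd (i := ⟨_, hp⟩) (by
        rw [mem_boxB_iff]
        rw [inB'_iff] at hu
        dsimp only
        omega)
      simpa using this
    | succ J ih =>
      have h1 := surrounds_diag hd (d.dual.1.1 - (J + 1 + 1), d.dual.1.2 - (J + 1 + 1))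
      have e1 : (d.dual.1.1 - ((J : ℤ) + 1 + 1) + 1, d.dual.1.2 - ((J : ℤ) + 1 + 1) + 1) =
          (d.dual.1.1 - ((J : ℤ) + 1), d.dual.1.2 - ((J : ℤ) + 1)) := by ext <;> simp <;> ring
      dsimp only at h1
      rw [e1] at h1
      push_cast
      rw [h1]
      have h2 : ¬ Crosses ω d (d.dual.1.1 - ((J : ℤ) + 1 + 1), d.dual.1.2 - ((J : ℤ) + 1 + 1))
          (d.dual.1.1 - ((J : ℤ) + 1), d.dual.1.2 - ((J : ℤ) + 1)) := by
        intro hc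
        rcases hcr _ _ hc with h3 | h3 <;>
        · have := congrArg Prod.fst h3
          dsimp only at this
          omega
      tauto
  obtain ⟨j, hj⟩ := hs.exists_crosses
  have key' : ∀ J : ℕ, (v.1 + J, v.2 + J) = d.dual.1 → v = d.dual.1 := by
    intro J hJ
    cases J with
    | zero => simpa using hJ
    | succ J =>
      exfalso
      apply key J
      rw [← hJ]
      have : ((v.1 + (J + 1 : ℕ), v.2 + (J + 1 : ℕ)) : Pt).1 - (J + 1) = v.1 := by
        push_cast; ring
      have h2 : ((v.1 + (J + 1 : ℕ), v.2 + (J + 1 : ℕ)) : Pt).2 - (J + 1) = v.2 := by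
        push_cast; ring
      rw [this, h2]
      exact hs
  rcases hcr _ _ hj with h1 | h1
  · exact key' j h1
  · refine key' (j + 1) ?_
    rw [← h1]
    ext <;> push_cast <;> ring

/-- Together with `Admissible.inside_iff`, this shows that the two rules for loops concern
complementary cases, read off from the dual vertex of any one medial edge. -/
theorem Admissible.outside_iff (h : Admissible n m ω) {d : DirEdge} (hd : OnLoop ω d) :
    (∃ u, IsDual u ∧ ¬ InB' n m u ∧ Surrounds ω d u) ↔ ¬ InB' n m d.dual.1 := by
  constructor
  · rintro ⟨u, hu, hu', hs⟩
    rw [h.surrounds_outside hd (u := ⟨u, hu⟩) hu' hs]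
    exact hu'
  · intro hu
    have h2 := h.not_surrounds_primal hd (primal_not_mem_boxB hu)
    have h3 := hd.surrounds_xor
    exact ⟨_, d.dual.2, hu, by tauto⟩

theorem Admissible.inside_iff (h : Admissible n m ω) {d : DirEdge} (hd : OnLoop ω d) :
    (∃ v, (InB n m v ∨ InB' n m v) ∧ Surrounds ω d v) ↔ InB' n m d.dual.1 := by
  constructor
  · rintro ⟨v, hv, hs⟩
    by_contra hu
    have := h.eq_of_surrounds_of_outside hd hu hs
    subst this
    rcases hv with hv | hv
    · exact not_primal_of_dual d.dual.2 hv.1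
    · exact hu hv
  · intro hu
    by_cases hs : Surrounds ω d d.dual.1
    · exact ⟨_, Or.inr hu, hs⟩
    · have h3 := hd.surrounds_xor
      have hp : Surrounds ω d d.primal.1 := by tauto
      refine ⟨_, Or.inl ?_, hp⟩
      by_contra hn
      exact h.not_surrounds_primal hd hn hp

/-! ### Bi-infinite paths -/

/-- The primal vertex of `d` is connected to the upper, respectively lower, boundary, and `d`
is directed from right to left along the interface. -/
def Leftward (m : ℕ) (ω : Config) (d : DirEdge) : Prop :=
  ((openGraph ω).Reachable d.primal (pvertex 0 (m + 1)) ∧ ¬ d.PL) ∨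
    ((openGraph ω).Reachable d.primal (pvertex 0 (-m - 1)) ∧ d.PL)

/-- A path that is not a loop never repeats a medial edge, so it leaves the finite set of edges with
dual vertex in `B'`. Outside and off the line y = -1/2 it would be a small loop. -/
theorem Admissible.eventually_outside (h : Admissible n m ω) {d : DirEdge} (hd : ¬ OnLoop ω d) :
    ∃ K, ∀ k ≥ K, ¬ InB' n m ((step ω)^[k] d).dual.1 ∧ ((step ω)^[k] d).dual.1.2 = -1 := by
  have hinj := iterate_injective_of_not_onLoop hd
  have hfin := finite_dual_mem (finite_inB' n m)
  have := hinj.tendsto_cofinite.eventually hfin.eventually_cofinite_notMem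
  rw [Nat.cofinite_eq_atTop, eventually_atTop] at this
  obtain ⟨K, hK⟩ := this
  refine ⟨K, fun k hk => ⟨hK k hk, ?_⟩⟩
  by_contra h'
  exact hd ((onLoop_iterate k).1 (h.onLoop_of_outside (hK k hk) h'))

theorem Admissible.reachable_of_level (h : Admissible n m ω) {d : DirEdge}
    (hu : ¬ InB' n m d.dual.1) (hu' : d.dual.1.2 = -1) :
    (d.primal.1.2 = 0 ∧ (openGraph ω).Reachable d.primal (pvertex 0 (m + 1)) ∧
      ¬ (openGraph ω).Reachable d.primal (pvertex 0 (-m - 1))) ∨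
    (d.primal.1.2 = -2 ∧ (openGraph ω).Reachable d.primal (pvertex 0 (-m - 1)) ∧
      ¬ (openGraph ω).Reachable d.primal (pvertex 0 (m + 1))) := by
  have hp := primal_not_mem_boxB hu
  have h1 := pvertex_mem_upperBoundary n m
  have h2 := pvertex_mem_lowerBoundary n m
  have hc := d.corner_cases
  rcases hc.2.1 with h3 | h3
  · refine Or.inr ⟨by omega, h.reachable_lower hp h2.1.1 (by omega) h2.2, fun hr => ?_⟩
    exact h.not_reachable h1.1.1 hp h1.2 (by omega) hr.symm
  · refine Or.inl ⟨by omega, h.reachable_upper hp h1.1.1 (by omega) h1.2, fun hr => ?_⟩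
    exact h.not_reachable hp h2.1.1 (by omega) h2.2 hr

/-- Far along the path its cluster is seen to be exactly one of the upper and lower ones, and the
path follows this cluster throughout. Reversal changes only the side on which the cluster lies. -/
theorem Admissible.leftward_rev (h : Admissible n m ω) {d : DirEdge} (hd : ¬ OnLoop ω d) :
    Leftward m ω d.rev ↔ ¬ Leftward m ω d := by
  obtain ⟨K, hK⟩ := h.eventually_outside hd
  have h1 := h.reachable_of_level (hK K le_rfl).1 (hK K le_rfl).2
  have h2 := iterate_reachable ω d K
  have h3 : ∀ j, (openGraph ω).Reachable ((step ω)^[K] d).primal j ↔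
    (openGraph ω).Reachable d.primal j := fun j => ⟨fun h' => h2.trans h', fun h' => h2.symm.trans h'⟩
  rw [h3, h3] at h1
  unfold Leftward
  rw [primal_rev, PL_rev]
  tauto

theorem Admissible.leftward_direction (h : Admissible n m ω) {d : DirEdge}
    (hu : ¬ InB' n m d.dual.1) (hu' : d.dual.1.2 = -1) :
    (Leftward m ω d ↔ (d.dx : ℤ) = -1) := by
  have h1 := h.reachable_of_level hu hu'
  unfold Leftward
  by_cases hp : d.PL
  · have h2 := coords_of_PL hp
    rcases h1 with h1 | h1
    · exact iff_of_false (by tauto) (by omega)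
    · exact iff_of_true (by tauto) (by omega)
  · have h2 := coords_of_not_PL hp
    rcases h1 with h1 | h1
    · exact iff_of_true (by tauto) (by omega)
    · exact iff_of_false (by tauto) (by omega)

theorem leftward_iterate (m : ℕ) (ω : Config) (d : DirEdge) (k : ℕ) :
    Leftward m ω ((step ω)^[k] d) ↔ Leftward m ω d := by
  have h2 := iterate_reachable ω d k
  have h3 : ∀ j, (openGraph ω).Reachable ((step ω)^[k] d).primal j ↔
    (openGraph ω).Reachable d.primal j := fun j => ⟨fun h' => h2.trans h', fun h' => h2.symm.trans h'⟩
  unfold Leftward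
  rw [h3, h3, iterate_PL]

/-- Once on the line y = -1/2, the path has the cluster on a fixed side, so its horizontal direction
is constant. -/
theorem Admissible.tendsto_src (h : Admissible n m ω) {d : DirEdge} (hd : ¬ OnLoop ω d) :
    (Leftward m ω d → Tendsto (fun k : ℕ => ((step ω)^[k] d).src.1.1) atTop atBot) ∧
    (¬ Leftward m ω d → Tendsto (fun k : ℕ => ((step ω)^[k] d).src.1.1) atTop atTop) := by
  obtain ⟨K, hK⟩ := h.eventually_outside hd
  have hdir : ∀ k ≥ K, (Leftward m ω d ↔ (((step ω)^[k] d).dx : ℤ) = -1) := fun k hk => by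
    rw [← leftward_iterate m ω d k, h.leftward_direction (hK k hk).1 (hK k hk).2]
  have hsrc : ∀ k, ((step ω)^[k + 1] d).src.1.1 =
      ((step ω)^[k] d).src.1.1 + ((step ω)^[k] d).dx := fun k => by
    rw [Function.iterate_succ_apply', step_src, tgt_fst]
  constructor
  · intro hl
    rw [← tendsto_add_atTop_iff_nat K]
    have : ∀ k : ℕ, ((step ω)^[k + K] d).src.1.1 = ((step ω)^[K] d).src.1.1 - k := by
      intro k
      induction k with
      | zero => simp
      | succ k ih =>
        have h1 := (hdir (k + K) (by omega)).1 hl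
        rw [show k + 1 + K = k + K + 1 by ring, hsrc, ih, h1]
        push_cast
        ring
    simp only [this]
    rw [tendsto_atBot]
    intro b
    filter_upwards [eventually_ge_atTop (((step ω)^[K] d).src.1.1 - b).toNat] with k hk
    omega
  · intro hl
    rw [← tendsto_add_atTop_iff_nat K]
    have : ∀ k : ℕ, ((step ω)^[k + K] d).src.1.1 = ((step ω)^[K] d).src.1.1 + k := by
      intro k
      induction k with
      | zero => simp
      | succ k ih =>
        have h1 := (units_cases ((step ω)^[k + K] d).dx).resolve_right
          (fun h' => hl ((hdir (k + K) (by omega)).2 h'))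
        rw [show k + 1 + K = k + K + 1 by ring, hsrc, ih, h1]
        push_cast
        ring
    simp only [this]
    rw [tendsto_atTop]
    intro b
    filter_upwards [eventually_ge_atTop (b - ((step ω)^[K] d).src.1.1).toNat] with k hk
    omega

theorem Admissible.rightToLeft_iff (h : Admissible n m ω) {d : DirEdge} (hd : ¬ OnLoop ω d) :
    RightToLeft ω d ↔ Leftward m ω d := by
  have h1 := h.tendsto_src hd
  have h2 := h.tendsto_src (d := d.rev) (by rwa [onLoop_rev])
  have h3 := h.leftward_rev hd
  constructor
  · intro hr
    by_contra hn
    exact hr.1.not_tendsto disjoint_atBot_atTop (h1.2 hn)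
  · intro hl
    exact ⟨h1.1 hl, h2.2 (by tauto)⟩

/-! ### The orientation -/

/-- The loop through `d`, as an element of the index set of the uniform variables. -/
def loopOf {ω : Config} {d : DirEdge} (h : OnLoop ω d) : Loop := ⟨loopThrough ω d, ω, d, h, rfl⟩

/-- The orientation determined by `ω` and `U`. -/
def canonicalOrientation (n m : ℕ) (r : ℝ) (ω : Config) (U : Loop → unitInterval) :
    Set DirEdge :=
  {d | (∀ h : OnLoop ω d, Clockwise ω d ↔ (InB' n m d.dual.1 → (U (loopOf h) : ℝ) < r)) ∧
    (¬ OnLoop ω d → Leftward m ω d)}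

theorem loopOf_rev {d : DirEdge} (h : OnLoop ω d) : loopOf h.rev = loopOf h :=
  Subtype.ext (loopThrough_rev h)

theorem loopOf_step {d : DirEdge} (h : OnLoop ω d) : loopOf (onLoop_step.2 h) = loopOf h :=
  Subtype.ext (loopThrough_step h)

theorem Admissible.inB'_step (h : Admissible n m ω) {d : DirEdge} (hd : OnLoop ω d) :
    InB' n m (step ω d).dual.1 ↔ InB' n m d.dual.1 := by
  rw [← h.inside_iff hd, ← h.inside_iff (onLoop_step.2 hd)]
  have h1 : ∀ v, Surrounds ω (step ω d) v ↔ Surrounds ω d v := surrounds_iterate hd 1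
  simp only [h1]

theorem Admissible.canonicalOrientation_rev (h : Admissible n m ω) (r : ℝ)
    (U : Loop → unitInterval) (d : DirEdge) :
    d ∈ canonicalOrientation n m r ω U ↔ d.rev ∉ canonicalOrientation n m r ω U := by
  by_cases hd : OnLoop ω d
  · have e1 : d ∈ canonicalOrientation n m r ω U ↔
        (Clockwise ω d ↔ (InB' n m d.dual.1 → (U (loopOf hd) : ℝ) < r)) :=
      ⟨fun h' => h'.1 hd, fun h' => ⟨fun _ => h', fun h'' => absurd hd h''⟩⟩
    have e2 : d.rev ∈ canonicalOrientation n m r ω U ↔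
        (¬ Clockwise ω d ↔ (InB' n m d.dual.1 → (U (loopOf hd) : ℝ) < r)) := by
      rw [← clockwise_rev hd, ← dual_rev, ← loopOf_rev hd]
      exact ⟨fun h' => h'.1 hd.rev, fun h' => ⟨fun _ => h', fun h'' => absurd hd.rev h''⟩⟩
    rw [e1, e2]
    tauto
  · have hd' : ¬ OnLoop ω d.rev := by rwa [onLoop_rev]
    have e1 : d ∈ canonicalOrientation n m r ω U ↔ Leftward m ω d :=
      ⟨fun h' => h'.2 hd, fun h' => ⟨fun h'' => absurd h'' hd, fun _ => h'⟩⟩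
    have e2 : d.rev ∈ canonicalOrientation n m r ω U ↔ Leftward m ω d.rev :=
      ⟨fun h' => h'.2 hd', fun h' => ⟨fun h'' => absurd h'' hd', fun _ => h'⟩⟩
    rw [e1, e2, h.leftward_rev hd, not_not]

theorem Admissible.canonicalOrientation_step (h : Admissible n m ω) (r : ℝ)
    (U : Loop → unitInterval) (d : DirEdge) :
    step ω d ∈ canonicalOrientation n m r ω U ↔ d ∈ canonicalOrientation n m r ω U := by
  by_cases hd : OnLoop ω d
  · have e1 : d ∈ canonicalOrientation n m r ω U ↔
        (Clockwise ω d ↔ (InB' n m d.dual.1 → (U (loopOf hd) : ℝ) < r)) :=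
      ⟨fun h' => h'.1 hd, fun h' => ⟨fun _ => h', fun h'' => absurd hd h''⟩⟩
    rw [e1, ← clockwise_step hd, ← h.inB'_step hd, ← loopOf_step hd]
    exact ⟨fun h' => h'.1 (onLoop_step.2 hd),
      fun h' => ⟨fun _ => h', fun h'' => absurd (onLoop_step.2 hd) h''⟩⟩
  · have hd' : ¬ OnLoop ω (step ω d) := by rwa [onLoop_step]
    have h1 : Leftward m ω (step ω d) ↔ Leftward m ω d := leftward_iterate m ω d 1
    exact ⟨fun h' => ⟨fun h'' => absurd h'' hd, fun _ => h1.1 (h'.2 hd')⟩,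
      fun h' => ⟨fun h'' => absurd h'' hd', fun _ => h1.2 (h'.2 hd)⟩⟩

theorem Admissible.isOrientedBy_iff (h : Admissible n m ω) (r : ℝ) (U : Loop → unitInterval)
    (o : Set DirEdge) : IsOrientedBy n m r ω U o ↔ o = canonicalOrientation n m r ω U := by
  constructor
  · intro ho
    -- One inclusion is enough, since both sets contain exactly one direction of every medial edge.
    have hsub : ∀ d ∈ o, d ∈ canonicalOrientation n m r ω U := by
      intro d hd
      refine ⟨fun hl => ?_, fun hl => (h.rightToLeft_iff hl).1 (ho.biinfinite d hd hl)⟩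
      by_cases hu : InB' n m d.dual.1
      · have hin := (h.inside_iff hl).2 hu
        by_cases hr : (U (loopOf hl) : ℝ) < r
        · exact iff_of_true (ho.inside_lt d hd hl hin _ rfl hr) fun _ => hr
        · exact iff_of_false (hl.counterClockwise_iff.1
            (ho.inside_ge d hd hl hin _ rfl (not_lt.1 hr))) fun h' => hr (h' hu)
      · exact iff_of_true (ho.outside d hd hl ((h.outside_iff hl).2 hu)) fun h' => absurd h' hu
    ext d
    refine ⟨hsub d, fun hd => ?_⟩
    rw [ho.one_direction]
    exact fun hr => (h.canonicalOrientation_rev r U d).1 hd (hsub _ hr)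
  · rintro rfl
    refine ⟨⟨h.canonicalOrientation_rev r U,
      fun d => (h.canonicalOrientation_step r U d).2⟩, ?_, ?_, ?_, ?_⟩
    · intro d hd hl hout
      exact (hd.1 hl).2 fun h' => absurd h' ((h.outside_iff hl).1 hout)
    · intro d hd hl
      exact (h.rightToLeft_iff hl).2 (hd.2 hl)
    · intro d hd hl hin l hle hr
      have : l = loopOf hl := Subtype.ext hle
      subst this
      exact (hd.1 hl).2 fun _ => hr
    · intro d hd hl hin l hle hr
      have : l = loopOf hl := Subtype.ext hle
      subst this
      rw [hl.counterClockwise_iff, hd.1 hl]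
      exact fun h' => absurd (h' ((h.inside_iff hl).1 hin)) (not_lt.2 hr)

end

/-! ### Spins on a simply connected lattice -/

theorem exists_primitive (h : ℤ → ℤˣ) : ∃ f : ℤ → ℤˣ, f 0 = 1 ∧ ∀ k, f (k + 1) = f k * h k := by
  refine ⟨fun k => (∏ i ∈ Finset.Ico 0 k, h i) * ∏ i ∈ Finset.Ico k 0, h i, by simp, fun k => ?_⟩
  rcases lt_or_ge k 0 with hk | hk
  · have h1 : Finset.Ico 0 k = ∅ := by simp [hk.le]
    have h2 : Finset.Ico 0 (k + 1) = ∅ := by simp; omega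
    have h3 : Finset.Ico k 0 = insert k (Finset.Ico (k + 1) 0) := by
      ext j; simp; omega
    simp only [h1, h2, h3]
    rw [Finset.prod_insert (by simp), mul_comm (h k)]
    simp [mul_assoc, Int.units_mul_self]
  · have h1 : Finset.Ico k 0 = ∅ := by simp [hk]
    have h2 : Finset.Ico (k + 1) 0 = ∅ := by simp; omega
    have h3 : Finset.Ico 0 (k + 1) = insert k (Finset.Ico 0 k) := by
      ext j; simp; omega
    simp only [h1, h2, h3]
    rw [Finset.prod_insert (by simp), mul_comm (h k)]
    simp

/-- Integration along the axis b = 0 and then along columns; flatness gives the relation between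
neighbouring columns. -/
theorem exists_potential (H V : ℤ → ℤ → ℤˣ)
    (hflat : ∀ a b, H a b * V (a + 1) b = V a b * H a (b + 1)) :
    ∃ g : ℤ → ℤ → ℤˣ, (∀ a b, g (a + 1) b = g a b * H a b) ∧
      ∀ a b, g a (b + 1) = g a b * V a b := by
  obtain ⟨f, -, hf⟩ := exists_primitive fun a => H a 0
  choose k hk0 hk using fun a => exists_primitive (V a)
  have hV : ∀ a b, f a * k a (b + 1) = f a * k a b * V a b := fun a b => by
    rw [hk, mul_assoc]
  refine ⟨fun a b => f a * k a b, fun a b => ?_, hV⟩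
  induction b using Int.induction_on with
  | zero => simp [hk0, hf]
  | succ b ih =>
    dsimp only at ih ⊢
    rw [hV, hV, ih, mul_assoc, hflat, ← mul_assoc]
  | pred b ih =>
    have h1 := hV (a + 1) (-b - 1)
    have h2 := hV a (-b - 1)
    have h3 := hflat a (-b - 1)
    rw [sub_add_cancel] at h1 h2 h3
    dsimp only at ih ⊢
    apply mul_right_cancel (b := V (a + 1) (-b - 1))
    rw [← h1, ih, h2, mul_assoc (f a * k a (-b - 1)) (H a _), h3, mul_assoc]

theorem const_of_const_neighbours {X : Type*} (g : ℤ → ℤ → X) (h1 : ∀ a b, g (a + 1) b = g a b)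
    (h2 : ∀ a b, g a (b + 1) = g a b) (a b : ℤ) : g a b = g 0 0 := by
  have h : ∀ b, g 0 b = g 0 0 := by
    intro b
    induction b using Int.induction_on with
    | zero => rfl
    | succ b ih => rw [h2, ih]
    | pred b ih => rw [← ih, ← h2, sub_add_cancel]
  rw [← h b]
  induction a using Int.induction_on with
  | zero => rfl
  | succ a ih => rw [h1, ih]
  | pred a ih => rw [← ih, ← h1, sub_add_cancel]

open Classical in
/-- The sign of a medial edge under an orientation: `1` if its primal vertex is on the left. -/
def edgeSign (o : Set DirEdge) (e : DirEdge) : ℤˣ := if (e ∈ o ↔ e.PL) then 1 else -1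

open Classical in
/-- The sign of the side with ends `v` and `w`. -/
def sideSign (o : Set DirEdge) (v w : Pt) : ℤˣ :=
  if h : ∃ e : DirEdge, e.left = v ∧ e.right = w then edgeSign o h.choose else 1

/-! ### The flat connection defined by an orientation. -/

section

variable {o : Set DirEdge}

theorem edgeSign_rev (ho : ∀ d, d ∈ o ↔ d.rev ∉ o) (e : DirEdge) :
    edgeSign o e.rev = edgeSign o e := by
  have h := ho e
  unfold edgeSign
  rw [PL_rev]
  congr 1
  apply propext
  tauto

theorem edgeSign_step {ω : Config} (hs : ∀ d, step ω d ∈ o ↔ d ∈ o) (e : DirEdge) :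
    edgeSign o (step ω e) = edgeSign o e := by
  unfold edgeSign
  rw [hs, step_PL]

theorem sideSign_left_right (e : DirEdge) : sideSign o e.left e.right = edgeSign o e := by
  have h : ∃ f : DirEdge, f.left = e.left ∧ f.right = e.right := ⟨e, rfl, rfl⟩
  rw [sideSign, dif_pos h, ext_sides h.choose_spec.1 h.choose_spec.2]

theorem sideSign_right_left (ho : ∀ d, d ∈ o ↔ d.rev ∉ o) (e : DirEdge) :
    sideSign o e.right e.left = edgeSign o e := by
  rw [← edgeSign_rev ho, ← sideSign_left_right, rev_left, rev_right]

theorem sideSign_comm (ho : ∀ d, d ∈ o ↔ d.rev ∉ o) (v w : Pt) :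
    sideSign o v w = sideSign o w v := by
  by_cases h : ∃ e : DirEdge, e.left = v ∧ e.right = w
  · obtain ⟨e, rfl, rfl⟩ := h
    rw [sideSign_left_right, sideSign_right_left ho]
  · have h' : ¬ ∃ e : DirEdge, e.left = w ∧ e.right = v := by
      rintro ⟨e, rfl, rfl⟩
      exact h ⟨e.rev, rev_left e, rev_right e⟩
    rw [sideSign, dif_neg h, sideSign, dif_neg h']

/-- The two sides joined by an arc have the same sign, because the orientation follows the arc. For
either pairing of the four sides, the products along the upper and the lower route agree. -/
theorem sideSign_flat {ω : Config} (ho : ∀ d, d ∈ o ↔ d.rev ∉ o)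
    (hs : ∀ d, step ω d ∈ o ↔ d ∈ o) {v : Pt} (hv : Even (v.1 + v.2)) :
    sideSign o v (v.1 + 1, v.2 + 1) * sideSign o (v.1 + 1, v.2 + 1) (v.1 + 2, v.2) =
      sideSign o v (v.1 + 1, v.2 - 1) * sideSign o (v.1 + 1, v.2 - 1) (v.1 + 2, v.2) := by
  obtain ⟨e, f, he1, he2, hf1, hf2, h⟩ := tile_arcs ω hv
  have hce := edgeSign_step hs e
  have hcf := edgeSign_step hs f
  rw [← sideSign_left_right, ← sideSign_left_right, he1, he2] at hce
  rw [← sideSign_left_right, ← sideSign_left_right, hf1, hf2] at hcf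
  rw [sideSign_comm ho v, sideSign_comm ho v]
  rcases h with ⟨h1, h2, h3, h4⟩ | ⟨h1, h2, h3, h4⟩ <;> rw [h1, h2] at hce <;>
    rw [h3, h4] at hcf
  · rw [hce, hcf, Int.units_mul_self, Int.units_mul_self]
  · rw [hce, ← hcf]

theorem exists_vertex_potential {ω : Config} (ho : ∀ d, d ∈ o ↔ d.rev ∉ o)
    (hs : ∀ d, step ω d ∈ o ↔ d ∈ o) :
    ∃ G : Pt → ℤˣ, ∀ e : DirEdge, G e.primal.1 = G e.dual.1 * edgeSign o e := by
  -- The substitution (a, b) to (a + b, a - b) turns the union of the two lattices, whose neighbours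
  -- are diagonal, into the standard square lattice.
  obtain ⟨g, hg1, hg2⟩ := exists_potential
    (fun a b => sideSign o (a + b, a - b) (a + b + 1, a - b + 1))
    (fun a b => sideSign o (a + b, a - b) (a + b + 1, a - b - 1)) (fun a b => by
      have := sideSign_flat (ω := ω) (v := (a + b, a - b)) ho hs
        (by rw [Int.even_iff]; dsimp only; omega)
      dsimp only at this ⊢
      rw [show a + 1 + b = a + b + 1 by ring, show a + 1 - b = a - b + 1 by ring,
        show a + (b + 1) = a + b + 1 by ring, show a - (b + 1) = a - b - 1 by ring,
        add_sub_cancel_right, sub_add_cancel, show a + b + 1 + 1 = a + b + 2 by ring]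
      exact this)
  have key1 : ∀ v : Pt, Even (v.1 + v.2) →
      g ((v.1 + 1 + (v.2 + 1)) / 2) ((v.1 + 1 - (v.2 + 1)) / 2) =
      g ((v.1 + v.2) / 2) ((v.1 - v.2) / 2) * sideSign o v (v.1 + 1, v.2 + 1) := by
    intro v hv
    rw [Int.even_iff] at hv
    have := hg1 ((v.1 + v.2) / 2) ((v.1 - v.2) / 2)
    rw [show (v.1 + v.2) / 2 + (v.1 - v.2) / 2 = v.1 by omega,
      show (v.1 + v.2) / 2 - (v.1 - v.2) / 2 = v.2 by omega] at this
    rw [← this, show (v.1 + 1 + (v.2 + 1)) / 2 = (v.1 + v.2) / 2 + 1 by omega,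
      show (v.1 + 1 - (v.2 + 1)) / 2 = (v.1 - v.2) / 2 by omega]
  have key2 : ∀ v : Pt, Even (v.1 + v.2) →
      g ((v.1 + 1 + (v.2 - 1)) / 2) ((v.1 + 1 - (v.2 - 1)) / 2) =
      g ((v.1 + v.2) / 2) ((v.1 - v.2) / 2) * sideSign o v (v.1 + 1, v.2 - 1) := by
    intro v hv
    rw [Int.even_iff] at hv
    have := hg2 ((v.1 + v.2) / 2) ((v.1 - v.2) / 2)
    rw [show (v.1 + v.2) / 2 + (v.1 - v.2) / 2 = v.1 by omega,
      show (v.1 + v.2) / 2 - (v.1 - v.2) / 2 = v.2 by omega] at this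
    rw [← this, show (v.1 + 1 + (v.2 - 1)) / 2 = (v.1 + v.2) / 2 by omega,
      show (v.1 + 1 - (v.2 - 1)) / 2 = (v.1 - v.2) / 2 + 1 by omega]
  set G : Pt → ℤˣ := fun v => g ((v.1 + v.2) / 2) ((v.1 - v.2) / 2) with hG
  have flip : ∀ x y z : ℤˣ, x = y * z → y = x * z := by
    rintro x y z rfl
    rw [mul_assoc, Int.units_mul_self, mul_one]
  have hLR : ∀ e : DirEdge, G e.left = G e.right * edgeSign o e := by
    intro e
    have h1 := right_fst_eq e
    have h2 := right_snd_eq e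
    have hl : Even (e.left.1 + e.left.2) := by
      have := e.primal_left_xor
      simp only [IsPrimal, IsDual, Int.even_iff, Int.odd_iff] at *
      omega
    have hr : Even (e.right.1 + e.right.2) := by
      have := e.primal_left_xor
      simp only [IsPrimal, IsDual, Int.even_iff, Int.odd_iff] at *
      omega
    rcases units_cases e.dx with hx | hx <;> rcases units_cases e.dy with hy | hy <;>
      rw [hx] at h2 <;> rw [hy] at h1
    · have := key2 _ hl
      rw [show (e.left.1 + 1, e.left.2 - 1) = e.right from Prod.ext h1.symm h2.symm,
        sideSign_left_right] at this
      apply flip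
      rw [← this, hG]
      dsimp only
      rw [h1, h2]
    · have := key1 _ hr
      rw [show (e.right.1 + 1, e.right.2 + 1) = e.left from
        Prod.ext (by dsimp only; omega) (by dsimp only; omega), sideSign_right_left ho] at this
      rw [hG]
      dsimp only
      rw [← this]
      congr 1 <;> omega
    · have := key1 _ hl
      rw [show (e.left.1 + 1, e.left.2 + 1) = e.right from
        Prod.ext (by dsimp only; omega) (by dsimp only; omega), sideSign_left_right] at this
      apply flip
      rw [hG]
      dsimp only
      rw [← this]
      congr 1 <;> omega
    · have := key2 _ hr
      rw [show (e.right.1 + 1, e.right.2 - 1) = e.left from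
        Prod.ext (by dsimp only; omega) (by dsimp only; omega), sideSign_right_left ho] at this
      rw [hG]
      dsimp only
      rw [← this]
      congr 1 <;> omega
  refine ⟨G, fun e => ?_⟩
  by_cases he : e.PL
  · rw [primal_of_PL he, dual_of_PL he, hLR]
  · rw [primal_of_not_PL he, dual_of_not_PL he]
    exact flip _ _ _ (hLR e)

end

/-! ### Orientations and spins -/

/-- The edge orientations represented by a pair of spin configurations. -/
def orientationOf (s : SpinPair) : Set DirEdge := {d | d.PL ↔ s.1 d.primal = s.2 d.dual}

theorem orientationOf_rev (s : SpinPair) (d : DirEdge) :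
    d ∈ orientationOf s ↔ d.rev ∉ orientationOf s := by
  unfold orientationOf
  simp only [Set.mem_ofPred_eq, PL_rev, primal_rev, dual_rev]
  tauto

theorem units_ne_iff {x y : ℤˣ} : x = -y ↔ x ≠ y := by
  rcases Int.units_eq_one_or x with rfl | rfl <;> rcases Int.units_eq_one_or y with rfl | rfl <;>
    decide

theorem isSpinRepresentation_iff_subset {o : Set DirEdge} {s : SpinPair} :
    IsSpinRepresentation o s ↔ o ⊆ orientationOf s := by
  constructor
  · intro h d hd
    have := h d hd d.primal d.dual
    by_cases hp : d.PL
    · exact iff_of_true hp (this.1 (primal_of_PL hp).symm (dual_of_PL hp).symm)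
    · exact iff_of_false hp (units_ne_iff.1
        (this.2 (primal_of_not_PL hp).symm (dual_of_not_PL hp).symm))
  · intro h d hd i u
    have hd := h hd
    constructor
    · intro h1 h2
      have hp : d.PL := by rw [PL, h1]; exact i.2
      have e1 : d.primal = i := Subtype.ext (by rw [primal_of_PL hp, h1])
      have e2 : d.dual = u := Subtype.ext (by rw [dual_of_PL hp, h2])
      rw [← e1, ← e2]
      exact hd.1 hp
    · intro h1 h2
      have hp : ¬ d.PL := by rw [PL, h2]; exact not_primal_of_dual u.2
      have e1 : d.primal = i := Subtype.ext (by rw [primal_of_not_PL hp, h1])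
      have e2 : d.dual = u := Subtype.ext (by rw [dual_of_not_PL hp, h2])
      rw [← e1, ← e2]
      exact units_ne_iff.2 (mt hd.2 hp)

theorem eq_of_subset_of_rev {o o' : Set DirEdge} (ho : ∀ d, d ∈ o ↔ d.rev ∉ o)
    (ho' : ∀ d, d ∈ o' ↔ d.rev ∉ o') (h : o ⊆ o') : o = o' := by
  refine h.antisymm fun d hd => ?_
  rw [ho]
  exact fun hr => (ho' d).1 hd (h hr)

theorem isSpinRepresentation_iff {o : Set DirEdge} (ho : ∀ d, d ∈ o ↔ d.rev ∉ o) {s : SpinPair} :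
    IsSpinRepresentation o s ↔ o = orientationOf s := by
  rw [isSpinRepresentation_iff_subset]
  exact ⟨eq_of_subset_of_rev ho (orientationOf_rev s), fun h => h.subset⟩

theorem exists_orientationOf_eq {o : Set DirEdge} {ω : Config} (ho : ∀ d, d ∈ o ↔ d.rev ∉ o)
    (hs : ∀ d, step ω d ∈ o ↔ d ∈ o) (i : Primal) :
    ∃ s : SpinPair, o = orientationOf s ∧ s.1 i = 1 := by
  obtain ⟨G, hG⟩ := exists_vertex_potential ho hs
  -- Multiplication by the constant G i normalises the potential to 1 at the prescribed vertex
  -- without changing the orientation.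
  refine ⟨(fun j => G j.1 * G i.1, fun u => G u.1 * G i.1), ?_, Int.units_mul_self _⟩
  refine eq_of_subset_of_rev ho (orientationOf_rev _) fun d hd => ?_
  have h1 := hG d
  unfold orientationOf
  simp only [Set.mem_ofPred_eq, mul_left_inj]
  rw [h1, edgeSign]
  by_cases hp : d.PL
  · rw [if_pos (iff_of_true hd hp)]
    simp [hp]
  · rw [if_neg (by tauto)]
    simp only [hp, false_iff]
    rw [mul_neg_one, ← ne_eq, ← units_ne_iff]

open Classical in
/-- The spin at a vertex of either lattice. -/
def vertexSpin (s : SpinPair) (v : Pt) : ℤˣ :=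
  if h : IsPrimal v then s.1 ⟨v, h⟩ else if h : IsDual v then s.2 ⟨v, h⟩ else 1

theorem vertexSpin_primal (s : SpinPair) (i : Primal) : vertexSpin s i.1 = s.1 i := by
  rw [vertexSpin, dif_pos i.2]

theorem vertexSpin_dual (s : SpinPair) (u : Dual) : vertexSpin s u.1 = s.2 u := by
  rw [vertexSpin, dif_neg (not_primal_of_dual u.2), dif_pos u.2]

/-- The product of the two spin pairs is constant across every side, hence constant on the union of
the two lattices, and it equals 1 at i. -/
theorem orientationOf_injective {s s' : SpinPair} {i : Primal}
    (h : orientationOf s = orientationOf s') (hi : s.1 i = s'.1 i) : s = s' := by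
  have h1 : ∀ d : DirEdge, (s.1 d.primal = s.2 d.dual ↔ s'.1 d.primal = s'.2 d.dual) := by
    intro d
    have h2 : d ∈ orientationOf s ↔ d ∈ orientationOf s' := by rw [h]
    unfold orientationOf at h2
    simp only [Set.mem_ofPred_eq] at h2
    tauto
  have hu : ∀ a b c d : ℤˣ, (a = b ↔ c = d) → a * c = b * d := by
    intro a b c d
    rcases Int.units_eq_one_or a with rfl | rfl <;> rcases Int.units_eq_one_or b with rfl | rfl <;>
      rcases Int.units_eq_one_or c with rfl | rfl <;>
      rcases Int.units_eq_one_or d with rfl | rfl <;> decide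
  set g : Pt → ℤˣ := fun v => vertexSpin s v * vertexSpin s' v with hg
  have h3 : ∀ d : DirEdge, g d.left = g d.right := by
    intro d
    have h4 := hu _ _ _ _ (h1 d)
    rw [← vertexSpin_primal, ← vertexSpin_primal, ← vertexSpin_dual, ← vertexSpin_dual] at h4
    by_cases hp : d.PL
    · rwa [primal_of_PL hp, dual_of_PL hp] at h4
    · rw [primal_of_not_PL hp, dual_of_not_PL hp] at h4
      exact h4.symm
  have h4 := const_of_const_neighbours (fun a b => g (a + b, a - b))
    (fun a b => by
      obtain ⟨d, hl, hr⟩ := exists_sides (v := (a + b, a - b)) (w := (a + 1 + b, a + 1 - b))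
        (by rw [Int.even_iff]; dsimp only; omega) (by dsimp only; ring_nf; simp)
        (by dsimp only; ring_nf; simp)
      have := h3 d
      rw [hl, hr] at this
      exact this.symm)
    (fun a b => by
      obtain ⟨d, hl, hr⟩ := exists_sides (v := (a + b, a - b)) (w := (a + (b + 1), a - (b + 1)))
        (by rw [Int.even_iff]; dsimp only; omega) (by dsimp only; ring_nf; simp)
        (by dsimp only; ring_nf; simp)
      have := h3 d
      rw [hl, hr] at this
      exact this.symm)
  have h5 : ∀ v : Pt, Even (v.1 + v.2) → g v = g (0, 0) := by
    intro v hv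
    rw [Int.even_iff] at hv
    have := h4 ((v.1 + v.2) / 2) ((v.1 - v.2) / 2)
    rw [show (v.1 + v.2) / 2 + (v.1 - v.2) / 2 = v.1 by omega,
      show (v.1 + v.2) / 2 - (v.1 - v.2) / 2 = v.2 by omega] at this
    simpa using this
  have h6 : g (0, 0) = 1 := by
    rw [← h5 i.1 (i.2.1.add i.2.2), hg]
    dsimp only
    rw [vertexSpin_primal, vertexSpin_primal, hi, Int.units_mul_self]
  have h7 : ∀ a b : ℤˣ, a * b = 1 → a = b := fun a b hab => by
    rw [← mul_one a, ← Int.units_mul_self b, ← mul_assoc, hab, one_mul]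
  refine Prod.ext (funext fun j => h7 _ _ ?_) (funext fun u => h7 _ _ ?_)
  · rw [← vertexSpin_primal s, ← vertexSpin_primal s', ← h6]
    exact h5 j.1 (j.2.1.add j.2.2)
  · rw [← vertexSpin_dual s, ← vertexSpin_dual s', ← h6]
    exact h5 u.1 (u.2.1.add_odd u.2.2)

/-- The spins are compatible with the percolation configuration: they are constant on open edges
and on dual edges of closed edges. -/
def Compatible (ω : Config) (s : SpinPair) : Prop :=
  ∀ t : Tile, (ω t = true → ∀ i j : Primal, IsCorner i.1 t.1 → IsCorner j.1 t.1 → s.1 i = s.1 j) ∧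
    (ω t = false → ∀ u v : Dual, IsCorner u.1 t.1 → IsCorner v.1 t.1 → s.2 u = s.2 v)

theorem Compatible.step {ω : Config} {s : SpinPair} (h : Compatible ω s) (d : DirEdge) :
    s.1 (step ω d).primal = s.1 d.primal ∧ s.2 (step ω d).dual = s.2 d.dual := by
  cases ht : ω d.tgt
  · rw [step_primal_of_closed ht]
    exact ⟨rfl, (h d.tgt).2 ht _ _ (isCorner_step_dual ω d) (isCorner_dual d)⟩
  · rw [step_dual_of_open ht]
    exact ⟨(h d.tgt).1 ht _ _ (isCorner_step_primal ω d) (isCorner_primal d), rfl⟩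

theorem Compatible.orientationOf_step {ω : Config} {s : SpinPair} (h : Compatible ω s)
    (d : DirEdge) : BKW.step ω d ∈ orientationOf s ↔ d ∈ orientationOf s := by
  unfold orientationOf
  simp only [Set.mem_ofPred_eq, step_PL, (h.step d).1, (h.step d).2]

/-- Across an arc one vertex is kept. If the orientation follows the arc, agreement with this vertex
is preserved, so the spins at the two ends of the other pair coincide. -/
theorem compatible_of_step {ω : Config} {s : SpinPair}
    (h : ∀ d, step ω d ∈ orientationOf s ↔ d ∈ orientationOf s) : Compatible ω s := by
  have hu : ∀ a b c : ℤˣ, (a = b ↔ a = c) → b = c := by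
    intro a b c
    rcases Int.units_eq_one_or a with rfl | rfl <;> rcases Int.units_eq_one_or b with rfl | rfl <;>
      rcases Int.units_eq_one_or c with rfl | rfl <;> decide
  have h' : ∀ d : DirEdge, (s.1 (step ω d).primal = s.2 (step ω d).dual ↔
      s.1 d.primal = s.2 d.dual) := by
    intro d
    have := h d
    unfold orientationOf at this
    simp only [Set.mem_ofPred_eq, step_PL] at this
    tauto
  intro t
  obtain ⟨i, j, hi, hj, h1, h2, hij, hall⟩ := exists_primal_corners t
  obtain ⟨u, v, hu', hv', h3, h4, huv, hall'⟩ := exists_dual_corners t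
  obtain ⟨e, he, hei, heu⟩ := exists_into t i u hi hu'
  constructor
  · intro ht
    have h5 := h' e
    have h6 := step_primal_of_open (ω := ω) (d := e) (by rw [he, ht])
    rw [he, hei] at h6
    have h7 : (step ω e).primal = j := by
      apply Subtype.ext
      rw [h6]
      exact Prod.ext (by dsimp only; omega) (by dsimp only; omega)
    rw [step_dual_of_open (by rw [he, ht]), h7, hei, heu] at h5
    have h8 : s.1 i = s.1 j := hu (s.2 u) _ _ (by rw [eq_comm (a := s.2 u), eq_comm (a := s.2 u)]; exact h5.symm)
    intro k l hk hl
    rcases hall k hk with rfl | rfl <;> rcases hall l hl with rfl | rfl <;> simp [h8]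
  · intro ht
    have h5 := h' e
    have h6 := step_dual_of_closed (ω := ω) (d := e) (by rw [he, ht])
    rw [he, heu] at h6
    have h7 : (step ω e).dual = v := by
      apply Subtype.ext
      rw [h6]
      exact Prod.ext (by dsimp only; omega) (by dsimp only; omega)
    rw [step_primal_of_closed (by rw [he, ht]), h7, hei, heu] at h5
    have h8 : s.2 u = s.2 v := hu (s.1 i) _ _ h5.symm
    intro k l hk hl
    rcases hall' k hk with rfl | rfl <;> rcases hall' l hl with rfl | rfl <;> simp [h8]

theorem Compatible.reachable {ω : Config} {s : SpinPair} (h : Compatible ω s) {i j : Primal}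
    (hr : (openGraph ω).Reachable i j) : s.1 i = s.1 j := by
  rw [SimpleGraph.reachable_iff_reflTransGen] at hr
  induction hr with
  | refl => rfl
  | tail _ hjk ih =>
    obtain ⟨-, t, ht, hj, hk⟩ := hjk
    exact ih.trans ((h t).1 ht _ _ hj hk)

theorem Compatible.iceRule {ω : Config} {s : SpinPair} (h : Compatible ω s) : IceRule s := by
  intro t i j u v hi hj hu hv
  cases ht : ω t
  · rw [(h t).2 ht u v hu hv]; ring
  · rw [(h t).1 ht i j hi hj]; ring

/-! ### Boundary conditions and the orientation outside the domain. -/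

section

variable {n m : ℕ} {ω : Config}

theorem dobrushinSign_of_nonneg {v : Pt} (h : 0 ≤ v.2) : dobrushinSign v = 1 := if_pos h

theorem dobrushinSign_of_neg {v : Pt} (h : v.2 < 0) : dobrushinSign v = -1 := if_neg (not_le.2 h)

theorem dobrushinSign_primal_eq_dual {d : DirEdge} (h : d.dual.1.2 ≠ -1) :
    dobrushinSign d.primal.1 = dobrushinSign d.dual.1 := by
  have h1 := d.corner_cases
  have h2 := d.primal.2
  have h3 := d.dual.2
  simp only [IsPrimal, IsDual, Int.even_iff, Int.odd_iff] at h2 h3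
  rcases lt_or_ge d.dual.1.2 0 with h4 | h4
  · rw [dobrushinSign_of_neg h4, dobrushinSign_of_neg (by omega)]
  · rw [dobrushinSign_of_nonneg h4, dobrushinSign_of_nonneg (by omega)]

theorem Admissible.surrounds_dual_of_outside (h : Admissible n m ω) {d : DirEdge}
    (hd : OnLoop ω d) (hu : ¬ InB' n m d.dual.1) : Surrounds ω d d.dual.1 := by
  have h2 := h.not_surrounds_primal hd (primal_not_mem_boxB hu)
  have h3 := hd.surrounds_xor
  tauto

theorem exists_edge_of_dual (u : Dual) (c : ℤ) (hc : u.1.2 = c + 1 ∨ u.1.2 = c - 1) :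
    ∃ d : DirEdge, d.dual = u ∧ d.primal.1.2 = c := by
  have hp : IsPrimal (u.1.1 + 1, c) := by
    have := u.2
    simp only [IsPrimal, IsDual, Int.even_iff, Int.odd_iff] at *
    omega
  obtain ⟨e, hep, heu, -⟩ := exists_edge ⟨_, hp⟩ u (by simp)
    (by rcases hc with hc | hc <;> simp [hc]) True
  exact ⟨e, heu, by rw [hep]⟩

theorem exists_edge_of_dual_mem (s : SpinPair) (u : Dual) (c : ℤ)
    (hc : u.1.2 = c + 1 ∨ u.1.2 = c - 1) :
    ∃ d ∈ orientationOf s, d.dual = u ∧ d.primal.1.2 = c := by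
  obtain ⟨d, hd, hd'⟩ := exists_edge_of_dual u c hc
  by_cases h : d ∈ orientationOf s
  · exact ⟨d, h, hd, hd'⟩
  · refine ⟨d.rev, ?_, by rwa [dual_rev], by rwa [primal_rev]⟩
    have := orientationOf_rev s d
    tauto

/-- The spin at (n + 1, 0) fixes the upper cluster. Crossing the line y = -1/2, where the paths run
leftwards, determines the dual spins on the line and then the lower cluster; the clockwise small
loops give every other outside dual vertex the spin of its primal neighbours. -/
theorem Admissible.dobrushinBC (h : Admissible n m ω) {s : SpinPair} (hc : Compatible ω s)
    (hloop : ∀ d ∈ orientationOf s, OnLoop ω d → ¬ InB' n m d.dual.1 → Clockwise ω d)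
    (hpath : ∀ d ∈ orientationOf s, ¬ OnLoop ω d → Leftward m ω d)
    (h1 : s.1 (rightVertex n) = 1) : DobrushinBC n m s := by
  have hright : rightVertex n ∉ boxB n m := by
    rw [mem_boxB_iff]; dsimp only [rightVertex]; omega
  have hupper : ∀ i : Primal, i ∉ boxB n m → 0 ≤ i.1.2 → s.1 i = 1 := fun i hi hi0 => by
    rw [hc.reachable (h.reachable_upper hi hright hi0 le_rfl), h1]
  have hline : ∀ d ∈ orientationOf s, ¬ InB' n m d.dual.1 → d.dual.1.2 = -1 →
      Leftward m ω d := fun d hd hu hu' =>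
    hpath d hd fun hl => h.dual_level_of_onLoop hl hu hu'
  have hdual : ∀ u : Dual, ¬ InB' n m u.1 → u.1.2 = -1 → s.2 u = -1 := by
    intro u hu hu'
    obtain ⟨d, hd, rfl, hd0⟩ := exists_edge_of_dual_mem s u 0 (by omega)
    have h2 := hline d hd hu hu'
    have h3 := h.reachable_of_level hu hu'
    have h4 : ¬ d.PL := by
      unfold Leftward at h2
      rcases h3 with h3 | h3
      · tauto
      · omega
    have h5 := hupper d.primal (primal_not_mem_boxB hu) (by omega)
    have h6 : ¬ s.1 d.primal = s.2 d.dual := fun h' => h4 (hd.2 h')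
    rw [h5] at h6
    exact units_ne_iff.2 (Ne.symm h6)
  -- Spins are constant on the lower cluster, so one vertex of it suffices; it is found next to a
  -- dual vertex on the line outside `B'`.
  have hbase : ∃ i : Primal, i ∉ boxB n m ∧ i.1.2 < 0 ∧ s.1 i = -1 := by
    have hu : ¬ InB' n m (dualOnLine (n + 1)).1 := by
      rw [inB'_iff]; dsimp only [dualOnLine]; omega
    obtain ⟨d, hd, hdu, hd0⟩ := exists_edge_of_dual_mem s (dualOnLine (n + 1)) (-2)
      (Or.inl rfl)
    rw [← hdu] at hu
    have hu' : d.dual.1.2 = -1 := by rw [hdu]; rfl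
    have h2 := hline d hd hu hu'
    have h3 := h.reachable_of_level hu hu'
    have h4 : d.PL := by
      unfold Leftward at h2
      rcases h3 with h3 | h3
      · omega
      · tauto
    exact ⟨d.primal, primal_not_mem_boxB hu, by omega, (hd.1 h4).trans (hdual _ hu hu')⟩
  obtain ⟨j, hj, hj0, hj1⟩ := hbase
  have hprimal : ∀ i : Primal, i ∉ boxB n m → s.1 i = dobrushinSign i.1 := by
    intro i hi
    rcases lt_or_ge i.1.2 0 with h0 | h0
    · rw [dobrushinSign_of_neg h0, hc.reachable (h.reachable_lower hi hj h0 hj0), hj1]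
    · rw [dobrushinSign_of_nonneg h0, hupper i hi h0]
  refine ⟨hprimal, fun u hu => ?_⟩
  by_cases hu' : u.1.2 = -1
  · rw [hdual u hu hu', dobrushinSign_of_neg (by omega)]
  · obtain ⟨d, hd, rfl, -⟩ := exists_edge_of_dual_mem s u (u.1.2 - 1) (by omega)
    have hl := h.onLoop_of_outside hu hu'
    have hp := ((clockwise_iff hl).1 (hloop d hd hl hu)).2 (h.surrounds_dual_of_outside hl hu)
    rw [← hd.1 hp, hprimal _ (primal_not_mem_boxB hu), dobrushinSign_primal_eq_dual hu']

/-- The converse reading: the boundary spins force the small loops to be clockwise, and far out on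
the line they force the paths leftwards. -/
theorem Admissible.orientationOf_outside (h : Admissible n m ω) {s : SpinPair}
    (hc : Compatible ω s) (hbc : DobrushinBC n m s) {d : DirEdge} (hd : d ∈ orientationOf s) :
    (OnLoop ω d → ¬ InB' n m d.dual.1 → Clockwise ω d) ∧ (¬ OnLoop ω d → Leftward m ω d) := by
  constructor
  · intro hl hu
    have h1 := h.dual_level_of_onLoop hl hu
    have h2 : s.1 d.primal = s.2 d.dual := by
      rw [hbc.1 _ (primal_not_mem_boxB hu), hbc.2 _ hu, dobrushinSign_primal_eq_dual h1]
    exact (clockwise_iff hl).2 (iff_of_true (hd.2 h2) (h.surrounds_dual_of_outside hl hu))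
  · intro hl
    obtain ⟨K, hK⟩ := h.eventually_outside hl
    obtain ⟨hu, hu'⟩ := hK K le_rfl
    rw [← leftward_iterate m ω d K]
    have hdK : (BKW.step ω)^[K] d ∈ orientationOf s := by
      clear hK hu hu'
      induction K with
      | zero => exact hd
      | succ K ih => rw [Function.iterate_succ_apply', hc.orientationOf_step]; exact ih
    set e := (BKW.step ω)^[K] d
    have h1 : s.2 e.dual = -1 := by rw [hbc.2 _ hu, dobrushinSign_of_neg (by omega)]
    have h2 := hbc.1 _ (primal_not_mem_boxB hu)
    unfold orientationOf at hdK
    rw [Set.mem_ofPred_eq, h1, h2] at hdK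
    unfold Leftward
    rcases h.reachable_of_level hu hu' with h3 | h3
    · rw [dobrushinSign_of_nonneg (by omega)] at hdK
      exact Or.inl ⟨h3.2.1, fun hp => absurd (hdK.1 hp) (by decide)⟩
    · rw [dobrushinSign_of_neg (by omega)] at hdK
      exact Or.inr ⟨h3.2.1, hdK.2 rfl⟩

theorem Admissible.isInducedSpin_iff_eq (h : Admissible n m ω) (r : ℝ) (U : Loop → unitInterval)
    (s : SpinPair) : IsInducedSpin n m r ω U s ↔
      canonicalOrientation n m r ω U = orientationOf s ∧ s.1 (rightVertex n) = 1 := by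
  unfold IsInducedSpin
  simp only [h.isOrientedBy_iff]
  rw [exists_eq_left, isSpinRepresentation_iff (h.canonicalOrientation_rev r U)]

theorem Admissible.existsUnique_isInducedSpin (h : Admissible n m ω) (r : ℝ)
    (U : Loop → unitInterval) : ∃! s, IsInducedSpin n m r ω U s := by
  simp only [h.isInducedSpin_iff_eq]
  obtain ⟨s, hs, hs1⟩ := exists_orientationOf_eq (h.canonicalOrientation_rev r U)
    (h.canonicalOrientation_step r U) (rightVertex n)
  refine ⟨s, ⟨hs, hs1⟩, fun s' hs' => ?_⟩
  exact orientationOf_injective (hs'.1.symm.trans hs) (hs'.2.trans hs1.symm)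

/-- The spins induced by `ω` and `U`, in terms of the uniform variables of the loops inside. -/
theorem Admissible.isInducedSpin_iff (h : Admissible n m ω) (r : ℝ) (U : Loop → unitInterval)
    (s : SpinPair) : IsInducedSpin n m r ω U s ↔ DobrushinBC n m s ∧ Compatible ω s ∧
      ∀ d ∈ orientationOf s, ∀ hd : OnLoop ω d, InB' n m d.dual.1 →
        ((U (loopOf hd) : ℝ) < r ↔ Clockwise ω d) := by
  rw [h.isInducedSpin_iff_eq]
  constructor
  · rintro ⟨he, h1⟩
    have hc : Compatible ω s := compatible_of_step fun d => by
      rw [← he]; exact h.canonicalOrientation_step r U d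
    refine ⟨h.dobrushinBC hc (fun d hd hl hu => ?_) (fun d hd hl => ?_) h1, hc,
      fun d hd hl hu => ?_⟩
    · rw [← he] at hd
      exact (hd.1 hl).2 fun h' => absurd h' hu
    · rw [← he] at hd
      exact hd.2 hl
    · rw [← he] at hd
      rw [hd.1 hl]
      exact ⟨fun h' _ => h', fun h' => h' hu⟩
  · rintro ⟨hbc, hc, hU⟩
    refine ⟨(eq_of_subset_of_rev (orientationOf_rev s) (h.canonicalOrientation_rev r U) ?_).symm,
      ?_⟩
    · intro d hd
      have h1 := h.orientationOf_outside hc hbc hd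
      refine ⟨fun hl => ?_, h1.2⟩
      by_cases hu : InB' n m d.dual.1
      · rw [← hU d hd hl hu]
        exact ⟨fun h' _ => h', fun h' => h' hu⟩
      · exact iff_of_true (h1.1 hl hu) fun h' => absurd h' hu
    · rw [hbc.1 _ (show rightVertex n ∉ boxB n m by
        rw [mem_boxB_iff]; dsimp only [rightVertex]; omega)]
      exact dobrushinSign_of_nonneg le_rfl

end

/-! ### Loops inside the domain and the sum of their turns -/

theorem finite_insideEdges (n m : ℕ) : {d : DirEdge | InB' n m d.dual.1}.Finite :=
  finite_dual_mem (finite_inB' n m)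

/-- The directed medial edges whose dual vertex belongs to `B'`. -/
def insideEdges (n m : ℕ) : Finset DirEdge := (finite_insideEdges n m).toFinset

theorem mem_insideEdges {n m : ℕ} {d : DirEdge} :
    d ∈ insideEdges n m ↔ InB' n m d.dual.1 := by
  simp [insideEdges]

theorem rev_mem_insideEdges {n m : ℕ} {d : DirEdge} :
    d.rev ∈ insideEdges n m ↔ d ∈ insideEdges n m := by
  rw [mem_insideEdges, mem_insideEdges, dual_rev]

theorem finite_insideLoops (n m : ℕ) (ω : Config) :
    {l : Loop | ∃ d, ∃ hd : OnLoop ω d, InB' n m d.dual.1 ∧ l = loopOf hd}.Finite := by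
  refine Set.Finite.of_finite_image (f := fun l : Loop => l.1) ?_ Subtype.val_injective.injOn
  refine ((finite_insideEdges n m).image (loopThrough ω)).subset ?_
  rintro _ ⟨_, ⟨d, hd, hu, rfl⟩, rfl⟩
  exact ⟨d, hu, rfl⟩

/-- The loops of `ω` through medial edges whose dual vertex belongs to `B'`. -/
def insideLoops (n m : ℕ) (ω : Config) : Finset Loop := (finite_insideLoops n m ω).toFinset

theorem mem_insideLoops {n m : ℕ} {ω : Config} {l : Loop} :
    l ∈ insideLoops n m ω ↔ ∃ d, ∃ hd : OnLoop ω d, InB' n m d.dual.1 ∧ l = loopOf hd := by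
  simp [insideLoops]

/-- The loop `l` of `ω` is clockwise under the orientation `o`. -/
def ClockwiseLoop (ω : Config) (o : Set DirEdge) (l : Loop) : Prop :=
  ∃ d ∈ o, OnLoop ω d ∧ loopThrough ω d = l.1 ∧ Clockwise ω d

theorem loopThrough_iterate {ω : Config} {d : DirEdge} (h : OnLoop ω d) (k : ℕ) :
    loopThrough ω ((step ω)^[k] d) = loopThrough ω d := by
  induction k with
  | zero => rfl
  | succ k ih => rw [Function.iterate_succ_apply', loopThrough_step ((onLoop_iterate k).2 h), ih]

/-! ### Turning sums grouped by loops. -/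

section

variable {n m : ℕ} {ω : Config} {o : Set DirEdge}

theorem iterate_mem_iff (hs : ∀ d, step ω d ∈ o ↔ d ∈ o) (d : DirEdge) (k : ℕ) :
    (step ω)^[k] d ∈ o ↔ d ∈ o := by
  induction k with
  | zero => rfl
  | succ k ih => rw [Function.iterate_succ_apply', hs, ih]

theorem exists_iterate_of_mem (ho : ∀ d, d ∈ o ↔ d.rev ∉ o) (hs : ∀ d, step ω d ∈ o ↔ d ∈ o)
    {d e : DirEdge} (hd : d ∈ o) (he : e ∈ o) (h : loopThrough ω d = loopThrough ω e) :
    ∃ k, (step ω)^[k] d = e := by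
  rcases exists_iterate_of_loopThrough_eq h with h | ⟨k, hk⟩
  · exact h
  · have := (iterate_mem_iff hs d k).2 hd
    rw [hk] at this
    exact absurd this ((ho e).1 he)

theorem clockwiseLoop_loopOf (ho : ∀ d, d ∈ o ↔ d.rev ∉ o) (hs : ∀ d, step ω d ∈ o ↔ d ∈ o)
    {d : DirEdge} (hd : OnLoop ω d) (hdo : d ∈ o) :
    ClockwiseLoop ω o (loopOf hd) ↔ Clockwise ω d := by
  constructor
  · rintro ⟨e, heo, he, hl, hc⟩
    obtain ⟨k, rfl⟩ := exists_iterate_of_mem ho hs hdo heo hl.symm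
    exact (clockwise_iterate hd k).1 hc
  · exact fun h => ⟨d, hdo, hd, rfl, h⟩

theorem Admissible.inB'_iterate (h : Admissible n m ω) {d : DirEdge} (hd : OnLoop ω d) (k : ℕ) :
    InB' n m ((step ω)^[k] d).dual.1 ↔ InB' n m d.dual.1 := by
  induction k with
  | zero => rfl
  | succ k ih => rw [Function.iterate_succ_apply', h.inB'_step ((onLoop_iterate k).2 hd), ih]

theorem exists_mem_of_mem_insideLoops (ho : ∀ d, d ∈ o ↔ d.rev ∉ o) {l : Loop}
    (hl : l ∈ insideLoops n m ω) :
    ∃ d ∈ o, ∃ hd : OnLoop ω d, InB' n m d.dual.1 ∧ l = loopOf hd := by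
  obtain ⟨d, hd, hu, rfl⟩ := mem_insideLoops.1 hl
  by_cases hdo : d ∈ o
  · exact ⟨d, hdo, hd, hu, rfl⟩
  · exact ⟨d.rev, by_contra fun h => hdo ((ho d).2 h), hd.rev, by rwa [dual_rev],
      (loopOf_rev hd).symm⟩

-- Medial edges directed along o are grouped by their loop. Each group is the orbit of one edge,
-- which lies wholly inside, and its turning is given by `sum_turn_orbit`.
open Classical in
theorem Admissible.sum_turn_loops (h : Admissible n m ω) (ho : ∀ d, d ∈ o ↔ d.rev ∉ o)
    (hs : ∀ d, step ω d ∈ o ↔ d ∈ o) :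
    ∑ d ∈ (insideEdges n m).filter (fun d => OnLoop ω d ∧ d ∈ o), turn ω d =
      ∑ l ∈ insideLoops n m ω, if ClockwiseLoop ω o l then -4 else 4 := by
  set F := (insideEdges n m).filter (fun d => OnLoop ω d ∧ d ∈ o) with hF
  have hmem : ∀ d : F, OnLoop ω d.1 := fun d => ((Finset.mem_filter.1 d.2).2).1
  have himage : insideLoops n m ω = Finset.univ.image (fun d : F => loopOf (hmem d)) := by
    ext l
    rw [Finset.mem_image]
    constructor
    · intro hl
      obtain ⟨d, hdo, hd, hu, rfl⟩ := exists_mem_of_mem_insideLoops ho hl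
      exact ⟨⟨d, Finset.mem_filter.2 ⟨mem_insideEdges.2 hu, hd, hdo⟩⟩, Finset.mem_univ _, rfl⟩
    · rintro ⟨d, -, rfl⟩
      exact mem_insideLoops.2 ⟨d.1, hmem d, mem_insideEdges.1 (Finset.mem_filter.1 d.2).1, rfl⟩
  rw [himage, Finset.sum_image' (fun d : F => turn ω d.1), Finset.sum_coe_sort F (turn ω)]
  rintro ⟨d, hdF⟩ -
  obtain ⟨hdM, hd, hdo⟩ := Finset.mem_filter.1 hdF
  rw [if_congr (clockwiseLoop_loopOf ho hs hd hdo) rfl rfl, ← sum_turn_orbit hd]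
  symm
  refine Finset.sum_bij (fun e _ => e.1) ?_ (fun a _ b _ hab => Subtype.ext hab) ?_
    fun _ _ => rfl
  · rintro ⟨e, heF⟩ he
    have he' := (Finset.mem_filter.1 he).2
    have heo := (Finset.mem_filter.1 heF).2.2
    exact (mem_orbit hd).2 (exists_iterate_of_mem ho hs hdo heo (congrArg Subtype.val he').symm)
  · intro e he
    obtain ⟨k, rfl⟩ := (mem_orbit hd).1 he
    refine ⟨⟨(step ω)^[k] d, Finset.mem_filter.2 ⟨?_, (onLoop_iterate k).2 hd,
      (iterate_mem_iff hs d k).2 hdo⟩⟩, Finset.mem_filter.2 ⟨Finset.mem_univ _, ?_⟩, rfl⟩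
    · rw [mem_insideEdges, h.inB'_iterate hd]
      exact mem_insideEdges.1 hdM
    · exact Subtype.ext (loopThrough_iterate hd k)

theorem pred_mem_iff (hs : ∀ d, step ω d ∈ o ↔ d ∈ o) (d : DirEdge) : pred ω d ∈ o ↔ d ∈ o := by
  rw [← hs, step_pred]

theorem onLoop_pred (d : DirEdge) : OnLoop ω (pred ω d) ↔ OnLoop ω d := by
  rw [← onLoop_step, step_pred]

open Classical in
theorem Admissible.sum_turn_pred_loops (h : Admissible n m ω) (hs : ∀ d, step ω d ∈ o ↔ d ∈ o) :
    ∑ d ∈ (insideEdges n m).filter (fun d => OnLoop ω d ∧ d ∈ o), turn ω (pred ω d) =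
      ∑ d ∈ (insideEdges n m).filter (fun d => OnLoop ω d ∧ d ∈ o), turn ω d := by
  refine Finset.sum_bij' (fun d _ => pred ω d) (fun d _ => step ω d) ?_ ?_
    (fun d _ => step_pred ω d) (fun d _ => pred_step ω d) (fun _ _ => rfl)
  · intro d hd
    obtain ⟨hdM, hd, hdo⟩ := Finset.mem_filter.1 hd
    have hp := (onLoop_pred d).2 hd
    refine Finset.mem_filter.2 ⟨?_, hp, (pred_mem_iff hs d).2 hdo⟩
    rw [mem_insideEdges, ← h.inB'_step hp, step_pred]
    exact mem_insideEdges.1 hdM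
  · intro d hd
    obtain ⟨hdM, hd, hdo⟩ := Finset.mem_filter.1 hd
    refine Finset.mem_filter.2 ⟨?_, onLoop_step.2 hd, (hs d).2 hdo⟩
    rw [mem_insideEdges, h.inB'_step hd]
    exact mem_insideEdges.1 hdM

/-! ### The bi-infinite paths -/

/-- An open tile would keep the dual vertex, so a path leaves `B'` only through a closed tile. This
tile is not an edge of the graph, hence lies at height -1, just right or left of the box. -/
theorem Admissible.exit (h : Admissible n m ω) {d : DirEdge} (hd : InB' n m d.dual.1)
    (hd' : ¬ InB' n m (step ω d).dual.1) :
    (step ω d).dual.1.2 = -1 ∧ (step ω d).primal.1.1 = d.tgt.1.1 ∧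
      (step ω d).primal = d.primal ∧ (step ω d).dual.1.1 = d.tgt.1.1 + (step ω d).dx ∧
      (d.tgt.1.1 = 2 * n + 2 ∨ d.tgt.1.1 = -(2 * n) - 2) ∧
      (d.tgt.1.1 = 2 * n + 2 ↔ ((step ω d).dx : ℤ) = 1) := by
  have ht := tile_not_mem_boxE hd' (isCorner_step_dual ω d)
  have hc : ω d.tgt = false := by
    cases h1 : ω d.tgt
    · rfl
    · rw [step_dual_of_open h1] at hd'
      exact absurd hd hd'
  have h2 : d.tgt.1.2 = -1 := by
    by_contra h2
    rw [h.open_of ht h2] at hc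
    cases hc
  have h3 := dual_tile_level (isCorner_step_dual ω d) h2
  have h4 := step_primal_of_closed hc
  have h5 := step_dual_of_closed hc
  have h6 := d.corner_cases
  have h7 := two_tgt_fst (step ω d)
  have h8 := tgt_fst (step ω d)
  rw [step_src] at h8
  have h9 : (step ω d).left.1 + (step ω d).right.1 =
      (step ω d).primal.1.1 + (step ω d).dual.1.1 := by
    by_cases hp : (step ω d).PL
    · rw [primal_of_PL hp, dual_of_PL hp]
    · rw [primal_of_not_PL hp, dual_of_not_PL hp, add_comm]
  have h10 := d.primal.2
  simp only [IsPrimal, Int.even_iff] at h10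
  have h12 : (step ω d).dual.1.1 = 2 * d.tgt.1.1 - d.dual.1.1 := by rw [h5]
  have h13 : (step ω d).dual.1.2 = 2 * d.tgt.1.2 - d.dual.1.2 := by rw [h5]
  rw [inB'_iff] at hd hd'
  have h14 := units_cases (step ω d).dx
  rw [h4] at h9 ⊢
  refine ⟨h3, by omega, rfl, by omega, by omega, by omega⟩

theorem Admissible.not_inB'_eventually (h : Admissible n m ω) {d : DirEdge} (hd : ¬ OnLoop ω d) :
    ∃ k, ¬ InB' n m ((step ω)^[k] d).dual.1 := by
  obtain ⟨K, hK⟩ := h.eventually_outside hd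
  exact ⟨K, (hK K le_rfl).1⟩

/-- A medial edge of a bi-infinite path where the path enters the domain from the right. -/
structure IsEntrance (n : ℕ) (ω : Config) (c : DirEdge) : Prop where
  dual_fst : c.dual.1.1 = 2 * n + 3
  dual_snd : c.dual.1.2 = -1
  primal_fst : c.primal.1.1 = 2 * n + 2
  dx_eq : (c.dx : ℤ) = -1

theorem IsEntrance.unique {c c' : DirEdge} (h : IsEntrance n ω c) (h' : IsEntrance n ω c')
    (hp : c.PL ↔ c'.PL) : c = c' := by
  have hd : c.dual = c'.dual := Subtype.ext (Prod.ext (h.dual_fst.trans h'.dual_fst.symm)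
    (h.dual_snd.trans h'.dual_snd.symm))
  refine ext_primal_dual (Subtype.ext (Prod.ext (h.primal_fst.trans h'.primal_fst.symm) ?_)) hd hp
  have e1 := h.dx_eq
  have e2 := h'.dx_eq
  have e3 := h.dual_snd
  have e4 := h'.dual_snd
  by_cases hc : c.PL
  · have h1 := (coords_of_PL hc).2.1
    have h2 := (coords_of_PL (hp.1 hc)).2.1
    omega
  · have h1 := (coords_of_not_PL hc).2.1
    have h2 := (coords_of_not_PL (fun h => hc (hp.2 h))).2.1
    omega

/-- The reversed path is followed up to its first exit. As it runs to the right outside, this exit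
is on the right-hand side. -/
theorem Admissible.exists_entrance (h : Admissible n m ω) {d : DirEdge} (hd : InB' n m d.dual.1)
    (hl : ¬ OnLoop ω d) (hL : Leftward m ω d) :
    ∃ c K, IsEntrance n ω c ∧ (step ω)^[K + 1] c = d ∧
      ∀ k ≤ K, InB' n m ((step ω)^[k + 1] c).dual.1 := by
  classical
  have hl' : ¬ OnLoop ω d.rev := by rwa [onLoop_rev]
  have hex := h.not_inB'_eventually hl'
  obtain ⟨K, hK⟩ : ∃ K, Nat.find hex = K + 1 := by
    refine Nat.exists_eq_succ_of_ne_zero fun h0 => ?_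
    have := Nat.find_spec hex
    rw [h0, Function.iterate_zero, id, dual_rev] at this
    exact this hd
  have h1 := Nat.find_spec hex
  have h2 : ∀ k ≤ K, InB' n m ((step ω)^[k] d.rev).dual.1 := fun k hk =>
    not_not.1 (Nat.find_min hex (by omega))
  rw [hK] at h1
  have h3 : ∀ k ≤ K + 1, (step ω)^[k] ((step ω)^[K + 1] d.rev).rev =
      ((step ω)^[K + 1 - k] d.rev).rev := by
    intro k hk
    have : (step ω)^[K + 1] d.rev = (step ω)^[k] ((step ω)^[K + 1 - k] d.rev) := by
      rw [← Function.iterate_add_apply]; congr 1; omega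
    rw [this, iterate_step_rev]
  refine ⟨((step ω)^[K + 1] d.rev).rev, K, ?_, ?_, ?_⟩
  · rw [Function.iterate_succ_apply'] at h1
    obtain ⟨e1, e2, e3, e4, e5, e6⟩ := h.exit (h2 K le_rfl) h1
    have h4 := h.leftward_direction h1 e1
    rw [← Function.iterate_succ_apply' (step ω), leftward_iterate, h.leftward_rev hl,
      Function.iterate_succ_apply'] at h4
    have h5 := units_cases (step ω ((step ω)^[K] d.rev)).dx
    have h6 : ((step ω ((step ω)^[K] d.rev)).dx : ℤ) = 1 := by tauto
    have h7 := e6.2 h6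
    rw [Function.iterate_succ_apply']
    refine ⟨?_, ?_, ?_, ?_⟩
    · rw [dual_rev, e4, h7, h6]; ring
    · rw [dual_rev, e1]
    · rw [primal_rev, e2, h7]
    · change ((-(step ω ((step ω)^[K] d.rev)).dx : ℤˣ) : ℤ) = -1
      rw [Units.val_neg, h6]
  · rw [h3 _ le_rfl, Nat.sub_self, Function.iterate_zero, id, rev_rev]
  · intro k hk
    rw [h3 _ (by omega), dual_rev]
    exact h2 _ (by omega)

theorem pos_fst (d : DirEdge) : (pos d).1 = min d.primal.1.1 d.dual.1.1 := by
  have h : (pos d).1 = min d.left.1 d.right.1 := by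
    unfold pos
    rw [left_fst, right_fst]
    rcases units_cases d.dx with hx | hx <;> rcases units_cases d.dy with hy | hy <;>
      rw [hx, hy] <;> dsimp only <;> omega
  rw [h]
  by_cases hp : d.PL
  · rw [primal_of_PL hp, dual_of_PL hp]
  · rw [primal_of_not_PL hp, dual_of_not_PL hp, min_comm]

open Classical in
/-- The part inside the domain of one of the two bi-infinite paths, oriented to the left. -/
def pathEdges (n m : ℕ) (ω : Config) (b : Bool) : Finset DirEdge :=
  (insideEdges n m).filter fun d => ¬ OnLoop ω d ∧ Leftward m ω d ∧ (d.PL ↔ b = true)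

theorem mem_pathEdges {b : Bool} {d : DirEdge} : d ∈ pathEdges n m ω b ↔
    InB' n m d.dual.1 ∧ ¬ OnLoop ω d ∧ Leftward m ω d ∧ (d.PL ↔ b = true) := by
  classical
  rw [pathEdges, Finset.mem_filter, mem_insideEdges]

/-- For a given side of the primal vertices there is only one possible entrance, so these edges form
a single segment of one path. The entrance and the exit are its strictly rightmost and leftmost
positions, so the total turning vanishes. -/
theorem Admissible.sum_turn_pathEdges (h : Admissible n m ω) (b : Bool) :
    ∑ d ∈ pathEdges n m ω b, (turn ω (pred ω d) + turn ω d) = 0 := by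
  classical
  rcases (pathEdges n m ω b).eq_empty_or_nonempty with h0 | ⟨d, hd⟩
  · rw [h0, Finset.sum_empty]
  obtain ⟨hu, hl, hL, hb⟩ := mem_pathEdges.1 hd
  obtain ⟨c, K, hc, hK, hKu⟩ := h.exists_entrance hu hl hL
  have hlc : ¬ OnLoop ω c := by rwa [← onLoop_iterate (K + 1), hK]
  have hLc : Leftward m ω c := by rwa [← leftward_iterate m ω c (K + 1), hK]
  have hbc : c.PL ↔ b = true := by rw [← iterate_PL ω c (K + 1), hK, hb]
  have hex : ∃ k, ¬ InB' n m ((step ω)^[k + 1] c).dual.1 := by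
    obtain ⟨k, hk⟩ := h.not_inB'_eventually (d := step ω c) (by rwa [onLoop_step])
    exact ⟨k, by rwa [Function.iterate_succ_apply]⟩
  set N := Nat.find hex with hN
  have hout : ¬ InB' n m ((step ω)^[N + 1] c).dual.1 := Nat.find_spec hex
  have hin : ∀ k < N, InB' n m ((step ω)^[k + 1] c).dual.1 := fun k hk =>
    not_not.1 (Nat.find_min hex hk)
  have hinj := iterate_injective_of_not_onLoop hlc
  have hN0 : 0 < N := by
    rcases Nat.eq_zero_or_pos N with h1 | h1
    · rw [h1] at hout
      exact absurd (hKu 0 (Nat.zero_le _)) hout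
    · exact h1
  have himage : pathEdges n m ω b = (Finset.range N).image fun k => (step ω)^[k + 1] c := by
    ext e
    rw [mem_pathEdges, Finset.mem_image]
    constructor
    · rintro ⟨heu, hel, heL, heb⟩
      obtain ⟨c', K', hc', hK', hKu'⟩ := h.exists_entrance heu hel heL
      have hbc' : c'.PL ↔ b = true := by rw [← iterate_PL ω c' (K' + 1), hK', heb]
      obtain rfl := hc.unique hc' (hbc.trans hbc'.symm)
      refine ⟨K', Finset.mem_range.2 ?_, hK'⟩
      by_contra hcon
      exact hout (hKu' N (by omega))
    · rintro ⟨k, hk, rfl⟩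
      exact ⟨hin k (Finset.mem_range.1 hk), by rwa [onLoop_iterate],
        by rwa [leftward_iterate], by rw [iterate_PL, hbc]⟩
  rw [himage, Finset.sum_image fun i _ j _ hij => by simpa using hinj hij]
  have hx : ∀ k < N, -(2 * n + 2 : ℤ) ≤ (pos ((step ω)^[k + 1] c)).1 ∧
      (pos ((step ω)^[k + 1] c)).1 ≤ 2 * n + 1 := by
    intro k hk
    have h1 := hin k hk
    rw [inB'_iff] at h1
    have h2 := ((step ω)^[k + 1] c).corner_cases.1
    rw [pos_fst]
    omega
  have hx0 : (pos c).1 = 2 * n + 2 := by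
    rw [pos_fst, hc.dual_fst, hc.primal_fst]; omega
  have hxN : (pos ((step ω)^[N + 1] c)).1 = -(2 * n) - 3 := by
    obtain ⟨k, hk⟩ : ∃ k, N = k + 1 := ⟨N - 1, by omega⟩
    rw [hk] at hout ⊢
    have h1 := hin k (by omega)
    have h3 := hout
    rw [Function.iterate_succ_apply'] at h3
    obtain ⟨e1, e2, e3, e4, e5, e6⟩ := h.exit h1 h3
    have h4 := h.leftward_direction h3 e1
    rw [← Function.iterate_succ_apply' (step ω), leftward_iterate,
      Function.iterate_succ_apply'] at h4
    have h5 := h4.1 hLc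
    rw [Function.iterate_succ_apply', pos_fst]
    omega
  refine (Finset.sum_congr rfl fun k _ => ?_).trans
    (sum_turn_path (ω := ω) (d := c) (N := N) (fun i j hij _ => fun heq => ?_) ?_ ?_)
  · rw [Function.iterate_succ_apply', pred_step]
  · exact hij.ne (hinj heq)
  · intro j hj0 hjN
    obtain ⟨k, rfl⟩ : ∃ k, j = k + 1 := ⟨j - 1, by omega⟩
    rcases Nat.lt_or_ge k N with hk | hk
    · have := hx k hk; omega
    · obtain rfl : k = N := by omega
      omega
  · intro i hi
    rcases Nat.eq_zero_or_pos i with rfl | hi0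
    · rw [Function.iterate_zero, id]; omega
    · obtain ⟨k, rfl⟩ : ∃ k, i = k + 1 := ⟨i - 1, by omega⟩
      have := hx k (by omega)
      omega

-- Reversing a whole segment changes the sign of its sum, so the zero persists whether the
-- orientation follows each path or runs against it. The latter occurs for one of the two paths when
-- primal vertices are kept on the left.
open Classical in
theorem Admissible.sum_turn_paths (h : Admissible n m ω) (ho : ∀ d, d ∈ o ↔ d.rev ∉ o)
    (hpath : ∀ b : Bool, (∀ d ∈ pathEdges n m ω b, d ∈ o) ∨ ∀ d ∈ pathEdges n m ω b, d ∉ o) :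
    ∑ d ∈ (insideEdges n m).filter (fun d => ¬ OnLoop ω d ∧ d ∈ o),
      (turn ω (pred ω d) + turn ω d) = 0 := by
  have hrev : ∀ d, turn ω (pred ω d.rev) + turn ω d.rev = -(turn ω (pred ω d) + turn ω d) := by
    intro d
    rw [turn_pred, turn_pred, rev_rev]; ring
  have hsplit : ∀ b : Bool, ∑ d ∈ (insideEdges n m).filter (fun d => (¬ OnLoop ω d ∧ d ∈ o) ∧
      ((d.PL ↔ b = true) ∧ Leftward m ω d ∨ ¬ (d.PL ↔ b = true) ∧ ¬ Leftward m ω d)),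
      (turn ω (pred ω d) + turn ω d) = 0 := by
    intro b
    rcases hpath b with hb | hb
    · rw [← h.sum_turn_pathEdges b]
      refine Finset.sum_congr ?_ fun _ _ => rfl
      ext d
      rw [Finset.mem_filter, mem_pathEdges, mem_insideEdges]
      constructor
      · rintro ⟨hu, ⟨hl, hdo⟩, ⟨h1, h2⟩ | ⟨h1, h2⟩⟩
        · exact ⟨hu, hl, h2, h1⟩
        · have h3 : d.rev ∈ o := hb _ (mem_pathEdges.2 ⟨by rwa [dual_rev], by rwa [onLoop_rev],
            (h.leftward_rev hl).2 h2, by rw [PL_rev]; tauto⟩)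
          exact absurd h3 ((ho d).1 hdo)
      · rintro ⟨hu, hl, h2, h1⟩
        exact ⟨hu, ⟨hl, hb _ (mem_pathEdges.2 ⟨hu, hl, h2, h1⟩)⟩, Or.inl ⟨h1, h2⟩⟩
    · rw [← neg_eq_zero, ← Finset.sum_neg_distrib, ← h.sum_turn_pathEdges b]
      refine Finset.sum_bij' (fun d _ => d.rev) (fun d _ => d.rev) ?_ ?_
        (fun d _ => rev_rev d) (fun d _ => rev_rev d) (fun d _ => (hrev d).symm)
      · intro d hd
        rw [Finset.mem_filter, mem_insideEdges] at hd
        obtain ⟨hu, ⟨hl, hdo⟩, ⟨h1, h2⟩ | ⟨h1, h2⟩⟩ := hd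
        · exact absurd hdo (hb _ (mem_pathEdges.2 ⟨hu, hl, h2, h1⟩))
        · exact mem_pathEdges.2 ⟨by rwa [dual_rev], by rwa [onLoop_rev],
            (h.leftward_rev hl).2 h2, by rw [PL_rev]; tauto⟩
      · intro d hd
        have hd1 := hb d hd
        obtain ⟨hu, hl, h2, h1⟩ := mem_pathEdges.1 hd
        refine Finset.mem_filter.2 ⟨mem_insideEdges.2 (by rwa [dual_rev]),
          ⟨by rwa [onLoop_rev], by_contra fun h' => hd1 ((ho d).2 h')⟩, Or.inr ⟨?_, ?_⟩⟩
        · rw [PL_rev]; tauto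
        · rw [h.leftward_rev hl, not_not]; exact h2
  have h1 := hsplit true
  have h2 := hsplit false
  rw [← add_zero (0 : ℤ)]
  nth_rewrite 1 [← h1]
  rw [← h2, ← Finset.sum_union]
  · refine Finset.sum_congr ?_ fun _ _ => rfl
    ext d
    simp only [Finset.mem_union, Finset.mem_filter]
    tauto
  · rw [Finset.disjoint_left]
    intro d hd hd'
    have e1 := (Finset.mem_filter.1 hd).2.2
    have e2 := (Finset.mem_filter.1 hd').2.2
    clear hsplit h1 h2 hd hd'
    simp only [iff_true, Bool.false_eq_true, iff_false] at e1 e2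
    tauto

open Classical in
/-- The signed sum of turns along an orientation, in terms of its clockwise and counter-clockwise
loops. -/
theorem Admissible.sum_signed_turn (h : Admissible n m ω) (ho : ∀ d, d ∈ o ↔ d.rev ∉ o)
    (hs : ∀ d, step ω d ∈ o ↔ d ∈ o)
    (hpath : ∀ b : Bool, (∀ d ∈ pathEdges n m ω b, d ∈ o) ∨ ∀ d ∈ pathEdges n m ω b, d ∉ o) :
    ∑ d ∈ insideEdges n m, (if d ∈ o then 1 else -1) * turn ω d =
      ∑ l ∈ insideLoops n m ω, if ClockwiseLoop ω o l then -8 else 8 := by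
  -- An edge against the orientation contributes, through its reverse, the turn at the other end.
  -- Each turn of a loop is thus counted twice, which gives 8 instead of 4.
  have h1 : ∑ d ∈ insideEdges n m, (if d ∈ o then 1 else -1) * turn ω d =
      ∑ d ∈ (insideEdges n m).filter (fun d => d ∈ o), (turn ω (pred ω d) + turn ω d) := by
    rw [← Finset.sum_filter_add_sum_filter_not _ (fun d => d ∈ o), Finset.sum_add_distrib,
      add_comm]
    congr 1
    · refine Finset.sum_bij' (fun d _ => d.rev) (fun d _ => d.rev) ?_ ?_
        (fun d _ => rev_rev d) (fun d _ => rev_rev d) ?_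
      · intro d hd
        rw [Finset.mem_filter] at hd ⊢
        exact ⟨rev_mem_insideEdges.2 hd.1, by_contra fun h' => hd.2 ((ho d).2 h')⟩
      · intro d hd
        rw [Finset.mem_filter] at hd ⊢
        exact ⟨rev_mem_insideEdges.2 hd.1, (ho d).1 hd.2⟩
      · intro d hd
        rw [if_neg (Finset.mem_filter.1 hd).2, turn_pred, rev_rev]; ring
    · refine Finset.sum_congr rfl fun d hd => ?_
      rw [if_pos (Finset.mem_filter.1 hd).2, one_mul]
  rw [h1, ← Finset.sum_filter_add_sum_filter_not _ (OnLoop ω), Finset.filter_filter,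
    Finset.filter_filter]
  simp only [and_comm (a := _ ∈ o)]
  rw [h.sum_turn_paths ho hpath, add_zero, Finset.sum_add_distrib, h.sum_turn_pred_loops hs,
    h.sum_turn_loops ho hs, ← Finset.sum_add_distrib]
  refine Finset.sum_congr rfl fun l _ => ?_
  split_ifs <;> rfl

end

/-! ### Clusters and loops -/

theorem ncard_image_eq_of_eq_iff {X Y Z : Type*} {D : Set X} {f : X → Y} {g : X → Z}
    (h : ∀ a ∈ D, ∀ b ∈ D, f a = f b ↔ g a = g b) : (f '' D).ncard = (g '' D).ncard := by
  refine Set.ncard_congr (fun y hy => g hy.choose) (fun y hy => ⟨_, hy.choose_spec.1, rfl⟩) ?_ ?_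
  · intro y z hy hz hyz
    have := (h _ hy.choose_spec.1 _ hz.choose_spec.1).2 hyz
    rwa [hy.choose_spec.2, hz.choose_spec.2] at this
  · rintro _ ⟨a, ha, rfl⟩
    have hy : f a ∈ f '' D := ⟨a, ha, rfl⟩
    exact ⟨f a, hy, (h _ hy.choose_spec.1 _ ha).1 hy.choose_spec.2⟩

theorem finite_boxB (n m : ℕ) : (boxB n m).Finite := by
  refine Set.Finite.of_finite_image (f := fun i : Primal => i.1) ?_ Subtype.val_injective.injOn
  refine ((Set.finite_Icc (-(2 * n : ℤ)) (2 * n)).prod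
    (Set.finite_Icc (-(2 * m : ℤ)) (2 * m))).subset ?_
  rintro _ ⟨i, hi, rfl⟩
  rw [mem_boxB_iff] at hi
  exact hi

/-- The outer boundaries of finite clusters: counter-clockwise loops inside the domain with
primal vertices to the left. -/
def outerEdges (n m : ℕ) (ω : Config) : Set DirEdge :=
  {d | OnLoop ω d ∧ InB' n m d.dual.1 ∧ d.PL ∧ ¬ Clockwise ω d}

section

variable {n m : ℕ} {ω : Config}

theorem exists_diagonal_edge (i : Primal) :
    ∃ d : DirEdge, d.primal = i ∧ d.dual.1 = (i.1.1 + 1, i.1.2 + 1) ∧ d.PL := by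
  have hu : IsDual (i.1.1 + 1, i.1.2 + 1) := ⟨i.2.1.add_one, i.2.2.add_one⟩
  obtain ⟨d, h1, h2, h3⟩ := exists_edge i ⟨_, hu⟩ (by simp) (by simp) True
  exact ⟨d, h1, by rw [h2], h3.2 trivial⟩

/-- The ray from v + (1, 1) only meets sides whose ends are further in direction (1, 1) than v,
while the loop only touches vertices of the cluster of v. -/
theorem not_surrounds_diagonal {d : DirEdge} {v : Primal}
    (hd : (openGraph ω).Reachable v d.primal)
    (hv : ∀ j, (openGraph ω).Reachable v j → j.1.1 + j.1.2 ≤ v.1.1 + v.1.2) :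
    ¬ Surrounds ω d (v.1.1 + 1, v.1.2 + 1) := by
  intro h
  obtain ⟨j, k, hk⟩ := h.exists_crosses
  have h1 := hv _ (hd.trans (iterate_reachable ω d k))
  set f := (step ω)^[k] d
  dsimp only at hk
  have h2 : f.primal.1 = f.left ∨ f.primal.1 = f.right := by
    by_cases hp : f.PL
    · exact Or.inl (primal_of_PL hp)
    · exact Or.inr (primal_of_not_PL hp)
  rw [Sym2.eq_iff] at hk
  rcases hk with ⟨h3, h4⟩ | ⟨h3, h4⟩ <;> rw [h3, h4] at h2 <;> rcases h2 with h2 | h2 <;>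
    rw [h2] at h1 <;> dsimp only at h1 <;> omega

/-- Such a loop surrounds its adjacent cluster, and no vertex outside the box is surrounded. -/
theorem Admissible.mem_boxB_of_mem_outerEdges (h : Admissible n m ω) {d : DirEdge}
    (hd : d ∈ outerEdges n m ω) {i : Primal} (hi : (openGraph ω).Reachable d.primal i) :
    i ∈ boxB n m := by
  obtain ⟨hl, hu, hp, hc⟩ := hd
  by_contra hb
  have h1 := h.not_surrounds_primal hl hb
  rw [← surrounds_of_reachable hl hi] at h1
  have h2 := hl.surrounds_xor
  rw [clockwise_iff hl] at hc
  tauto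

theorem exists_extremal (v : Primal)
    (hv : ∀ i, (openGraph ω).Reachable v i → i ∈ boxB n m) :
    ∃ i, (openGraph ω).Reachable v i ∧
      ∀ j, (openGraph ω).Reachable i j → j.1.1 + j.1.2 ≤ i.1.1 + i.1.2 := by
  obtain ⟨i, hi, hmax⟩ := Set.exists_max_image {i | (openGraph ω).Reachable v i}
    (fun i => i.1.1 + i.1.2) ((finite_boxB n m).subset hv) ⟨v, SimpleGraph.Reachable.refl v⟩
  exact ⟨i, hi, fun j hj => hmax j (hi.trans hj)⟩

theorem Admissible.mem_outerEdges_of_extremal (h : Admissible n m ω) {e : DirEdge}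
    (hb : ∀ i, (openGraph ω).Reachable e.primal i → i ∈ boxB n m)
    (hmax : ∀ j, (openGraph ω).Reachable e.primal j →
      j.1.1 + j.1.2 ≤ e.primal.1.1 + e.primal.1.2)
    (he : e.dual.1 = (e.primal.1.1 + 1, e.primal.1.2 + 1)) (hp : e.PL) :
    e ∈ outerEdges n m ω := by
  have hl : OnLoop ω e := by
    by_contra hl
    obtain ⟨K, hK⟩ := h.eventually_outside hl
    exact primal_not_mem_boxB (hK K le_rfl).1 (hb _ (iterate_reachable ω e K))
  refine ⟨hl, ?_, hp, ?_⟩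
  · have h1 := hb _ (SimpleGraph.Reachable.refl _)
    rw [mem_boxB_iff] at h1
    rw [inB'_iff, he]
    dsimp only
    omega
  · rw [clockwise_iff hl, he]
    have := not_surrounds_diagonal (SimpleGraph.Reachable.refl _) hmax
    tauto

/-- An outer loop surrounds an extremal vertex of its cluster but not the dual vertex beyond it, so
it uses the medial edge between them. This identifies the outer loop of a cluster. -/
theorem exists_iterate_eq_extremal {d e : DirEdge}
    (hd : d ∈ outerEdges n m ω) (hde : (openGraph ω).Reachable d.primal e.primal)
    (hmax : ∀ j, (openGraph ω).Reachable e.primal j →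
      j.1.1 + j.1.2 ≤ e.primal.1.1 + e.primal.1.2)
    (he : e.dual.1 = (e.primal.1.1 + 1, e.primal.1.2 + 1)) (hp : e.PL) :
    ∃ k, (step ω)^[k] d = e := by
  obtain ⟨hl, hu, hdp, hc⟩ := hd
  have h1 := not_surrounds_diagonal hde.symm hmax
  rw [← he] at h1
  have h2 : Surrounds ω d e.primal.1 := by
    rw [← surrounds_of_reachable hl hde]
    have h2 := hl.surrounds_xor
    rw [clockwise_iff hl] at hc
    tauto
  obtain ⟨k, hk⟩ := (hits_iff_primal_dual hl e).2 (by tauto)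
  rcases hk with hk | hk
  · exact ⟨k, hk⟩
  · have h3 := iterate_PL ω d k
    rw [hk, PL_rev] at h3
    tauto

theorem Admissible.loopThrough_eq_iff (h : Admissible n m ω) {d e : DirEdge}
    (hd : d ∈ outerEdges n m ω) (he : e ∈ outerEdges n m ω) :
    loopThrough ω d = loopThrough ω e ↔ (openGraph ω).connectedComponentMk d.primal =
      (openGraph ω).connectedComponentMk e.primal := by
  rw [SimpleGraph.ConnectedComponent.eq]
  constructor
  · intro hde
    rcases exists_iterate_of_loopThrough_eq hde with ⟨k, rfl⟩ | ⟨k, hk⟩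
    · exact iterate_reachable ω d k
    · rw [← primal_rev e, ← hk]
      exact iterate_reachable ω d k
  · intro hde
    obtain ⟨i, hi, hmax⟩ := exists_extremal (n := n) (m := m) d.primal
      fun i => h.mem_boxB_of_mem_outerEdges hd
    obtain ⟨f, rfl, hf, hfp⟩ := exists_diagonal_edge i
    obtain ⟨k, hk⟩ := exists_iterate_eq_extremal hd hi hmax hf hfp
    obtain ⟨k', hk'⟩ := exists_iterate_eq_extremal he (hde.symm.trans hi) hmax hf hfp
    rw [← loopThrough_iterate hd.1 k, ← loopThrough_iterate he.1 k', hk, hk']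

/-- A cluster contained in the box has exactly one outer loop; the remaining two clusters are the
upper and the lower one. -/
theorem Admissible.numClusters_eq (h : Admissible n m ω) :
    numClusters (boxV n m) ω = (loopThrough ω '' outerEdges n m ω).ncard + 2 := by
  have hB := mem_boxB_iff (n := n) (m := m)
  set cu := (openGraph ω).connectedComponentMk (pvertex 0 (m + 1)) with hcu
  set cl := (openGraph ω).connectedComponentMk (pvertex 0 (-m - 1)) with hcl
  have hu1 : pvertex 0 (m + 1) ∉ boxB n m := by rw [pvertex_mem_boxB]; omega
  have hl1 : pvertex 0 (-m - 1) ∉ boxB n m := by rw [pvertex_mem_boxB]; omega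
  have hu2 : (0 : ℤ) ≤ (pvertex 0 (m + 1)).1.2 := by dsimp only [pvertex]; omega
  have hl2 : (pvertex 0 (-m - 1)).1.2 < 0 := by dsimp only [pvertex]; omega
  have houtside : ∀ i : Primal, i ∉ boxB n m → (openGraph ω).connectedComponentMk i = cu ∨
      (openGraph ω).connectedComponentMk i = cl := by
    intro i hi
    rw [hcu, hcl, SimpleGraph.ConnectedComponent.eq, SimpleGraph.ConnectedComponent.eq]
    rcases lt_or_ge i.1.2 0 with h0 | h0
    · exact Or.inr (h.reachable_lower hi hl1 h0 hl2)
    · exact Or.inl (h.reachable_upper hi hu1 h0 hu2)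
  have hne : cu ≠ cl := by
    rw [hcu, hcl, Ne, SimpleGraph.ConnectedComponent.eq]
    exact h.not_reachable hu1 hl1 hu2 hl2
  have hD : ∀ d ∈ outerEdges n m ω, (openGraph ω).connectedComponentMk d.primal ≠ cu ∧
      (openGraph ω).connectedComponentMk d.primal ≠ cl := by
    intro d hd
    rw [hcu, hcl, Ne, Ne, SimpleGraph.ConnectedComponent.eq, SimpleGraph.ConnectedComponent.eq]
    exact ⟨fun hr => hu1 (h.mem_boxB_of_mem_outerEdges hd hr),
      fun hr => hl1 (h.mem_boxB_of_mem_outerEdges hd hr)⟩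
  have hset : {C : (openGraph ω).ConnectedComponent |
      ∃ i ∈ boxV n m, (openGraph ω).connectedComponentMk i = C} =
      insert cu (insert cl
        ((fun d : DirEdge => (openGraph ω).connectedComponentMk d.primal) '' outerEdges n m ω)) := by
    ext C
    simp only [Set.mem_insert_iff, Set.mem_image, Set.mem_ofPred_eq]
    constructor
    · rintro ⟨i, -, rfl⟩
      by_cases hi : ∀ j, (openGraph ω).Reachable i j → j ∈ boxB n m
      · obtain ⟨v, hv, hmax⟩ := exists_extremal i hi
        obtain ⟨e, rfl, he, hp⟩ := exists_diagonal_edge v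
        refine Or.inr (Or.inr ⟨e, h.mem_outerEdges_of_extremal (fun j hj => hi j (hv.trans hj))
          hmax he hp, ?_⟩)
        rw [SimpleGraph.ConnectedComponent.eq]
        exact hv.symm
      · push Not at hi
        obtain ⟨j, hj, hjB⟩ := hi
        rw [SimpleGraph.ConnectedComponent.eq.2 hj]
        rcases houtside j hjB with h1 | h1
        · exact Or.inl h1
        · exact Or.inr (Or.inl h1)
    · rintro (rfl | rfl | ⟨d, hd, rfl⟩)
      · exact ⟨_, Or.inr (pvertex_mem_upperBoundary n m).1, rfl⟩
      · exact ⟨_, Or.inr (pvertex_mem_lowerBoundary n m).1, rfl⟩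
      · exact ⟨_, Or.inl (h.mem_boxB_of_mem_outerEdges hd (SimpleGraph.Reachable.refl _)), rfl⟩
  have hfin : ((fun d : DirEdge => (openGraph ω).connectedComponentMk d.primal) ''
      outerEdges n m ω).Finite :=
    Set.Finite.image _ ((finite_insideEdges n m).subset fun d hd => hd.2.1)
  rw [numClusters, hset, Set.ncard_insert_of_notMem _ (hfin.insert _), Set.ncard_insert_of_notMem _ hfin,
    ncard_image_eq_of_eq_iff fun a ha b hb => h.loopThrough_eq_iff ha hb]
  · rintro ⟨d, hd, hdc⟩
    exact (hD d hd).2 hdc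
  · rintro (hc | ⟨d, hd, hdc⟩)
    · exact hne hc
    · exact (hD d hd).1 hdc

/-- The orientation with the primal vertices on the left. -/
def primalLeft : Set DirEdge := {d | d.PL}

theorem primalLeft_rev (d : DirEdge) : d ∈ primalLeft ↔ d.rev ∉ primalLeft := by
  change d.PL ↔ ¬ d.rev.PL
  rw [PL_rev, not_not]

theorem image_loopThrough_outerEdges :
    loopThrough ω '' outerEdges n m ω =
      Subtype.val '' {l : Loop | l ∈ insideLoops n m ω ∧ ¬ ClockwiseLoop ω primalLeft l} := by
  ext a
  constructor
  · rintro ⟨d, ⟨hl, hu, hp, hc⟩, rfl⟩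
    refine ⟨loopOf hl, ⟨mem_insideLoops.2 ⟨d, hl, hu, rfl⟩, ?_⟩, rfl⟩
    rwa [clockwiseLoop_loopOf primalLeft_rev (step_PL ω) hl hp]
  · rintro ⟨l, ⟨hl, hc⟩, rfl⟩
    obtain ⟨d, hdo, hd, hu, rfl⟩ := exists_mem_of_mem_insideLoops primalLeft_rev hl
    rw [clockwiseLoop_loopOf primalLeft_rev (step_PL ω) hd hdo] at hc
    exact ⟨d, ⟨hd, hu, hdo, hc⟩, rfl⟩

open Classical in
theorem Admissible.numClusters_eq_card (h : Admissible n m ω) : numClusters (boxV n m) ω =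
    ((insideLoops n m ω).filter fun l => ¬ ClockwiseLoop ω primalLeft l).card + 2 := by
  rw [h.numClusters_eq, image_loopThrough_outerEdges,
    Set.ncard_image_of_injective _ Subtype.val_injective, ← Set.ncard_coe_finset]
  congr 2
  ext l
  simp

/-- The sign of a tile: `1` if its primal edge is closed, `-1` if it is open. -/
def closedSign (ω : Config) (t : Tile) : ℤ := if ω t then -1 else 1

/-- The alternating sum over the medial edges determines the number of clusters. -/
theorem Admissible.sum_closedSign (h : Admissible n m ω) :
    ∑ d ∈ insideEdges n m, closedSign ω d.tgt =
      16 * (numClusters (boxV n m) ω : ℤ) - 32 - 8 * (insideLoops n m ω).card := by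
  classical
  have h1 := h.sum_signed_turn (o := primalLeft) primalLeft_rev (step_PL ω) (fun b => by
    cases b
    · exact Or.inr fun d hd hdp => by simpa using (mem_pathEdges.1 hd).2.2.2.1 hdp
    · exact Or.inl fun d hd => (mem_pathEdges.1 hd).2.2.2.2 rfl)
  have h2 : ∑ d ∈ insideEdges n m, closedSign ω d.tgt =
      ∑ d ∈ insideEdges n m, (if d ∈ primalLeft then 1 else -1) * turn ω d := by
    refine Finset.sum_congr rfl fun d _ => ?_
    have h3 : d ∈ primalLeft ↔ d.PL := Iff.rfl
    rw [turn_eq, closedSign, if_congr h3 rfl rfl]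
    by_cases hp : d.PL <;> simp [hp]
  rw [h2, h1, h.numClusters_eq_card]
  have h3 : ∀ l : Loop, (if ClockwiseLoop ω primalLeft l then (-8 : ℤ) else 8) =
      16 * (if ¬ ClockwiseLoop ω primalLeft l then 1 else 0) - 8 := by
    intro l; split_ifs <;> simp_all
  simp only [h3]
  rw [Finset.sum_sub_distrib, ← Finset.mul_sum, Finset.sum_boole, Finset.sum_const]
  push_cast
  rw [nsmul_eq_mul]
  ring

end

/-! ### Summation over tiles -/

theorem mem_boxE_of_dual {n m : ℕ} {t : Tile} (ht : t ∈ boxE n m) {u : Dual}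
    (hu : IsCorner u.1 t.1) : InB' n m u.1 := by
  by_contra h
  exact tile_not_mem_boxE h hu ht

theorem mem_boxE_of_two_dual {n m : ℕ} {t : Tile} {u v : Dual} (hu : IsCorner u.1 t.1)
    (hv : IsCorner v.1 t.1) (huv : u ≠ v) (hu' : InB' n m u.1) (hv' : InB' n m v.1) :
    t ∈ boxE n m := by
  obtain ⟨i, j, hi, hj, h1, h2, hij, -⟩ := exists_primal_corners t
  rw [mem_boxE_iff]
  by_contra! hcon
  have h3 := mt (fun h => hcon i h) (not_not.2 hi)
  have h4 := mt (fun h => hcon j h) (not_not.2 hj)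
  rw [mem_boxB_iff] at h3 h4
  rw [inB'_iff] at hu' hv'
  have hi2 := i.2
  have hj2 := j.2
  have hu2 := u.2
  have hv2 := v.2
  simp only [IsPrimal, IsDual, Int.even_iff, Int.odd_iff] at hi2 hj2 hu2 hv2
  rw [isCorner_iff] at hi hj hu hv
  have huv' : u.1.1 ≠ v.1.1 ∨ u.1.2 ≠ v.1.2 := by
    by_contra! h
    exact huv (Subtype.ext (Prod.ext h.1 h.2))
  have hij' : i.1.1 ≠ j.1.1 ∨ i.1.2 ≠ j.1.2 := by
    by_contra! h
    exact hij (Subtype.ext (Prod.ext h.1 h.2))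
  generalize i.1.1 = i1 at *
  generalize i.1.2 = i2 at *
  generalize j.1.1 = j1 at *
  generalize j.1.2 = j2 at *
  generalize u.1.1 = u1 at *
  generalize u.1.2 = u2 at *
  generalize v.1.1 = v1 at *
  generalize v.1.2 = v2 at *
  generalize t.1.1 = t1 at *
  generalize t.1.2 = t2 at *
  clear hcon
  rcases hu with hu | hu | hu | hu <;> rcases hi with hi | hi | hi | hi <;> omega

open Classical in
/-- The edges of the graph, as a finite set of tiles. -/
def edgeTiles (n m : ℕ) : Finset Tile := ((insideEdges n m).image tgt).filter (· ∈ boxE n m)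

open Classical in
/-- The tiles outside the graph with a corner in the domain. -/
def outerTiles (n m : ℕ) : Finset Tile := ((insideEdges n m).image tgt).filter (· ∉ boxE n m)

theorem exists_insideEdge {n m : ℕ} {t : Tile} {u : Dual} (hu : IsCorner u.1 t.1)
    (hu' : InB' n m u.1) : ∃ d ∈ insideEdges n m, d.tgt = t := by
  obtain ⟨i, -, hi, -⟩ := exists_primal_corners t
  obtain ⟨e, he, -, heu⟩ := exists_into t i u hi hu
  exact ⟨e, mem_insideEdges.2 (by rwa [heu]), he⟩

theorem mem_edgeTiles {n m : ℕ} {t : Tile} : t ∈ edgeTiles n m ↔ t ∈ boxE n m := by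
  classical
  rw [edgeTiles, Finset.mem_filter, Finset.mem_image]
  refine ⟨And.right, fun h => ⟨?_, h⟩⟩
  obtain ⟨u, -, hu, -⟩ := exists_dual_corners t
  exact exists_insideEdge hu (mem_boxE_of_dual h hu)

theorem mem_outerTiles {n m : ℕ} {t : Tile} : t ∈ outerTiles n m ↔
    t ∉ boxE n m ∧ ∃ u : Dual, IsCorner u.1 t.1 ∧ InB' n m u.1 := by
  classical
  rw [outerTiles, Finset.mem_filter, Finset.mem_image, and_comm]
  refine and_congr_right fun _ => ⟨?_, ?_⟩
  · rintro ⟨d, hd, rfl⟩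
    exact ⟨d.dual, isCorner_dual d, mem_insideEdges.1 hd⟩
  · rintro ⟨u, hu, hu'⟩
    exact exists_insideEdge hu hu'

theorem isCorner_primal_or_dual {v : Pt} {t : Tile} (h : IsCorner v t.1) :
    IsPrimal v ∨ IsDual v := by
  have := t.2
  rw [isCorner_iff] at h
  simp only [IsPrimal, IsDual, Int.even_iff, Int.odd_iff] at *
  omega

theorem finite_corners (t : Tile) : {v : Pt | IsCorner v t.1}.Finite := by
  refine ((Set.finite_Icc (t.1.1 - 1) (t.1.1 + 1)).prod
    (Set.finite_Icc (t.1.2 - 1) (t.1.2 + 1))).subset fun v hv => ?_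
  rw [Set.mem_ofPred_eq, isCorner_iff] at hv
  rw [Set.mem_prod, Set.mem_Icc, Set.mem_Icc]
  omega

theorem one_lt_cornersInD {n m : ℕ} {t : Tile} (h : t ∈ boxE n m) : 1 < cornersInD n m t := by
  obtain ⟨u, v, hu, hv, -, -, huv, -⟩ := exists_dual_corners t
  rw [cornersInD, Set.one_lt_ncard_iff ((finite_corners t).subset fun v hv => hv.1)]
  exact ⟨u.1, v.1, ⟨hu, Or.inr (mem_boxE_of_dual h hu)⟩, ⟨hv, Or.inr (mem_boxE_of_dual h hv)⟩,
    fun h => huv (Subtype.ext h)⟩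

theorem exists_dual_of_corner {n m : ℕ} {t : Tile} (ht : t ∉ boxE n m) {v : Pt}
    (hv : IsCorner v t.1) (h : InB n m v ∨ InB' n m v) : IsDual v ∧ InB' n m v := by
  rcases h with h | h
  · exact absurd (mem_boxE_iff.2 ⟨⟨v, h.1⟩, h, hv⟩) ht
  · exact ⟨h.1, h⟩

theorem cornersInD_le_one {n m : ℕ} {t : Tile} (h : t ∉ boxE n m) : cornersInD n m t ≤ 1 := by
  rw [cornersInD, Set.ncard_le_one_iff ((finite_corners t).subset fun v hv => hv.1)]
  rintro a b ⟨ha, ha'⟩ ⟨hb, hb'⟩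
  by_contra hab
  obtain ⟨ha1, ha2⟩ := exists_dual_of_corner h ha ha'
  obtain ⟨hb1, hb2⟩ := exists_dual_of_corner h hb hb'
  exact h (mem_boxE_of_two_dual (u := ⟨a, ha1⟩) (v := ⟨b, hb1⟩) ha hb
    (fun h => hab (congrArg Subtype.val h)) ha2 hb2)

theorem cornersInD_pos_iff {n m : ℕ} {t : Tile} :
    0 < cornersInD n m t ↔ ∃ v, IsCorner v t.1 ∧ (InB n m v ∨ InB' n m v) := by
  rw [cornersInD, Set.ncard_pos ((finite_corners t).subset fun v hv => hv.1)]
  rfl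

/-- A tile of the graph has both dual corners in `B'`; any other tile has at most one corner in the
domain, necessarily a dual one. -/
theorem mem_interiorTiles_iff {n m : ℕ} {t : Tile} : t ∈ interiorTiles n m ↔ t ∈ edgeTiles n m := by
  rw [mem_edgeTiles]
  change 1 ≤ cornersInD n m t ∧ ¬ cornersInD n m t = 1 ↔ _
  by_cases h : t ∈ boxE n m
  · have := one_lt_cornersInD h
    exact iff_of_true (by omega) h
  · have := cornersInD_le_one h
    exact iff_of_false (by omega) h

theorem mem_boundaryTiles_iff {n m : ℕ} {t : Tile} : t ∈ boundaryTiles n m ↔ t ∈ outerTiles n m := by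
  rw [mem_outerTiles]
  change cornersInD n m t = 1 ↔ _
  by_cases h : t ∈ boxE n m
  · have := one_lt_cornersInD h
    exact iff_of_false (by omega) fun h' => h'.1 h
  · have h1 := cornersInD_le_one h
    rw [show cornersInD n m t = 1 ↔ 0 < cornersInD n m t by omega, cornersInD_pos_iff]
    constructor
    · rintro ⟨v, hv, hv'⟩
      obtain ⟨h2, h3⟩ := exists_dual_of_corner h hv hv'
      exact ⟨h, ⟨v, h2⟩, hv, h3⟩
    · rintro ⟨-, u, hu, hu'⟩
      exact ⟨u.1, hu, Or.inr hu'⟩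

theorem sum_insideEdges {n m : ℕ} (f : DirEdge → ℤ) [DecidableEq Tile] :
    ∑ d ∈ insideEdges n m, f d =
      ∑ t ∈ edgeTiles n m, ∑ d ∈ (insideEdges n m).filter (fun d => d.tgt = t), f d +
      ∑ t ∈ outerTiles n m, ∑ d ∈ (insideEdges n m).filter (fun d => d.tgt = t), f d := by
  classical
  rw [edgeTiles, outerTiles, Finset.sum_filter_add_sum_filter_not]
  convert (Finset.sum_fiberwise_of_maps_to (fun d hd => Finset.mem_image_of_mem tgt hd) f).symm

theorem eq_of_tgt_eq {d e : DirEdge} (ht : d.tgt = e.tgt) (hp : d.primal = e.primal)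
    (hu : d.dual = e.dual) : d = e :=
  ext_primal_dual hp hu (by rw [PL_iff, PL_iff, ht, hp, hu])

-- The medial edges directed into a tile correspond to pairs of a primal and a dual corner.
open Classical in
theorem sum_tile {n m : ℕ} {t : Tile} {i j : Primal} {u v : Dual} (hi : IsCorner i.1 t.1)
    (hj : IsCorner j.1 t.1) (hij : i ≠ j) (hall : ∀ k : Primal, IsCorner k.1 t.1 → k = i ∨ k = j)
    (hu : IsCorner u.1 t.1) (hv : IsCorner v.1 t.1) (huv : u ≠ v)
    (hall' : ∀ w : Dual, IsCorner w.1 t.1 → w = u ∨ w = v) (F : Primal → Dual → ℤ) :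
    ∑ d ∈ (insideEdges n m).filter (fun d => d.tgt = t), F d.primal d.dual =
      (if InB' n m u.1 then F i u + F j u else 0) +
        (if InB' n m v.1 then F i v + F j v else 0) := by
  have h1 : ∑ d ∈ (insideEdges n m).filter (fun d => d.tgt = t), F d.primal d.dual =
      ∑ p ∈ ({i, j} : Finset Primal) ×ˢ ({u, v} : Finset Dual).filter (fun w => InB' n m w.1),
        F p.1 p.2 := by
    refine Finset.sum_bij (fun d _ => (d.primal, d.dual)) ?_ ?_ ?_ fun _ _ => rfl
    · intro d hd
      obtain ⟨hd', rfl⟩ := Finset.mem_filter.1 hd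
      rw [Finset.mem_product, Finset.mem_filter, Finset.mem_insert, Finset.mem_singleton,
        Finset.mem_insert, Finset.mem_singleton]
      exact ⟨hall _ (isCorner_primal d), hall' _ (isCorner_dual d), mem_insideEdges.1 hd'⟩
    · intro d hd e he hde
      rw [Finset.mem_filter] at hd he
      exact eq_of_tgt_eq (hd.2.trans he.2.symm) (congrArg Prod.fst hde) (congrArg Prod.snd hde)
    · rintro ⟨p, w⟩ hp
      rw [Finset.mem_product, Finset.mem_filter, Finset.mem_insert, Finset.mem_singleton,
        Finset.mem_insert, Finset.mem_singleton] at hp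
      obtain ⟨hp, hw, hwB⟩ := hp
      obtain ⟨e, he, hep, heu⟩ := exists_into t p w (by rcases hp with rfl | rfl <;> assumption)
        (by rcases hw with rfl | rfl <;> assumption)
      exact ⟨e, Finset.mem_filter.2 ⟨mem_insideEdges.2 (by rwa [heu]), he⟩, Prod.ext hep heu⟩
  rw [h1, Finset.sum_product_right, Finset.sum_filter, Finset.sum_pair huv,
    Finset.sum_pair hij, Finset.sum_pair hij]

/-! ### The Euler relation and the local form of the loop weights. -/

section

variable {n m : ℕ} {ω : Config}

/-- Up to a constant, the number of open edges and the number of clusters of an admissible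
configuration determine its number of loops. -/
theorem exists_euler_constant (n m : ℕ) : ∃ C : ℤ, ∀ ω, Admissible n m ω →
    8 * (((edgeTiles n m).filter (fun t => ω t = true)).card : ℤ) +
      16 * (numClusters (boxV n m) ω : ℤ) = 8 * ((insideLoops n m ω).card : ℤ) + C := by
  classical
  -- In `Admissible.sum_closedSign` a closed graph tile counts 4 and an open one -4, whereas the
  -- tiles outside the graph have the state prescribed by `wiredWired`.
  refine ⟨32 + 4 * (edgeTiles n m).card + ∑ t ∈ outerTiles n m,
    ∑ d ∈ (insideEdges n m).filter (fun d => d.tgt = t), closedSign wiredWired d.tgt,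
    fun ω h => ?_⟩
  have h1 := h.sum_closedSign
  rw [sum_insideEdges] at h1
  have h2 : ∀ t ∈ outerTiles n m,
      ∑ d ∈ (insideEdges n m).filter (fun d => d.tgt = t), closedSign ω d.tgt =
      ∑ d ∈ (insideEdges n m).filter (fun d => d.tgt = t), closedSign wiredWired d.tgt := by
    intro t ht
    refine Finset.sum_congr rfl fun d hd => ?_
    rw [(Finset.mem_filter.1 hd).2, closedSign, closedSign, h.1 t (mem_outerTiles.1 ht).1]
  have h3 : ∀ t ∈ edgeTiles n m,
      ∑ d ∈ (insideEdges n m).filter (fun d => d.tgt = t), closedSign ω d.tgt =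
      4 - 8 * (if ω t = true then 1 else 0) := by
    intro t ht
    obtain ⟨i, j, hi, hj, -, -, hij, hall⟩ := exists_primal_corners t
    obtain ⟨u, v, hu, hv, -, -, huv, hall'⟩ := exists_dual_corners t
    rw [mem_edgeTiles] at ht
    have h4 := sum_tile (n := n) (m := m) hi hj hij hall hu hv huv hall'
      fun _ _ => closedSign ω t
    rw [if_pos (mem_boxE_of_dual ht hu), if_pos (mem_boxE_of_dual ht hv)] at h4
    have h5 : ∑ d ∈ (insideEdges n m).filter (fun d => d.tgt = t), closedSign ω d.tgt =
        ∑ d ∈ (insideEdges n m).filter (fun d => d.tgt = t), closedSign ω t :=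
      Finset.sum_congr rfl fun d hd => by rw [(Finset.mem_filter.1 hd).2]
    rw [h5, h4, closedSign]
    split_ifs <;> norm_num
  rw [Finset.sum_congr rfl h2, Finset.sum_congr rfl h3, Finset.sum_sub_distrib, ← Finset.mul_sum,
    Finset.sum_boole, Finset.sum_const, nsmul_eq_mul] at h1
  linarith

/-- The product of the spin of the primal endpoints and the spin of the dual endpoints of a tile
of type 5 or 6. -/
def tileSign (s : SpinPair) (t : Tile) : ℤˣ :=
  vertexSpin s (t.1.1 + 1, t.1.2) * vertexSpin s (t.1.1, t.1.2 + 1)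

theorem tileSign_eq {s : SpinPair} {t : Tile} (h : IsType56 s t) {i : Primal} {u : Dual}
    (hi : IsCorner i.1 t.1) (hu : IsCorner u.1 t.1) : tileSign s t = s.1 i * s.2 u := by
  have h1 : IsCorner (t.1.1 + 1, t.1.2) t.1 := by rw [isCorner_iff]; simp
  have h2 : IsCorner (t.1.1, t.1.2 + 1) t.1 := by rw [isCorner_iff]; simp
  have ht := t.2
  rw [tileSign]
  by_cases hp : IsPrimal (t.1.1 + 1, t.1.2)
  · have hd : IsDual (t.1.1, t.1.2 + 1) := by
      simp only [IsPrimal, IsDual, Int.even_iff, Int.odd_iff] at *; omega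
    have e1 := vertexSpin_primal s ⟨_, hp⟩
    have e2 := vertexSpin_dual s ⟨_, hd⟩
    dsimp only at e1 e2
    rw [e1, e2, h.1 ⟨_, hp⟩ i h1 hi, h.2 ⟨_, hd⟩ u h2 hu]
  · have hd : IsDual (t.1.1 + 1, t.1.2) := (isCorner_primal_or_dual h1).resolve_left hp
    have hp' : IsPrimal (t.1.1, t.1.2 + 1) := by
      simp only [IsPrimal, IsDual, Int.even_iff, Int.odd_iff] at *; omega
    have e1 := vertexSpin_primal s ⟨_, hp'⟩
    have e2 := vertexSpin_dual s ⟨_, hd⟩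
    dsimp only at e1 e2
    rw [e1, e2, h.1 ⟨_, hp'⟩ i h2 hi, h.2 ⟨_, hd⟩ u h1 hu, mul_comm]

theorem units_sum_mul_sum (a b c d : ℤˣ) (h : a = b ∨ c = d) [Decidable (a = b ∧ c = d)] :
    ((a : ℤ) + b) * ((c : ℤ) + d) = if a = b ∧ c = d then 4 * ((a * c : ℤˣ) : ℤ) else 0 := by
  split_ifs with h'
  · rw [← h'.1, ← h'.2]
    push_cast
    ring
  · have hne : ∀ x y : ℤˣ, x ≠ y → (x : ℤ) + y = 0 := by decide
    rcases h with h | h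
    · rw [hne c d fun h1 => h' ⟨h, h1⟩, mul_zero]
    · rw [hne a b fun h1 => h' ⟨h1, h⟩, zero_mul]

theorem isType56_iff {s : SpinPair} {t : Tile} {i j : Primal} {u v : Dual}
    (hi : IsCorner i.1 t.1) (hj : IsCorner j.1 t.1)
    (hall : ∀ k : Primal, IsCorner k.1 t.1 → k = i ∨ k = j) (hu : IsCorner u.1 t.1)
    (hv : IsCorner v.1 t.1) (hall' : ∀ w : Dual, IsCorner w.1 t.1 → w = u ∨ w = v) :
    IsType56 s t ↔ s.1 i = s.1 j ∧ s.2 u = s.2 v := by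
  refine ⟨fun h => ⟨h.1 i j hi hj, h.2 u v hu hv⟩, fun h => ⟨fun k l hk hl => ?_,
    fun k l hk hl => ?_⟩⟩
  · rcases hall k hk with rfl | rfl <;> rcases hall l hl with rfl | rfl <;> simp [h.1]
  · rcases hall' k hk with rfl | rfl <;> rcases hall' l hl with rfl | rfl <;> simp [h.2]

-- The sum over the four corner pairs is (σ(i) + σ(j))(σ(u) + σ(v)) times the sign of the tile. By
-- the ice rule it vanishes unless the tile is of type 5 or 6.
open Classical in
theorem sum_tile_of_edge {s : SpinPair} (hs : IceRule s) {t : Tile} (ht : t ∈ edgeTiles n m) :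
    ∑ d ∈ (insideEdges n m).filter (fun d => d.tgt = t),
      closedSign ω d.tgt * (s.1 d.primal * s.2 d.dual : ℤˣ) =
      if IsType56 s t then 4 * closedSign ω t * (tileSign s t : ℤ) else 0 := by
  obtain ⟨i, j, hi, hj, -, -, hij, hall⟩ := exists_primal_corners t
  obtain ⟨u, v, hu, hv, -, -, huv, hall'⟩ := exists_dual_corners t
  rw [mem_edgeTiles] at ht
  have h4 := sum_tile (n := n) (m := m) hi hj hij hall hu hv huv hall'
    fun p w => closedSign ω t * (s.1 p * s.2 w : ℤˣ)
  rw [if_pos (mem_boxE_of_dual ht hu), if_pos (mem_boxE_of_dual ht hv)] at h4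
  have h5 : ∑ d ∈ (insideEdges n m).filter (fun d => d.tgt = t),
      closedSign ω d.tgt * (s.1 d.primal * s.2 d.dual : ℤˣ) =
      ∑ d ∈ (insideEdges n m).filter (fun d => d.tgt = t),
        closedSign ω t * (s.1 d.primal * s.2 d.dual : ℤˣ) :=
    Finset.sum_congr rfl fun d hd => by rw [(Finset.mem_filter.1 hd).2]
  have hice : s.1 i = s.1 j ∨ s.2 u = s.2 v := by
    rcases mul_eq_zero.1 (hs t i j u v hi hj hu hv) with h | h
    · exact Or.inl (Units.ext (sub_eq_zero.1 h))
    · exact Or.inr (Units.ext (sub_eq_zero.1 h))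
  have h6 := units_sum_mul_sum _ _ _ _ hice
  have h56 := isType56_iff (s := s) hi hj hall hu hv hall'
  rw [h5, h4]
  push_cast
  trans closedSign ω t * (((s.1 i : ℤ) + s.1 j) * ((s.2 u : ℤ) + s.2 v))
  · ring
  rw [h6, if_congr h56.symm rfl rfl]
  split_ifs with h
  · rw [tileSign_eq h hi hu]; ring
  · ring

-- Only the dual corner in `B'` contributes. At height -1 the two primal corners have opposite spins
-- and cancel. Elsewhere the tile is open and the other three corners share one spin, so the value
-- is -2 or 2 according to whether the last spin agrees.
open Classical in
theorem Admissible.sum_tile_of_outer (h : Admissible n m ω) {s : SpinPair}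
    (hbc : DobrushinBC n m s) {t : Tile} (ht : t ∈ outerTiles n m) :
    ∑ d ∈ (insideEdges n m).filter (fun d => d.tgt = t),
      closedSign ω d.tgt * (s.1 d.primal * s.2 d.dual : ℤˣ) =
      (if t.1.2 = -1 then 0 else 2) - if IsType56 s t then 4 else 0 := by
  obtain ⟨htE, w, hw, hwB⟩ := mem_outerTiles.1 ht
  obtain ⟨i, j, hi, hj, hx, hy, hij, hall⟩ := exists_primal_corners t
  obtain ⟨u, v, hu, hv, huvx, huvy, huv, hall'⟩ : ∃ u v : Dual, IsCorner u.1 t.1 ∧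
      IsCorner v.1 t.1 ∧ u.1.1 + v.1.1 = 2 * t.1.1 ∧ u.1.2 + v.1.2 = 2 * t.1.2 ∧ u ≠ v ∧
      (∀ w : Dual, IsCorner w.1 t.1 → w = u ∨ w = v) ∧ InB' n m u.1 := by
    obtain ⟨u, v, hu, hv, h1, h2, huv, hall'⟩ := exists_dual_corners t
    rcases hall' w hw with rfl | rfl
    · exact ⟨_, _, hu, hv, h1, h2, huv, hall', hwB⟩
    · exact ⟨_, _, hv, hu, by omega, by omega, huv.symm, fun k hk => (hall' k hk).symm, hwB⟩
  obtain ⟨hall', huB⟩ := hall'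
  have hvB : ¬ InB' n m v.1 := fun h' => htE (mem_boxE_of_two_dual hu hv huv huB h')
  have h4 := sum_tile (n := n) (m := m) hi hj hij hall hu hv huv hall'
    fun p w => closedSign ω t * (s.1 p * s.2 w : ℤˣ)
  rw [if_pos huB, if_neg hvB, add_zero] at h4
  have h5 : ∑ d ∈ (insideEdges n m).filter (fun d => d.tgt = t),
      closedSign ω d.tgt * (s.1 d.primal * s.2 d.dual : ℤˣ) =
      ∑ d ∈ (insideEdges n m).filter (fun d => d.tgt = t),
        closedSign ω t * (s.1 d.primal * s.2 d.dual : ℤˣ) :=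
    Finset.sum_congr rfl fun d hd => by rw [(Finset.mem_filter.1 hd).2]
  have hiB : i ∉ boxB n m := fun hb => htE (mem_boxE_iff.2 ⟨i, hb, hi⟩)
  have hjB : j ∉ boxB n m := fun hb => htE (mem_boxE_iff.2 ⟨j, hb, hj⟩)
  have hsi := hbc.1 i hiB
  have hsj := hbc.1 j hjB
  have hsv := hbc.2 v hvB
  have h56 := isType56_iff (s := s) hi hj hall hu hv hall'
  rw [h5, h4, if_congr h56 rfl rfl, hsi, hsj, hsv]
  have hi2 := i.2
  have hj2 := j.2
  have hv2 := v.2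
  have hu2 := u.2
  simp only [IsPrimal, IsDual, Int.even_iff, Int.odd_iff] at hi2 hj2 hv2 hu2
  rw [inB'_iff] at huB hvB
  have hij' : i.1.1 ≠ j.1.1 ∨ i.1.2 ≠ j.1.2 := by
    by_contra! h'
    exact hij (Subtype.ext (Prod.ext h'.1 h'.2))
  rw [isCorner_iff] at hi hj hu hv
  by_cases hl : t.1.2 = -1
  · rw [if_pos hl]
    have h7 : (dobrushinSign i.1 : ℤ) + dobrushinSign j.1 = 0 := by
      rcases lt_or_ge i.1.2 0 with h0 | h0
      · rw [dobrushinSign_of_neg h0, dobrushinSign_of_nonneg (v := j.1) (by omega)]; simp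
      · rw [dobrushinSign_of_nonneg h0, dobrushinSign_of_neg (v := j.1) (by omega)]; simp
    rw [if_neg]
    · push_cast
      linear_combination (closedSign ω t * (s.2 u : ℤ)) * h7
    · rintro ⟨h8, -⟩
      rw [h8] at h7
      have := units_cases (dobrushinSign j.1)
      omega
  · rw [if_neg hl, closedSign, if_pos (h.open_of htE hl)]
    have h7 : dobrushinSign j.1 = dobrushinSign i.1 ∧ dobrushinSign v.1 = dobrushinSign i.1 := by
      rcases lt_or_ge i.1.2 0 with h0 | h0
      · rw [dobrushinSign_of_neg h0, dobrushinSign_of_neg (v := j.1) (by omega),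
          dobrushinSign_of_neg (v := v.1) (by omega)]
        exact ⟨rfl, rfl⟩
      · rw [dobrushinSign_of_nonneg h0, dobrushinSign_of_nonneg (v := j.1) (by omega),
          dobrushinSign_of_nonneg (v := v.1) (by omega)]
        exact ⟨rfl, rfl⟩
    rw [h7.1, h7.2]
    generalize dobrushinSign i.1 = a
    generalize s.2 u = b
    rcases Int.units_eq_one_or a with rfl | rfl <;> rcases Int.units_eq_one_or b with rfl | rfl <;>
      simp

theorem Admissible.not_onLoop_path (h : Admissible n m ω) {s : SpinPair} (hc : Compatible ω s)
    (hbc : DobrushinBC n m s) (b : Bool) {d : DirEdge} (hd : d ∈ pathEdges n m ω b) :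
    d ∈ orientationOf s := by
  obtain ⟨-, hl, hL, -⟩ := mem_pathEdges.1 hd
  by_contra hdo
  have h1 : d.rev ∈ orientationOf s := by
    by_contra h'
    exact hdo ((orientationOf_rev s d).2 h')
  have h2 := (h.orientationOf_outside hc hbc h1).2 (by rwa [onLoop_rev])
  exact (h.leftward_rev hl).1 h2 hL

open Classical in
/-- The numbers of clockwise and counter-clockwise loops, in terms of the tiles. -/
theorem Admissible.sum_loops_eq (h : Admissible n m ω) {s : SpinPair} (hc : Compatible ω s)
    (hbc : DobrushinBC n m s) :
    ∑ l ∈ insideLoops n m ω, (if ClockwiseLoop ω (orientationOf s) l then (-8 : ℤ) else 8) =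
      ∑ t ∈ edgeTiles n m,
        (if IsType56 s t then 4 * closedSign ω t * (tileSign s t : ℤ) else 0) +
      ∑ t ∈ outerTiles n m, ((if t.1.2 = -1 then 0 else 2) - if IsType56 s t then 4 else 0) := by
  rw [← h.sum_signed_turn (orientationOf_rev s) hc.orientationOf_step
    fun b => Or.inl fun d => h.not_onLoop_path hc hbc b]
  have h1 : ∀ d : DirEdge, (if d ∈ orientationOf s then (1 : ℤ) else -1) * turn ω d =
      closedSign ω d.tgt * (s.1 d.primal * s.2 d.dual : ℤˣ) := by
    intro d
    have h2 : d ∈ orientationOf s ↔ (d.PL ↔ s.1 d.primal = s.2 d.dual) := Iff.rfl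
    rw [turn_eq, closedSign, if_congr h2 rfl rfl]
    generalize s.1 d.primal = a
    generalize s.2 d.dual = b
    by_cases hp : d.PL <;> rcases Int.units_eq_one_or a with rfl | rfl <;>
      rcases Int.units_eq_one_or b with rfl | rfl <;> cases ω d.tgt <;> simp [hp]
  simp only [h1]
  rw [sum_insideEdges]
  congr 1
  · exact Finset.sum_congr rfl fun t ht => sum_tile_of_edge hc.iceRule ht
  · exact Finset.sum_congr rfl fun t ht => h.sum_tile_of_outer hbc ht

end

/-! ### Summation over configurations -/

open Classical in
/-- The configuration that equals `η` on the edges of the graph and `wiredWired` elsewhere. -/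
def extendConfig (n m : ℕ) (η : edgeTiles n m → Bool) : Config :=
  fun t => if h : t ∈ edgeTiles n m then η ⟨t, h⟩ else wiredWired t

theorem extendConfig_of_mem {n m : ℕ} (η : edgeTiles n m → Bool) (t : edgeTiles n m) :
    extendConfig n m η t.1 = η t := by
  rw [extendConfig, dif_pos t.2]

theorem extendConfig_of_not_mem {n m : ℕ} (η : edgeTiles n m → Bool) {t : Tile}
    (h : t ∉ edgeTiles n m) : extendConfig n m η t = wiredWired t := by
  rw [extendConfig, dif_neg h]

theorem extendConfig_injective (n m : ℕ) : Function.Injective (extendConfig n m) := fun η η' h => by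
  funext t
  rw [← extendConfig_of_mem η, h, extendConfig_of_mem]

theorem exists_extendConfig_eq {n m : ℕ} {ω : Config}
    (h : ∀ t, t ∉ boxE n m → ω t = wiredWired t) : ∃ η, extendConfig n m η = ω := by
  refine ⟨fun t => ω t.1, funext fun t => ?_⟩
  by_cases ht : t ∈ edgeTiles n m
  · exact extendConfig_of_mem _ ⟨t, ht⟩
  · rw [extendConfig_of_not_mem _ ht, h t (mt mem_edgeTiles.2 ht)]

/-- The configurations that satisfy the wired-wired boundary condition. -/
def boundaryConfigs (n m : ℕ) : Finset Config :=
  Finset.univ.map ⟨extendConfig n m, extendConfig_injective n m⟩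

theorem mem_boundaryConfigs {n m : ℕ} {ω : Config} :
    ω ∈ boundaryConfigs n m ↔ ∀ t, t ∉ boxE n m → ω t = wiredWired t := by
  rw [boundaryConfigs, Finset.mem_map]
  constructor
  · rintro ⟨η, -, rfl⟩ t ht
    exact extendConfig_of_not_mem η (mt mem_edgeTiles.1 ht)
  · intro h
    obtain ⟨η, rfl⟩ := exists_extendConfig_eq h
    exact ⟨η, Finset.mem_univ _, rfl⟩

/-- The state `b` of the tile `t` is compatible with the spins `s`. -/
def CompatibleAt (s : SpinPair) (t : Tile) (b : Bool) : Prop :=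
  (b = true → ∀ i j : Primal, IsCorner i.1 t.1 → IsCorner j.1 t.1 → s.1 i = s.1 j) ∧
    (b = false → ∀ u v : Dual, IsCorner u.1 t.1 → IsCorner v.1 t.1 → s.2 u = s.2 v)

/-- An outside open edge stays in one half-plane. At an outside closed edge the primal spins are
opposite, so the ice rule forces the dual ones to agree. -/
theorem compatibleAt_wiredWired {n m : ℕ} {s : SpinPair} (hbc : DobrushinBC n m s)
    (hice : IceRule s) {t : Tile} (ht : t ∉ boxE n m) : CompatibleAt s t (wiredWired t) := by
  have hB : ∀ i : Primal, IsCorner i.1 t.1 → i ∉ boxB n m := fun i hi hb =>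
    ht (mem_boxE_iff.2 ⟨i, hb, hi⟩)
  have ht2 := t.2
  rw [Int.odd_iff] at ht2
  constructor
  · intro hw i j hi hj
    rw [wiredWired_eq_true_iff] at hw
    rw [hbc.1 i (hB i hi), hbc.1 j (hB j hj)]
    have hi2 := i.2
    have hj2 := j.2
    simp only [IsPrimal, Int.even_iff] at hi2 hj2
    rw [isCorner_iff] at hi hj
    rcases lt_or_ge i.1.2 0 with h0 | h0
    · rw [dobrushinSign_of_neg h0, dobrushinSign_of_neg (v := j.1) (by omega)]
    · rw [dobrushinSign_of_nonneg h0, dobrushinSign_of_nonneg (v := j.1) (by omega)]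
  · intro hw u v hu hv
    have hl : t.1.2 = -1 := by
      by_contra h
      rw [(wiredWired_eq_true_iff t).2 h] at hw
      cases hw
    obtain ⟨i, j, hi, hj, hx, hy, hij, -⟩ := exists_primal_corners t
    have h1 := hice t i j u v hi hj hu hv
    rw [hbc.1 i (hB i hi), hbc.1 j (hB j hj)] at h1
    have hi2 := i.2
    have hj2 := j.2
    simp only [IsPrimal, Int.even_iff] at hi2 hj2
    rw [isCorner_iff] at hi hj
    have h2 : (s.2 u : ℤ) - s.2 v = 0 := by
      refine (mul_eq_zero.1 h1).resolve_left ?_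
      rcases lt_or_ge i.1.2 0 with h0 | h0
      · rw [dobrushinSign_of_neg h0, dobrushinSign_of_nonneg (v := j.1) (by omega)]; decide
      · rw [dobrushinSign_of_nonneg h0, dobrushinSign_of_neg (v := j.1) (by omega)]; decide
    exact Units.ext (sub_eq_zero.1 h2)

/-- Compatible spins are constant on clusters and differ on the two parts of the boundary, so the
disconnection event imposes nothing further in the sum over configurations. -/
theorem admissible_of_compatible {n m : ℕ} {ω : Config} {s : SpinPair} (hbc : DobrushinBC n m s)
    (hω : ∀ t, t ∉ boxE n m → ω t = wiredWired t) (hc : Compatible ω s) : Admissible n m ω := by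
  refine ⟨hω, fun i hi j hj hr => ?_⟩
  have h1 := hc.reachable hr
  rw [hbc.1 i hi.1.1, hbc.1 j hj.1.1, dobrushinSign_of_nonneg hi.2, dobrushinSign_of_neg hj.2] at h1
  exact absurd h1 (by decide)

theorem compatible_extendConfig_iff {n m : ℕ} {s : SpinPair} (hbc : DobrushinBC n m s)
    (hice : IceRule s) (η : edgeTiles n m → Bool) :
    Compatible (extendConfig n m η) s ↔ ∀ t : edgeTiles n m, CompatibleAt s t.1 (η t) := by
  constructor
  · intro h t
    rw [← extendConfig_of_mem η t]
    exact h t.1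
  · intro h t
    change CompatibleAt s t _
    by_cases ht : t ∈ edgeTiles n m
    · rw [extendConfig_of_mem η ⟨t, ht⟩]
      exact h ⟨t, ht⟩
    · rw [extendConfig_of_not_mem η ht]
      exact compatibleAt_wiredWired hbc hice (mt mem_edgeTiles.2 ht)

/-- At the critical parameter p/(1 - p) = √q, so open edges and clusters are weighted by powers of
the same number, as the Euler relation requires. -/
theorem fkWeight_eq {n m : ℕ} {q : ℝ} (hq : 0 < q) {ω : Config}
    (hω : ∀ t, t ∉ boxE n m → ω t = wiredWired t) :
    fkWeight (boxV n m) (boxE n m) wiredWired (criticalP q) q ω =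
      ((1 + √q) ^ (edgeTiles n m).card)⁻¹ *
        √q ^ (((edgeTiles n m).filter (fun t => ω t = true)).card + 2 * numClusters (boxV n m) ω) := by
  rw [fkWeight, if_pos hω]
  have h1 : {t | t ∈ boxE n m ∧ ω t = true}.ncard =
      ((edgeTiles n m).filter (fun t => ω t = true)).card := by
    rw [← Set.ncard_coe_finset]
    congr 1
    ext t
    simp [mem_edgeTiles]
  have h2 : {t | t ∈ boxE n m ∧ ω t = false}.ncard =
      ((edgeTiles n m).filter (fun t => ¬ ω t = true)).card := by
    rw [← Set.ncard_coe_finset]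
    congr 1
    ext t
    simp [mem_edgeTiles]
  have h3 := Finset.card_filter_add_card_filter_not (s := edgeTiles n m) (fun t => ω t = true)
  have h4 : 0 < √q := Real.sqrt_pos.2 hq
  have h5 : 1 - criticalP q = (1 + √q)⁻¹ := by
    unfold criticalP
    field_simp
    ring
  rw [h1, h2, h5, ← h3, pow_add (√q), pow_mul, Real.sq_sqrt hq.le, criticalP, div_eq_mul_inv,
    mul_pow, pow_add, mul_inv, inv_pow, inv_pow]
  ring

open Classical in
/-- The probability weight of the orientations of the loops of `ω` prescribed by `s`. -/
def loopWeight (n m : ℕ) (r : ℝ) (ω : Config) (s : SpinPair) : ℝ :=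
  ∏ l ∈ insideLoops n m ω, if ClockwiseLoop ω (orientationOf s) l then r else 1 - r

open Classical in
/-- The contribution of a tile of the graph in the state `b`. -/
def tileWeight (lam : ℝ) (s : SpinPair) (t : Tile) (b : Bool) : ℝ :=
  if IsType56 s t then Real.exp (-(lam / 2) * ((if b then -1 else 1) * ((tileSign s t : ℤ) : ℝ)))
    else 1

/-! ### The joint weight and its factorisation over tiles. -/

section

variable {q lam : ℝ} {n m : ℕ}

/-- A clockwise loop weighs exp(λ)/√q and a counter-clockwise one exp(-λ)/√q, that is exp(-λ/8 ·
x)/√q with x = -8 or 8. The sum of these x is local by `Admissible.sum_loops_eq`. -/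
theorem loopWeight_eq (hq : 0 < q) (hqlam : √q = Real.exp lam + Real.exp (-lam)) {ω : Config} {s : SpinPair} (h : Admissible n m ω) (hc : Compatible ω s)
    (hbc : DobrushinBC n m s) : loopWeight n m (Real.exp lam / √q) ω s =
      (√q ^ (insideLoops n m ω).card)⁻¹ *
        ((∏ t ∈ outerTiles n m, Real.exp (-(lam / 8) * (if t.1.2 = -1 then 0 else 2))) *
          Real.exp (lam / 2) ^ {t | t ∈ boundaryTiles n m ∧ IsType56 s t}.ncard *
          ∏ t ∈ edgeTiles n m, tileWeight lam s t (ω t)) := by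
  classical
  have h4 : 0 < √q := Real.sqrt_pos.2 hq
  have h1 : loopWeight n m (Real.exp lam / √q) ω s = ∏ l ∈ insideLoops n m ω, ((√q)⁻¹ *
      Real.exp (-(lam / 8) *
        ((if ClockwiseLoop ω (orientationOf s) l then (-8 : ℤ) else 8 : ℤ) : ℝ))) := by
    refine Finset.prod_congr rfl fun l _ => ?_
    split_ifs
    · rw [show -(lam / 8) * ((-8 : ℤ) : ℝ) = lam by push_cast; ring]; field_simp
    · rw [show -(lam / 8) * ((8 : ℤ) : ℝ) = -lam by push_cast; ring]
      field_simp
      linarith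
  have h2 : {t | t ∈ boundaryTiles n m ∧ IsType56 s t}.ncard =
      ((outerTiles n m).filter (IsType56 s)).card := by
    rw [← Set.ncard_coe_finset]
    congr 1
    ext t
    simp [mem_boundaryTiles_iff]
  rw [h1, Finset.prod_mul_distrib, Finset.prod_const, inv_pow, ← Real.exp_sum, ← Finset.mul_sum,
    ← Int.cast_sum, h.sum_loops_eq hc hbc, h2, Int.cast_add, mul_add, Real.exp_add, Int.cast_sum,
    Int.cast_sum, Finset.mul_sum, Finset.mul_sum, Real.exp_sum, Real.exp_sum, mul_comm (∏ t ∈ edgeTiles n m, _)]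
  congr 2
  · rw [← Finset.prod_const, Finset.prod_filter, ← Finset.prod_mul_distrib]
    refine Finset.prod_congr rfl fun t _ => ?_
    split_ifs <;> simp <;> (try rw [← Real.exp_add]) <;> ring_nf
  · refine Finset.prod_congr rfl fun t _ => ?_
    unfold tileWeight closedSign
    split_ifs <;> simp <;> ring_nf

-- For type 5 or 6 both states are compatible, with opposite exponents, so the sign of the tile does
-- not matter for the sum. Otherwise exactly one state is compatible.
open Classical in
theorem sum_tileWeight (s : SpinPair) (hs : IceRule s) (t : Tile) :
    ∑ b : Bool, (if CompatibleAt s t b then tileWeight lam s t b else 0) =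
      if IsType56 s t then Real.exp (lam / 2) + Real.exp (-lam / 2) else 1 := by
  obtain ⟨i, j, hi, hj, -, -, hij, hall⟩ := exists_primal_corners t
  obtain ⟨u, v, hu, hv, -, -, huv, hall'⟩ := exists_dual_corners t
  have h56 := isType56_iff (s := s) hi hj hall hu hv hall'
  have h1 : CompatibleAt s t true ↔ s.1 i = s.1 j := by
    refine ⟨fun h => h.1 rfl i j hi hj, fun h => ⟨fun _ k l hk hl => ?_, fun h => Bool.noConfusion h⟩⟩
    rcases hall k hk with rfl | rfl <;> rcases hall l hl with rfl | rfl <;> simp [h]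
  have h2 : CompatibleAt s t false ↔ s.2 u = s.2 v := by
    refine ⟨fun h => h.2 rfl u v hu hv, fun h => ⟨fun h => Bool.noConfusion h, fun _ k l hk hl => ?_⟩⟩
    rcases hall' k hk with rfl | rfl <;> rcases hall' l hl with rfl | rfl <;> simp [h]
  have hice : s.1 i = s.1 j ∨ s.2 u = s.2 v := by
    rcases mul_eq_zero.1 (hs t i j u v hi hj hu hv) with h | h
    · exact Or.inl (Units.ext (sub_eq_zero.1 h))
    · exact Or.inr (Units.ext (sub_eq_zero.1 h))
  rw [Fintype.sum_bool, if_congr h1 rfl rfl, if_congr h2 rfl rfl, if_congr h56 rfl rfl]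
  unfold tileWeight
  rw [if_congr h56 rfl rfl, if_congr h56 rfl rfl]
  by_cases h3 : s.1 i = s.1 j <;> by_cases h4 : s.2 u = s.2 v
  · simp only [h3, h4, and_self, if_true]
    rcases Int.units_eq_one_or (tileSign s t) with h5 | h5 <;> rw [h5] <;> simp <;> ring_nf
  · simp [h3, h4]
  · simp [h3, h4]
  · exact absurd hice (by tauto)

open Classical in
/-- Up to a constant, summing the joint weight of the percolation configuration and the loop
orientations over the configurations compatible with given spins yields the six-vertex weight. -/
theorem exists_weight_constant (hq : 0 < q) (hqlam : √q = Real.exp lam + Real.exp (-lam))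
    (n m : ℕ) : ∃ K : ℝ, 0 < K ∧ ∀ s, DobrushinBC n m s →
      ∑ ω ∈ (boundaryConfigs n m).filter (fun ω => Admissible n m ω ∧ Compatible ω s),
        fkWeight (boxV n m) (boxE n m) wiredWired (criticalP q) q ω *
          loopWeight n m (Real.exp lam / √q) ω s =
      K * spinWeight n m (Real.exp (lam / 2) + Real.exp (-lam / 2)) (Real.exp (lam / 2)) s := by
  have h4 : 0 < √q := Real.sqrt_pos.2 hq
  obtain ⟨C, hC⟩ := exists_euler_constant n m
  set K1 : ℝ := ∏ t ∈ outerTiles n m, Real.exp (-(lam / 8) * (if t.1.2 = -1 then 0 else 2))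
  have hK1 : 0 < K1 := Finset.prod_pos fun t _ => Real.exp_pos _
  -- C/8 is the exponent of √q left over after the Euler relation; it enters as a real power, so its
  -- divisibility plays no role.
  set K0 : ℝ := ((1 + √q) ^ (edgeTiles n m).card)⁻¹ * √q ^ ((C : ℝ) / 8)
  refine ⟨K0 * K1, by positivity, fun s hbc => ?_⟩
  by_cases hice : IceRule s
  swap
  · rw [spinWeight, if_neg fun h => hice h.2, mul_zero]
    refine Finset.sum_eq_zero fun ω hω => ?_
    exact absurd (Finset.mem_filter.1 hω).2.2.iceRule hice
  set cb := Real.exp (lam / 2) ^ {t | t ∈ boundaryTiles n m ∧ IsType56 s t}.ncard with hcb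
  have hterm : ∀ ω, Admissible n m ω → Compatible ω s →
      fkWeight (boxV n m) (boxE n m) wiredWired (criticalP q) q ω *
        loopWeight n m (Real.exp lam / √q) ω s =
      K0 * K1 * cb * ∏ t : edgeTiles n m, tileWeight lam s t.1 (ω t.1) := by
    intro ω ha hc
    rw [fkWeight_eq hq ha.1, loopWeight_eq hq hqlam ha hc hbc,
      Finset.prod_coe_sort (edgeTiles n m) fun t => tileWeight lam s t (ω t)]
    have h5 : √q ^ (((edgeTiles n m).filter (fun t => ω t = true)).card +
        2 * numClusters (boxV n m) ω) =
        √q ^ (insideLoops n m ω).card * √q ^ ((C : ℝ) / 8) := by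
      rw [← Real.rpow_natCast, ← Real.rpow_natCast, ← Real.rpow_add h4]
      congr 1
      have h6 := hC ω ha
      have h7 : (8 * (((edgeTiles n m).filter (fun t => ω t = true)).card : ℝ) +
        16 * (numClusters (boxV n m) ω : ℝ)) = 8 * ((insideLoops n m ω).card : ℝ) + C := by
        exact_mod_cast h6
      push_cast
      linarith
    rw [h5]
    have h8 : √q ^ (insideLoops n m ω).card ≠ 0 := by positivity
    simp only [K0]
    linear_combination (((1 + √q) ^ (edgeTiles n m).card)⁻¹ * √q ^ ((C : ℝ) / 8) * K1 * cb *
      ∏ t ∈ edgeTiles n m, tileWeight lam s t (ω t)) * mul_inv_cancel₀ h8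
  have hsum : ∑ ω ∈ (boundaryConfigs n m).filter (fun ω => Admissible n m ω ∧ Compatible ω s),
        fkWeight (boxV n m) (boxE n m) wiredWired (criticalP q) q ω *
          loopWeight n m (Real.exp lam / √q) ω s =
      ∑ η : edgeTiles n m → Bool, K0 * K1 * cb *
        ∏ t : edgeTiles n m, (if CompatibleAt s t.1 (η t) then tileWeight lam s t.1 (η t) else 0) := by
    rw [Finset.sum_filter, boundaryConfigs, Finset.sum_map]
    refine Finset.sum_congr rfl fun η _ => ?_
    rw [Finset.prod_ite_zero]
    have hiff := compatible_extendConfig_iff hbc hice η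
    have hb : ∀ t, t ∉ boxE n m → extendConfig n m η t = wiredWired t := fun t ht =>
      extendConfig_of_not_mem η (mt mem_edgeTiles.1 ht)
    change (if Admissible n m (extendConfig n m η) ∧ Compatible (extendConfig n m η) s then
      fkWeight (boxV n m) (boxE n m) wiredWired (criticalP q) q (extendConfig n m η) *
          loopWeight n m (Real.exp lam / √q) (extendConfig n m η) s else 0) = _
    by_cases hc : Compatible (extendConfig n m η) s
    · have ha := admissible_of_compatible hbc hb hc
      rw [if_pos ⟨ha, hc⟩, if_pos fun t _ => hiff.1 hc t, hterm _ ha hc]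
      simp only [extendConfig_of_mem]
    · rw [if_neg fun h => hc h.2, if_neg fun h => hc (hiff.2 fun t => h t (Finset.mem_univ _)),
        mul_zero]
  rw [hsum, ← Finset.mul_sum]
  -- The sum over all states of the edges of a product over edges is the product of the sums over
  -- two states.
  have hprod := Finset.prod_univ_sum (fun _ : edgeTiles n m => (Finset.univ : Finset Bool))
    fun t b => if CompatibleAt s t.1 b then tileWeight lam s t.1 b else 0
  rw [Fintype.piFinset_univ] at hprod
  rw [← hprod]
  simp only [sum_tileWeight s hice]
  rw [Finset.prod_coe_sort (edgeTiles n m) fun t =>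
    if IsType56 s t then Real.exp (lam / 2) + Real.exp (-lam / 2) else 1, ← Finset.prod_filter,
    Finset.prod_const, spinWeight, if_pos ⟨hbc, hice⟩]
  have h2 : {t | t ∈ interiorTiles n m ∧ IsType56 s t}.ncard =
      ((edgeTiles n m).filter (IsType56 s)).card := by
    rw [← Set.ncard_coe_finset]
    congr 1
    ext t
    simp [mem_interiorTiles_iff]
  rw [h2]
  ring

end

/-! ### Measures with finite support -/

section

variable {X : Type*} [MeasurableSpace X]

theorem measure_eq_sum_smul_dirac [MeasurableSingletonClass X] (μ : Measure X) (F : Finset X) (h : μ (↑F)ᶜ = 0) :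
    μ = ∑ x ∈ F, μ {x} • Measure.dirac x := by
  classical
  ext A hA
  rw [Measure.finsetSum_apply, ← measure_inter_conull h]
  have h1 : A ∩ ↑F = ↑(F.filter (· ∈ A)) := by
    ext x; simp [and_comm]
  rw [h1, ← sum_measure_singleton, Finset.sum_filter]
  refine Finset.sum_congr rfl fun x _ => ?_
  rw [Measure.smul_apply, Measure.dirac_apply' _ hA, smul_eq_mul, Set.indicator_apply]
  split_ifs <;> simp

theorem proportionalTo_eq {w : X → ℝ} {F : Finset X} (h : ∀ x, x ∉ F → w x = 0) :
    proportionalTo w =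
      (∑ x ∈ F, ENNReal.ofReal (w x))⁻¹ • ∑ x ∈ F, ENNReal.ofReal (w x) • Measure.dirac x := by
  have h0 : ∀ x, x ∉ F → ENNReal.ofReal (w x) = 0 := fun x hx => by rw [h x hx, ENNReal.ofReal_zero]
  rw [proportionalTo, tsum_eq_sum h0]
  congr 1
  ext A hA
  rw [Measure.sum_apply _ hA, Measure.finsetSum_apply, tsum_eq_sum]
  intro x hx
  rw [h0 x hx, zero_smul, Measure.coe_zero, Pi.zero_apply]

theorem proportionalTo_singleton [MeasurableSingletonClass X] {w : X → ℝ} {F : Finset X} (h : ∀ x, x ∉ F → w x = 0) (x : X) :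
    proportionalTo w {x} = (∑ x ∈ F, ENNReal.ofReal (w x))⁻¹ * ENNReal.ofReal (w x) := by
  rw [proportionalTo_eq h, Measure.smul_apply, Measure.finsetSum_apply, smul_eq_mul]
  congr 1
  rw [Finset.sum_eq_single x]
  · simp
  · intro y _ hy
    simp [hy]
  · intro hx
    simp [h x hx]

theorem proportionalTo_compl [MeasurableSingletonClass X] {w : X → ℝ} {F : Finset X} (h : ∀ x, x ∉ F → w x = 0) :
    proportionalTo w (↑F)ᶜ = 0 := by
  rw [proportionalTo_eq h, Measure.smul_apply, Measure.finsetSum_apply, smul_eq_mul]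
  refine mul_eq_zero_of_right _ (Finset.sum_eq_zero fun x hx => ?_)
  simp [hx]

theorem isProbabilityMeasure_proportionalTo {w : X → ℝ} {F : Finset X}
    (h : ∀ x, x ∉ F → w x = 0) {x : X} (hx : 0 < w x) : IsProbabilityMeasure (proportionalTo w) := by
  have hxF : x ∈ F := by
    by_contra hn
    exact hx.ne' (h x hn)
  refine ⟨?_⟩
  rw [proportionalTo_eq h, Measure.smul_apply, Measure.finsetSum_apply, smul_eq_mul]
  simp only [Measure.smul_apply, measure_univ, smul_eq_mul, mul_one]
  refine ENNReal.inv_mul_cancel ?_ ?_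
  · intro h0
    rw [Finset.sum_eq_zero_iff] at h0
    have := h0 x hxF
    rw [ENNReal.ofReal_eq_zero] at this
    linarith
  · exact ENNReal.sum_ne_top.2 fun _ _ => ENNReal.ofReal_ne_top

end

/-- On a finite support, proportionality of the point masses determines the law, since both total
masses are one. Only null-measurability of the fibres is needed, as the spins are specified merely
almost surely. -/
theorem hasLaw_proportionalTo {X : Type*} [MeasurableSpace X] [MeasurableSingletonClass X]
    [MeasurableSpace.CountablyGenerated X] {Ω : Type*} [MeasurableSpace Ω] {P : Measure Ω}
    [IsProbabilityMeasure P] {σ : Ω → X} {F : Finset X} (hF : ∀ᵐ x ∂P, σ x ∈ F)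
    (hnull : ∀ s ∈ F, NullMeasurableSet (σ ⁻¹' {s}) P) {w : X → ℝ} (hw : ∀ s, s ∉ F → w s = 0)
    {K : ENNReal} (hK : ∀ s ∈ F, P (σ ⁻¹' {s}) = K * ENNReal.ofReal (w s)) :
    HasLaw σ (proportionalTo w) P := by
  classical
  have hσ : AEMeasurable σ P := by
    refine NullMeasurable.aemeasurable fun A _ => ?_
    have h1 : NullMeasurableSet (⋃ s ∈ F.filter (· ∈ A), σ ⁻¹' {s}) P :=
      Finset.nullMeasurableSet_biUnion _ fun s hs => hnull s (Finset.mem_filter.1 hs).1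
    refine h1.congr ?_
    filter_upwards [hF] with x hx
    apply propext
    change x ∈ (⋃ s ∈ F.filter (· ∈ A), σ ⁻¹' {s}) ↔ σ x ∈ A
    simp [hx]
  refine ⟨hσ, ?_⟩
  have hprob : IsProbabilityMeasure (P.map σ) := Measure.isProbabilityMeasure_map hσ
  have hsingle : ∀ s ∈ F, P.map σ {s} = K * ENNReal.ofReal (w s) := fun s hs => by
    rw [Measure.map_apply_of_aemeasurable hσ (measurableSet_singleton s), hK s hs]
  have hcompl : P.map σ (↑F)ᶜ = 0 := by
    rw [Measure.map_apply_of_aemeasurable hσ F.measurableSet.compl]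
    exact hF
  have h1 := measure_eq_sum_smul_dirac (P.map σ) F hcompl
  -- The proportionality factor is the inverse of the partition function because the image measure
  -- has mass one.
  have htotal : K * ∑ s ∈ F, ENNReal.ofReal (w s) = 1 := by
    rw [Finset.mul_sum, ← Finset.sum_congr rfl hsingle, sum_measure_singleton,
      ← measure_univ (μ := P.map σ), ← Set.univ_inter (F : Set X), measure_inter_conull hcompl]
  rw [h1, proportionalTo_eq hw, ← ENNReal.eq_inv_of_mul_eq_one_left htotal, Finset.smul_sum]
  refine Finset.sum_congr rfl fun s hs => ?_
  rw [hsingle s hs, smul_smul]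

/-! ### The conditioned percolation measure -/

/-- Shows that the conditioning event has positive probability: when all edges between the
half-planes are closed, the two boundary parts are disconnected. -/
theorem wiredWired_admissible (n m : ℕ) : Admissible n m wiredWired := by
  refine ⟨fun _ _ => rfl, fun i hi j hj hr => ?_⟩
  have h : ∀ k, (openGraph wiredWired).Reachable i k → 0 ≤ k.1.2 := by
    intro k hk
    rw [SimpleGraph.reachable_iff_reflTransGen] at hk
    induction hk with
    | refl => exact hi.2
    | tail _ hab ih =>
      obtain ⟨-, t, ht, ha, hb⟩ := hab
      rw [wiredWired_eq_true_iff] at ht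
      rename_i a b _
      have ha2 := a.2
      have hb2 := b.2
      have ht2 := t.2
      simp only [IsPrimal, Int.even_iff, Int.odd_iff] at ha2 hb2 ht2
      rw [isCorner_iff] at ha hb
      omega
  have := h j hr
  have := hj.2
  omega

theorem fkWeight_of_not_mem {n m : ℕ} {q : ℝ} (ω : Config) (h : ω ∉ boundaryConfigs n m) :
    fkWeight (boxV n m) (boxE n m) wiredWired (criticalP q) q ω = 0 := by
  rw [fkWeight, if_neg (mt mem_boundaryConfigs.2 h)]

theorem fkWeight_pos {n m : ℕ} {q : ℝ} (hq : 0 < q) {ω : Config}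
    (hω : ∀ t, t ∉ boxE n m → ω t = wiredWired t) :
    0 < fkWeight (boxV n m) (boxE n m) wiredWired (criticalP q) q ω := by
  rw [fkWeight_eq hq hω]
  have : 0 < √q := Real.sqrt_pos.2 hq
  positivity

open Classical in
/-- The support of the conditioned percolation measure. -/
def admissibleConfigs (n m : ℕ) : Finset Config := (boundaryConfigs n m).filter (Admissible n m)

theorem mem_admissibleConfigs {n m : ℕ} {ω : Config} :
    ω ∈ admissibleConfigs n m ↔ Admissible n m ω := by
  classical
  rw [admissibleConfigs, Finset.mem_filter, mem_boundaryConfigs]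
  exact ⟨And.right, fun h => ⟨h.1, h⟩⟩

section

variable {q : ℝ} (n m : ℕ)

theorem isProbabilityMeasure_fkMeasure (hq : 0 < q) :
    IsProbabilityMeasure (fkMeasure (boxV n m) (boxE n m) wiredWired (criticalP q) q) :=
  isProbabilityMeasure_proportionalTo fkWeight_of_not_mem
    (fkWeight_pos hq (wiredWired_admissible n m).1)

theorem fkMeasure_disconnected_ne_zero (hq : 0 < q) :
    fkMeasure (boxV n m) (boxE n m) wiredWired (criticalP q) q (disconnectedBoundaries n m) ≠ 0 := by
  intro h0
  have h1 := measure_mono_null (Set.singleton_subset_iff.2 (wiredWired_admissible n m).2) h0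
  rw [fkMeasure, proportionalTo_singleton fkWeight_of_not_mem, mul_eq_zero, ENNReal.inv_eq_zero,
    ENNReal.ofReal_eq_zero] at h1
  rcases h1 with h1 | h1
  · exact ENNReal.sum_ne_top.2 (fun _ _ => ENNReal.ofReal_ne_top) h1
  · exact absurd (fkWeight_pos hq (wiredWired_admissible n m).1) (not_lt.2 h1)

theorem isProbabilityMeasure_conditionedFK (hq : 0 < q) :
    IsProbabilityMeasure (conditionedFK n m q) := by
  have := isProbabilityMeasure_fkMeasure n m hq
  exact cond_isProbabilityMeasure (fkMeasure_disconnected_ne_zero n m hq)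

theorem conditionedFK_compl : conditionedFK n m q (↑(admissibleConfigs n m))ᶜ = 0 := by
  rw [conditionedFK, ProbabilityTheory.cond, Measure.smul_apply,
    Measure.restrict_apply (Finset.measurableSet _).compl,
    smul_eq_mul]
  refine mul_eq_zero_of_right _ (measure_mono_null ?_ (proportionalTo_compl fkWeight_of_not_mem))
  intro ω hω hω'
  exact hω.1 (mem_admissibleConfigs.2 ⟨mem_boundaryConfigs.1 hω', hω.2⟩)

theorem conditionedFK_singleton : ∃ K : ENNReal, ∀ ω, Admissible n m ω →
    conditionedFK n m q {ω} =
      K * ENNReal.ofReal (fkWeight (boxV n m) (boxE n m) wiredWired (criticalP q) q ω) := by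
  refine ⟨(fkMeasure (boxV n m) (boxE n m) wiredWired (criticalP q) q
    (disconnectedBoundaries n m))⁻¹ * (∑ ω ∈ boundaryConfigs n m, ENNReal.ofReal
      (fkWeight (boxV n m) (boxE n m) wiredWired (criticalP q) q ω))⁻¹, fun ω hω => ?_⟩
  rw [conditionedFK, ProbabilityTheory.cond, Measure.smul_apply, Measure.restrict_apply (measurableSet_singleton ω),
    Set.inter_eq_left.2 (Set.singleton_subset_iff.2 hω.2), smul_eq_mul, mul_assoc]
  congr 1
  exact proportionalTo_singleton fkWeight_of_not_mem ω

end

/-! ### The law of the spins -/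

instance : DiscreteMeasurableSpace ℤˣ :=
  ⟨fun s => ⟨Units.val '' s, MeasurableSet.of_discrete,
    Set.preimage_image_eq s Units.val_injective⟩⟩

open Classical in
/-- The values of the uniform variables for which `ω` induces the spins `s`. -/
def loopEvent (n m : ℕ) (r : ℝ) (ω : Config) (s : SpinPair) : Set (Loop → unitInterval) :=
  if DobrushinBC n m s ∧ Compatible ω s then
    (↑(insideLoops n m ω) : Set Loop).pi
      fun l => {u | (u : ℝ) < r ↔ ClockwiseLoop ω (orientationOf s) l}
  else ∅

theorem measurableSet_threshold (r : ℝ) (p : Prop) :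
    MeasurableSet {u : unitInterval | (u : ℝ) < r ↔ p} := by
  have h : MeasurableSet {u : unitInterval | (u : ℝ) < r} :=
    measurableSet_lt measurable_subtype_coe measurable_const
  by_cases hp : p
  · simpa [hp] using h
  · simp only [hp, iff_false]
    exact h.compl

open Classical in
theorem volume_threshold {r : ℝ} (h0 : 0 ≤ r) (h1 : r ≤ 1) (p : Prop) :
    volume {u : unitInterval | (u : ℝ) < r ↔ p} = ENNReal.ofReal (if p then r else 1 - r) := by
  have h : {u : unitInterval | (u : ℝ) < r} = Set.Iio ⟨r, h0, h1⟩ := rfl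
  by_cases hp : p
  · simp only [hp, iff_true, if_true]
    rw [h, unitInterval.volume_Iio]
  · simp only [hp, iff_false, if_false]
    have h' : {u : unitInterval | ¬ (u : ℝ) < r} = Set.Ici ⟨r, h0, h1⟩ := by
      ext u; simp [← Subtype.coe_le_coe]
    rw [h', unitInterval.volume_Ici]

theorem mem_loopEvent_iff {n m : ℕ} {ω : Config} (h : Admissible n m ω) (r : ℝ)
    (U : Loop → unitInterval) (s : SpinPair) :
    U ∈ loopEvent n m r ω s ↔ IsInducedSpin n m r ω U s := by
  rw [h.isInducedSpin_iff, loopEvent]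
  split_ifs with hs
  · rw [Set.mem_pi]
    constructor
    · intro hU
      refine ⟨hs.1, hs.2, fun d hd hl hu => ?_⟩
      have := hU _ (mem_insideLoops.2 ⟨d, hl, hu, rfl⟩)
      rwa [Set.mem_ofPred_eq,
        clockwiseLoop_loopOf (orientationOf_rev s) hs.2.orientationOf_step hl hd] at this
    · rintro ⟨-, -, hU⟩ l hl
      obtain ⟨d, hdo, hd, hu, rfl⟩ := exists_mem_of_mem_insideLoops (orientationOf_rev s) hl
      rw [Set.mem_ofPred_eq,
        clockwiseLoop_loopOf (orientationOf_rev s) hs.2.orientationOf_step hd hdo]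
      exact hU d hdo hd hu
  · exact iff_of_false (Set.notMem_empty U) fun h' => hs ⟨h'.1, h'.2.1⟩

theorem measurableSet_loopEvent (n m : ℕ) (r : ℝ) (ω : Config) (s : SpinPair) :
    MeasurableSet (loopEvent n m r ω s) := by
  rw [loopEvent]
  split_ifs
  · exact MeasurableSet.pi (Finset.countable_toSet _) fun l _ => measurableSet_threshold r _
  · exact MeasurableSet.empty

open Classical in
theorem infinitePi_loopEvent {r : ℝ} (h0 : 0 ≤ r) (h1 : r ≤ 1) (n m : ℕ) (ω : Config)
    (s : SpinPair) :
    Measure.infinitePi (fun _ : Loop => (volume : Measure unitInterval)) (loopEvent n m r ω s) =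
      if DobrushinBC n m s ∧ Compatible ω s then ENNReal.ofReal (loopWeight n m r ω s) else 0 := by
  rw [loopEvent]
  split_ifs
  · rw [Measure.infinitePi_pi _ fun l _ => measurableSet_threshold r _, loopWeight,
      ENNReal.ofReal_prod_of_nonneg]
    · exact Finset.prod_congr rfl fun l _ => volume_threshold h0 h1 _
    · intro l _
      split_ifs <;> linarith
  · exact measure_empty

/-- The event that the percolation configuration and the uniform variables induce `s`. -/
def spinEvent (n m : ℕ) (r : ℝ) (s : SpinPair) :
    Set (Config × (Loop → unitInterval) × (Tile → unitInterval)) :=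
  ⋃ ω ∈ admissibleConfigs n m, {ω} ×ˢ loopEvent n m r ω s ×ˢ Set.univ

theorem mem_spinEvent_iff {n m : ℕ} {ω : Config} (h : Admissible n m ω) (r : ℝ)
    (U : Loop → unitInterval) (U' : Tile → unitInterval) (s : SpinPair) :
    (ω, U, U') ∈ spinEvent n m r s ↔ IsInducedSpin n m r ω U s := by
  rw [← mem_loopEvent_iff h]
  simp only [spinEvent, Set.mem_iUnion, Set.mem_prod, Set.mem_singleton_iff, Set.mem_univ, and_true]
  constructor
  · rintro ⟨ω', -, rfl, hU⟩
    exact hU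
  · exact fun hU => ⟨ω, mem_admissibleConfigs.2 h, rfl, hU⟩

theorem measurableSet_spinEvent (n m : ℕ) (r : ℝ) (s : SpinPair) :
    MeasurableSet (spinEvent n m r s) :=
  Finset.measurableSet_biUnion _ fun ω _ => (measurableSet_singleton ω).prod
    ((measurableSet_loopEvent n m r ω s).prod MeasurableSet.univ)

-- The constant comes from the normalisations of the percolation measure and of the conditioning, so
-- it does not depend on the spins.
open Classical in
theorem couplingMeasure_spinEvent {q r : ℝ} (hq : 0 < q) (h0 : 0 ≤ r) (h1 : r ≤ 1) (n m : ℕ) :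
    ∃ K : ENNReal, ∀ s, DobrushinBC n m s → couplingMeasure n m q (spinEvent n m r s) =
      K * ENNReal.ofReal (∑ ω ∈ (boundaryConfigs n m).filter
        (fun ω => Admissible n m ω ∧ Compatible ω s),
        fkWeight (boxV n m) (boxE n m) wiredWired (criticalP q) q ω * loopWeight n m r ω s) := by
  have := isProbabilityMeasure_conditionedFK n m hq
  obtain ⟨K, hK⟩ := conditionedFK_singleton (q := q) n m
  refine ⟨K, fun s hs => ?_⟩
  have hlw : ∀ ω, 0 ≤ loopWeight n m r ω s := fun ω => Finset.prod_nonneg fun l _ => by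
    split_ifs <;> linarith
  have hfk : ∀ ω, Admissible n m ω →
      0 ≤ fkWeight (boxV n m) (boxE n m) wiredWired (criticalP q) q ω := fun ω h =>
    (fkWeight_pos hq h.1).le
  rw [spinEvent, measure_biUnion_finset]
  · rw [ENNReal.ofReal_sum_of_nonneg fun ω hω =>
      mul_nonneg (hfk ω (Finset.mem_filter.1 hω).2.1) (hlw ω), ← Finset.filter_filter,
      Finset.sum_filter, Finset.mul_sum]
    refine Finset.sum_congr rfl fun ω hω => ?_
    have hω := mem_admissibleConfigs.1 hω
    rw [couplingMeasure, Measure.prod_prod, Measure.prod_prod, measure_univ, mul_one, hK ω hω,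
      infinitePi_loopEvent h0 h1]
    by_cases hc : Compatible ω s
    · rw [if_pos ⟨hs, hc⟩, if_pos hc, ENNReal.ofReal_mul (hfk ω hω), mul_assoc]
    · rw [if_neg fun h => hc h.2, if_neg hc, mul_zero, mul_zero]
  · intro ω _ ω' _ hne
    rw [Function.onFun, Set.disjoint_left]
    rintro x ⟨hx, -⟩ ⟨hx', -⟩
    exact hne (hx.symm.trans hx')
  · exact fun ω _ => (measurableSet_singleton ω).prod
      ((measurableSet_loopEvent n m r ω s).prod MeasurableSet.univ)

theorem finite_dobrushinBC (n m : ℕ) : {s : SpinPair | DobrushinBC n m s}.Finite := by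
  have h1 := (finite_boxB n m).to_subtype
  have h2 := (finite_inB' n m).to_subtype
  refine Set.Finite.of_injOn (f := fun s : SpinPair =>
    ((fun i : boxB n m => s.1 i.1), fun u : {u : Dual | InB' n m u.1} => s.2 u.1))
    (t := Set.univ) (fun _ _ => Set.mem_univ _) ?_ Set.finite_univ
  intro s hs s' hs' h
  refine Prod.ext (funext fun i => ?_) (funext fun u => ?_)
  · by_cases hi : i ∈ boxB n m
    · exact congrFun (congrArg Prod.fst h) ⟨i, hi⟩
    · rw [hs.1 i hi, hs'.1 i hi]
  · by_cases hu : InB' n m u.1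
    · exact congrFun (congrArg Prod.snd h) ⟨u, hu⟩
    · rw [hs.2 u hu, hs'.2 u hu]

end
end BKW

theorem mainTheorem8 (q lam : ℝ) (hq : 4 < q) (hlam : 0 < lam)
    (hqlam : √q = Real.exp lam + Real.exp (-lam)) (n m : ℕ)
    {Ω : Type*} [MeasurableSpace Ω] (P : Measure Ω)
    (ω : Ω → Config) (U : Ω → Loop → unitInterval) (U' : Ω → Tile → unitInterval)
    (hlaw : HasLaw (fun x => (ω x, U x, U' x)) (couplingMeasure n m q) P) :
    (∀ᵐ x ∂P, ∃! o : Set DirEdge, IsOrientedBy n m (Real.exp lam / √q) (ω x) (U x) o) ∧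
    (∀ᵐ x ∂P, ∃! σ : SpinPair, IsInducedSpin n m (Real.exp lam / √q) (ω x) (U x) σ) ∧
    ∀ σ : Ω → SpinPair,
      (∀ᵐ x ∂P, IsInducedSpin n m (Real.exp lam / √q) (ω x) (U x) (σ x)) →
      HasLaw σ
        (spinMeasure n m (Real.exp (lam / 2) + Real.exp (-lam / 2)) (Real.exp (lam / 2))) P := by
  have hq0 : 0 < q := by linarith
  have hsqrt : 0 < √q := Real.sqrt_pos.2 hq0
  set r := Real.exp lam / √q with hr
  have hr0 : 0 ≤ r := by positivity
  have hr1 : r ≤ 1 := by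
    rw [hr, div_le_one hsqrt, hqlam]
    linarith [Real.exp_pos (-lam)]
  have := isProbabilityMeasure_conditionedFK n m hq0
  have hcoupling : IsProbabilityMeasure (couplingMeasure n m q) := by
    unfold couplingMeasure; infer_instance
  -- The total mass of P is recovered from the image measure.
  have hP : IsProbabilityMeasure P := by
    rw [← hlaw.map_eq] at hcoupling
    exact (Measure.isProbabilityMeasure_map_iff hlaw.aemeasurable).1 hcoupling
  have hadm : ∀ᵐ x ∂P, Admissible n m (ω x) := by
    have h1 : ∀ᵐ y ∂(P.map fun x => (ω x, U x, U' x)), y.1 ∈ admissibleConfigs n m := by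
      rw [hlaw.map_eq, ae_iff]
      have h2 : {y : Config × (Loop → unitInterval) × (Tile → unitInterval) |
          y.1 ∉ admissibleConfigs n m} = (↑(admissibleConfigs n m) : Set Config)ᶜ ×ˢ Set.univ := by
        ext y; simp
      rw [h2, couplingMeasure, Measure.prod_prod, conditionedFK_compl, zero_mul]
    filter_upwards [ae_of_ae_map hlaw.aemeasurable h1] with x hx
    exact mem_admissibleConfigs.1 hx
  refine ⟨?_, ?_, fun σ hσ => ?_⟩
  · filter_upwards [hadm] with x hx
    exact ⟨_, (hx.isOrientedBy_iff r (U x) _).2 rfl, fun o => (hx.isOrientedBy_iff r (U x) o).1⟩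
  · filter_upwards [hadm] with x hx
    exact hx.existsUnique_isInducedSpin r (U x)
  · obtain ⟨K, hK⟩ := couplingMeasure_spinEvent hq0 hr0 hr1 n m
    obtain ⟨K', hK', hsum⟩ := exists_weight_constant hq0 hqlam n m
    -- By uniqueness of the induced spins, each fibre of σ agrees up to a null set with a measurable
    -- event of the coupling, so no measurability of σ has to be assumed.
    have hae : ∀ s, σ ⁻¹' {s} =ᵐ[P] (fun x => (ω x, U x, U' x)) ⁻¹' spinEvent n m r s := by
      intro s
      filter_upwards [hadm, hσ] with x hx hσx
      apply propext
      change σ x = s ↔ (ω x, U x, U' x) ∈ spinEvent n m r s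
      rw [mem_spinEvent_iff hx]
      constructor
      · rintro rfl
        exact hσx
      · exact fun hs => (hx.existsUnique_isInducedSpin r (U x)).unique hσx hs
    have hF : ∀ s : SpinPair, s ∈ (finite_dobrushinBC n m).toFinset ↔ DobrushinBC n m s :=
      fun s => by simp
    refine hasLaw_proportionalTo (F := (finite_dobrushinBC n m).toFinset) ?_ ?_ ?_
      (K := K * ENNReal.ofReal K') ?_
    · filter_upwards [hadm, hσ] with x hx hσx
      exact (hF _).2 ((hx.isInducedSpin_iff r (U x) _).1 hσx).1
    · intro s _
      exact (hlaw.aemeasurable.nullMeasurable (measurableSet_spinEvent n m r s)).congr (hae s).symm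
    · intro s hs
      rw [spinWeight, if_neg fun h => hs ((hF s).2 h.1)]
    · intro s hs
      rw [measure_congr (hae s), ← Measure.map_apply_of_aemeasurable hlaw.aemeasurable
        (measurableSet_spinEvent n m r s), hlaw.map_eq, hK s ((hF s).1 hs),
        hsum s ((hF s).1 hs), ENNReal.ofReal_mul hK'.le, mul_assoc]
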